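/- Consider the two-user symmetric Gaussian interference channel with real gains $h_d,h_c$, $$y_1=h_dx_1+h_cx_2+z_1,\qquad y_2=h_dx_2+h_cx_1+z_2,$$ where $z_1,z_2\sim\mathcal N(0,1)$ are independent of each other, i.i.d. over time and independent of the messages and of the encoders' randomness. Transmitter $i$ has a uniformly distributed message $W_i$, $W_1$ and $W_2$ are independent, and each transmitter may use private randomness. In each direction the transmitters are joined by a noiseless secure link carrying at most $NC_G$ bits per block of $N$ channel uses ($C_G\ge 0$). The encoding is causal: the link symbol sent by a transmitter at time $k$ depends only on its message, its randomness and the link symbols it received before time $k$, and its channel input at time $k$ depends only on its message, its randomness and the link symbols it received up to time $k$. The inputs satisfy the average power constraint $\frac1N\sum_{k=1}^N E[x_{i,k}^2]\le P$ ($P\ge 0$, $i=1,2$). A symmetric secrecy rate $R_s$ (bits per channel use) is achievable if for every $\varepsilon>0$ and all sufficiently large $N$ there is such a code of block length $N$ in which both message sets have at least $2^{N(R_s-\varepsilon)}$ elements, receiver $i$ decodes $W_i$ from $\mathbf y_i^N$ with error probability at most $\varepsilon$, and weak secrecy holds: $\frac1N I(W_i;\mathbf y_j^N)\le\varepsilon$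 for $i\ne j$. Let $\mathrm{SNR}=h_d^2P$ and $\mathrm{INR}=h_c^2P$. Then every achievable symmetric secrecy rate satisfies $$R_s\le\max_{0\le|\rho|\le1}\frac13\Big[2C_G+\tfrac12\log_2\big(1+\mathrm{SNR}+\mathrm{INR}+2\rho\sqrt{\mathrm{SNR}\,\mathrm{INR}}\big)+\tfrac12\log_2\det\Sigma_{\bar y|\bar s}\Big],$$ where the maximum is attained, $\Sigma_{\bar y|\bar s}=\Sigma_{\bar y}-\Sigma_{\bar y,\bar s}\Sigma_{\bar s}^{-1}\Sigma_{\bar y,\bar s}^{T}$ and $$\Sigma_{\bar y}=\begin{pmatrix}1+\mathrm{SNR}+\mathrm{INR}+2\rho\sqrt{\mathrm{SNR}\,\mathrm{INR}}&2\sqrt{\mathrm{SNR}\,\mathrm{INR}}+\rho(\mathrm{SNR}+\mathrm{INR})\\2\sqrt{\mathrm{SNR}\,\mathrm{INR}}+\rho(\mathrm{SNR}+\mathrm{INR})&1+\mathrm{SNR}+\mathrm{INR}+2\rho\sqrt{\mathrm{SNR}\,\mathrm{INR}}\end{pmatrix},$$ $$\Sigma_{\bar y,\bar s}=\begin{pmatrix}\sqrt{\mathrm{SNR}\,\mathrm{INR}}+\rho\,\mathrm{INR}&\mathrm{INR}+\rho\sqrt{\mathrm{SNR}\,\mathrm{INR}}\\\mathrm{INR}+\rho\sqrt{\mathrm{SNR}\,\mathrm{INR}}&\sqrt{\mathrm{SNR}\,\mathrm{INR}}+\rho\,\mathrm{INR}\end{pmatrix},\qquad\Sigma_{\bar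 s}=\begin{pmatrix}1+\mathrm{INR}&\rho\,\mathrm{INR}\\\rho\,\mathrm{INR}&1+\mathrm{INR}\end{pmatrix}.$$ -/

import Mathlib

open MeasureTheory ProbabilityTheory

noncomputable section

namespace GSIC

/-! ### Information -/

/-- Mutual information `I(X;Y)` under `μ`, in nats: the Kullback-Leibler divergence of the joint law
from the product of the marginal laws. -/
def mutualInfo {Ω A B : Type*} [MeasurableSpace Ω] [MeasurableSpace A] [MeasurableSpace B]
    (μ : Measure Ω) (X : Ω → A) (Y : Ω → B) : ENNReal :=
  InformationTheory.klDiv (μ.map (fun ω => (X ω, Y ω))) ((μ.map X).prod (μ.map Y))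

/-! ### Codes for the two-user interference channel with conferencing transmitters -/

/-- A block code of length `N` with message sets `Fin M₁`, `Fin M₂`. Times are `0, …, N - 1`.
Each transmitter `i` has a private random variable with law `νᵢ` (stochastic encoding; a real random
variable of arbitrary law carries as much randomness as any standard Borel source).
At time `k` transmitter 1 puts the symbol `f₁₂ k w₁ θ₁ l` on the noiseless link to transmitter 2,
where `l` is the list of the symbols it has received over the reverse link at times `< k`; the
symbol belongs to an alphabet of size `size₁₂ k`. The channel input `x₁ k w₁ θ₁ l` may use the
list `l` of the symbols received at times `≤ k`, but no future ones. Symmetrically for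
transmitter 2. Receiver `i` decodes its message from its own output block. -/
structure Code (N M₁ M₂ : ℕ) where
  ν₁ : Measure ℝ
  ν₂ : Measure ℝ
  prob₁ : IsProbabilityMeasure ν₁
  prob₂ : IsProbabilityMeasure ν₂
  size₁₂ : ℕ → ℕ
  size₂₁ : ℕ → ℕ
  f₁₂ : ℕ → Fin M₁ → ℝ → List ℕ → ℕ
  f₂₁ : ℕ → Fin M₂ → ℝ → List ℕ → ℕ
  f₁₂_lt : ∀ k w θ l, f₁₂ k w θ l < size₁₂ k
  f₂₁_lt : ∀ k w θ l, f₂₁ k w θ l < size₂₁ k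
  measurable_f₁₂ : ∀ k w l, Measurable fun θ => f₁₂ k w θ l
  measurable_f₂₁ : ∀ k w l, Measurable fun θ => f₂₁ k w θ l
  x₁ : ℕ → Fin M₁ → ℝ → List ℕ → ℝ
  x₂ : ℕ → Fin M₂ → ℝ → List ℕ → ℝ
  measurable_x₁ : ∀ k w l, Measurable fun θ => x₁ k w θ l
  measurable_x₂ : ∀ k w l, Measurable fun θ => x₂ k w θ l
  dec₁ : (Fin N → ℝ) → Fin M₁
  dec₂ : (Fin N → ℝ) → Fin M₂
  measurable_dec₁ : Measurable dec₁
  measurable_dec₂ : Measurable dec₂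

/-- Sample space: (message 1, randomness 1), (message 2, randomness 2), noise block 1,
noise block 2. -/
abbrev Sample (N M₁ M₂ : ℕ) : Type :=
  (Fin M₁ × ℝ) × (Fin M₂ × ℝ) × (Fin N → ℝ) × (Fin N → ℝ)

namespace Code

variable {N M₁ M₂ : ℕ} (c : Code N M₁ M₂)

/-- The symbols `(v₁₂, v₂₁)` exchanged over the two cooperative links at times `< k`, each list in
chronological order. -/
def transcript (a₁ : Fin M₁ × ℝ) (a₂ : Fin M₂ × ℝ) : ℕ → List ℕ × List ℕ
  | 0 => ([], [])
  | k + 1 =>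
    ((transcript a₁ a₂ k).1 ++ [c.f₁₂ k a₁.1 a₁.2 (transcript a₁ a₂ k).2],
     (transcript a₁ a₂ k).2 ++ [c.f₂₁ k a₂.1 a₂.2 (transcript a₁ a₂ k).1])

/-- The law of the sample: uniform messages, private randomness and i.i.d. standard Gaussian noise,
all independent. -/
def law : Measure (Sample N M₁ M₂) :=
  ((uniformOn (Set.univ : Set (Fin M₁))).prod c.ν₁).prod
    (((uniformOn (Set.univ : Set (Fin M₂))).prod c.ν₂).prod
      ((Measure.pi fun _ : Fin N => gaussianReal 0 1).prod
        (Measure.pi fun _ : Fin N => gaussianReal 0 1)))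

/-- Message of transmitter 1. -/
def msg₁ (ω : Sample N M₁ M₂) : Fin M₁ := ω.1.1

/-- Message of transmitter 2. -/
def msg₂ (ω : Sample N M₁ M₂) : Fin M₂ := ω.2.1.1

/-- Channel input of transmitter 1 at time `k`. -/
def input₁ (ω : Sample N M₁ M₂) (k : Fin N) : ℝ :=
  c.x₁ k ω.1.1 ω.1.2 (c.transcript ω.1 ω.2.1 (k + 1)).2

/-- Channel input of transmitter 2 at time `k`. -/
def input₂ (ω : Sample N M₁ M₂) (k : Fin N) : ℝ :=
  c.x₂ k ω.2.1.1 ω.2.1.2 (c.transcript ω.1 ω.2.1 (k + 1)).1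

/-- Output block at receiver 1: `y₁ = h_d x₁ + h_c x₂ + z₁`. -/
def output₁ (hd hc : ℝ) (ω : Sample N M₁ M₂) (k : Fin N) : ℝ :=
  hd * c.input₁ ω k + hc * c.input₂ ω k + ω.2.2.1 k

/-- Output block at receiver 2: `y₂ = h_d x₂ + h_c x₁ + z₂`. -/
def output₂ (hd hc : ℝ) (ω : Sample N M₁ M₂) (k : Fin N) : ℝ :=
  hd * c.input₂ ω k + hc * c.input₁ ω k + ω.2.2.2 k

/-- In each direction the cooperative link carries at most `N * CG` bits per block. -/
def LinkConstraint (CG : ℝ) : Prop :=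
  ∑ k ∈ Finset.range N, Real.logb 2 (c.size₁₂ k) ≤ N * CG ∧
  ∑ k ∈ Finset.range N, Real.logb 2 (c.size₂₁ k) ≤ N * CG

/-- Average power constraint: `(1/N) ∑ₖ E[xᵢ,ₖ²] ≤ P` for `i = 1, 2`. -/
def PowerConstraint (P : ℝ) : Prop :=
  ∑ k, ∫⁻ ω, ENNReal.ofReal (c.input₁ ω k ^ 2) ∂c.law ≤ ENNReal.ofReal (N * P) ∧
  ∑ k, ∫⁻ ω, ENNReal.ofReal (c.input₂ ω k ^ 2) ∂c.law ≤ ENNReal.ofReal (N * P)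

/-- Each receiver decodes its own message with error probability at most `ε`. -/
def Reliable (hd hc ε : ℝ) : Prop :=
  c.law {ω | c.dec₁ (c.output₁ hd hc ω) ≠ msg₁ ω} ≤ ENNReal.ofReal ε ∧
  c.law {ω | c.dec₂ (c.output₂ hd hc ω) ≠ msg₂ ω} ≤ ENNReal.ofReal ε

/-- Weak secrecy up to `ε`: `I(W₁; y₂ᴺ) ≤ N ε` and `I(W₂; y₁ᴺ) ≤ N ε`, in bits. -/
def WeaklySecret (hd hc ε : ℝ) : Prop :=
  mutualInfo c.law msg₁ (c.output₂ hd hc) ≤ ENNReal.ofReal (N * ε * Real.log 2) ∧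
  mutualInfo c.law msg₂ (c.output₁ hd hc) ≤ ENNReal.ofReal (N * ε * Real.log 2)

end Code

/-- The rate pair `(R₁, R₂)` (bits per channel use) is achievable under weak secrecy: for every
`ε > 0` and all large block lengths there is an admissible code with rates at least `Rᵢ - ε`, error
probabilities at most `ε`, and leakage rates at most `ε`. -/
def Achievable (hd hc P CG R₁ R₂ : ℝ) : Prop :=
  ∀ ε : ℝ, 0 < ε → ∀ᶠ N : ℕ in Filter.atTop, ∃ M₁ M₂ : ℕ, 0 < M₁ ∧ 0 < M₂ ∧
    N * (R₁ - ε) ≤ Real.logb 2 M₁ ∧ N * (R₂ - ε) ≤ Real.logb 2 M₂ ∧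
    ∃ c : Code N M₁ M₂, c.LinkConstraint CG ∧ c.PowerConstraint P ∧
      c.Reliable hd hc ε ∧ c.WeaklySecret hd hc ε

/-- `R` is an achievable symmetric secrecy rate. -/
def SymmetricAchievable (hd hc P CG R : ℝ) : Prop :=
  Achievable hd hc P CG R R

/-! ### The outer bound -/

def sigmaY (SNR INR ρ : ℝ) : Matrix (Fin 2) (Fin 2) ℝ :=
  !![1 + SNR + INR + 2 * ρ * √(SNR * INR), 2 * √(SNR * INR) + ρ * (SNR + INR);
     2 * √(SNR * INR) + ρ * (SNR + INR), 1 + SNR + INR + 2 * ρ * √(SNR * INR)]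

def sigmaYS (SNR INR ρ : ℝ) : Matrix (Fin 2) (Fin 2) ℝ :=
  !![√(SNR * INR) + ρ * INR, INR + ρ * √(SNR * INR);
     INR + ρ * √(SNR * INR), √(SNR * INR) + ρ * INR]

def sigmaS (INR ρ : ℝ) : Matrix (Fin 2) (Fin 2) ℝ :=
  !![1 + INR, ρ * INR;
     ρ * INR, 1 + INR]

/-- The conditional covariance matrix of the outputs given the interference proxies. -/
def sigmaYgivenS (SNR INR ρ : ℝ) : Matrix (Fin 2) (Fin 2) ℝ :=
  sigmaY SNR INR ρ - sigmaYS SNR INR ρ * (sigmaS INR ρ)⁻¹ * (sigmaYS SNR INR ρ).transpose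

/-- The quantity that is maximized over `ρ`; logarithms are to base 2. -/
def outerBound (CG SNR INR ρ : ℝ) : ℝ :=
  (1 / 3) * (2 * CG + (1 / 2) * Real.logb 2 (1 + SNR + INR + 2 * ρ * √(SNR * INR))
    + (1 / 2) * Real.logb 2 (sigmaYgivenS SNR INR ρ).det)

end GSIC

end

noncomputable section

namespace GSIC

open scoped ENNReal NNReal

/-! Write V for the link symbols, s₁ = h_c x₁ + z₂ and s₂ = h_c x₂ + z₁ for the noisy interference,
and s̄ for the pair (s₂, s₁) with its noise replaced by an independent copy z'. Up to decoding-error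
terms, the following inequalities carry the proof.

(a) log M₁ ≤ I(W₁; y₂) + h(y₁ | y₂) − h(z₁), and secrecy makes the first term small
(`decode₁_given_out₂`, `leakage_le`). (b) log M₂ ≤ h(y₂) − h(s₁ | V): the source of transmitter 2
and V determine x₂, and given V the two sources are independent (`decode₂_interference`). (c) log M₁
≤ h(y₁) − h(s₂ | V), likewise (`decode₁_interference`). (d) h(s₁, s₂) ≤ h(s₁ | V) + h(s₂ | V) + log
#V, where log #V is at most 2 N C_G bits (`entropy_links`, `log_card_links_le`). (e) h(y₁, y₂) +
h(z') ≤ h(s̄) + h(y₁, y₂ | s̄), since s̄ is z' plus a signal and z' is independent of the outputs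
(`entropy_genie`).

In the sum h(y₂) cancels, h(s₁, s₂) = h(s̄) because the laws agree, and 2 log M₁ + log M₂ is bounded
by link bits, h(y₁) and h(y₁, y₂ | s̄), less noise entropies. The last two entropies are at most
Gaussian ones, governed by the powers and by the average correlation ρ of the inputs. All
covariances involved are symmetric under exchange of the users, so sums and differences of
components diagonalise them; each direction contributes a factor `condVar`.

No entropy is ever defined. An inequality E log f ≤ E log d follows by Gibbs from ∫ f / d ≤ 1, and
with mixture densities `mix` this integral is Fubini plus cancellation. Logarithms of mixtures are
integrable because a mixture with Gaussian noise has a Gaussian lower bound. `decTest` plays the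
part of Fano's inequality, and the Gaussian maximum entropy principle amounts to choosing Gaussian
densities for f. -/

/-! ### Gibbs' inequality -/

/-- If `∫ f / d ≤ 1`, then the mean of `log f` is at most the mean of `log d`. -/
theorem integral_log_le_of_lintegral_div_le_one {Ω : Type*} [MeasurableSpace Ω] {μ : Measure Ω}
    [IsProbabilityMeasure μ] {f d : Ω → ℝ≥0∞}
    (hf : ∀ᵐ ω ∂μ, f ω ≠ 0 ∧ f ω ≠ ∞) (hd : ∀ᵐ ω ∂μ, d ω ≠ 0 ∧ d ω ≠ ∞)
    (hfi : Integrable (fun ω => Real.log (f ω).toReal) μ)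
    (hdi : Integrable (fun ω => Real.log (d ω).toReal) μ)
    (h : ∫⁻ ω, f ω / d ω ∂μ ≤ 1) :
    ∫ ω, Real.log (f ω).toReal ∂μ ≤ ∫ ω, Real.log (d ω).toReal ∂μ := by
  set L : Ω → ℝ := fun ω => Real.log (f ω).toReal - Real.log (d ω).toReal with hL
  have hLi : Integrable L μ := hfi.sub hdi
  have hexp : ∀ᵐ ω ∂μ, ENNReal.ofReal (Real.exp (L ω)) = f ω / d ω := by
    filter_upwards [hf, hd] with ω h1 h2
    have hf0 : 0 < (f ω).toReal := ENNReal.toReal_pos h1.1 h1.2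
    have hd0 : 0 < (d ω).toReal := ENNReal.toReal_pos h2.1 h2.2
    rw [hL, Real.exp_sub, Real.exp_log hf0, Real.exp_log hd0, ENNReal.ofReal_div_of_pos hd0,
      ENNReal.ofReal_toReal h1.2, ENNReal.ofReal_toReal h2.2]
  have hlin : ∫⁻ ω, ENNReal.ofReal (Real.exp (L ω)) ∂μ ≤ 1 := by
    rw [lintegral_congr_ae hexp]; exact h
  -- Integrability of exp L need not be assumed: `hlin` already bounds its integral.
  have hei : Integrable (fun ω => Real.exp (L ω)) μ := by
    refine ⟨(Real.measurable_exp.comp_aemeasurable hLi.aemeasurable).aestronglyMeasurable, ?_⟩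
    rw [hasFiniteIntegral_iff_ofReal (Filter.Eventually.of_forall fun ω => (Real.exp_pos _).le)]
    exact hlin.trans_lt ENNReal.one_lt_top
  have hint : ∫ ω, Real.exp (L ω) ∂μ ≤ 1 := by
    rw [integral_eq_lintegral_of_nonneg_ae
      (Filter.Eventually.of_forall fun ω => (Real.exp_pos _).le) hei.aestronglyMeasurable]
    exact ENNReal.toReal_le_of_le_ofReal zero_le_one (by simpa using hlin)
  -- Integrate t ≤ exp t − 1; by `hint` the right side is at most 0.
  have h1 : ∫ ω, L ω ∂μ ≤ ∫ ω, (Real.exp (L ω) - 1) ∂μ :=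
    integral_mono hLi (hei.sub (integrable_const _))
      (fun ω => by have := Real.add_one_le_exp (L ω); simp only; linarith)
  rw [integral_sub hei (integrable_const _)] at h1
  simp only [integral_const, probReal_univ, smul_eq_mul, mul_one] at h1
  have h2 : ∫ ω, L ω ∂μ = ∫ ω, Real.log (f ω).toReal ∂μ - ∫ ω, Real.log (d ω).toReal ∂μ :=
    integral_sub hfi hdi
  linarith

/-- Variational lower bound for the Kullback-Leibler divergence. -/
theorem integral_log_le_of_klDiv_le {α : Type*} [MeasurableSpace α] {μ ν : Measure α}
    [IsProbabilityMeasure μ] [IsProbabilityMeasure ν] {f : α → ℝ≥0∞} (hfm : Measurable f)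
    (hf : ∀ᵐ x ∂μ, f x ≠ 0 ∧ f x ≠ ∞)
    (hfi : Integrable (fun x => Real.log (f x).toReal) μ) (h : ∫⁻ x, f x ∂ν ≤ 1)
    {r : ℝ} (hr : 0 ≤ r) (hkl : InformationTheory.klDiv μ ν ≤ ENNReal.ofReal r) :
    ∫ x, Real.log (f x).toReal ∂μ ≤ r := by
  obtain ⟨hac, hllr⟩ := InformationTheory.klDiv_ne_top_iff.1
    (ne_top_of_le_ne_top ENNReal.ofReal_ne_top hkl)
  have hpos : ∀ᵐ x ∂μ, μ.rnDeriv ν x ≠ 0 ∧ μ.rnDeriv ν x ≠ ∞ := by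
    filter_upwards [Measure.rnDeriv_pos hac, hac.ae_le (Measure.rnDeriv_lt_top μ ν)] with x h1 h2
    exact ⟨h1.ne', h2.ne⟩
  -- `f` is a candidate likelihood ratio, compared with the true one. Passing from μ to ν multiplies
  -- by `rnDeriv`, which cancels the denominator and leaves ∫ f dν.
  have key : ∫ x, Real.log (f x).toReal ∂μ ≤ ∫ x, Real.log (μ.rnDeriv ν x).toReal ∂μ := by
    refine integral_log_le_of_lintegral_div_le_one hf hpos hfi hllr ?_
    calc ∫⁻ x, f x / μ.rnDeriv ν x ∂μ
        = ∫⁻ x, f x / μ.rnDeriv ν x ∂(ν.withDensity (μ.rnDeriv ν)) := by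
          rw [Measure.withDensity_rnDeriv_eq _ _ hac]
      _ = ∫⁻ x, μ.rnDeriv ν x * (f x / μ.rnDeriv ν x) ∂ν :=
          lintegral_withDensity_eq_lintegral_mul _ (Measure.measurable_rnDeriv _ _)
            (hfm.div (Measure.measurable_rnDeriv _ _))
      _ ≤ ∫⁻ x, f x ∂ν := lintegral_mono fun x => ENNReal.mul_div_le
      _ ≤ 1 := h
  have hk : (InformationTheory.klDiv μ ν).toReal = ∫ x, llr μ ν x ∂μ :=
    InformationTheory.toReal_klDiv_of_measure_eq hac (by simp)
  have : (InformationTheory.klDiv μ ν).toReal ≤ r := ENNReal.toReal_le_of_le_ofReal hr hkl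
  rw [hk] at this
  exact key.trans this

/-! ### Additive noise -/

/-- `γ` has the density `φ` with respect to the translation invariant reference measure; `φ` is at
most one and decays no faster than a Gaussian whose exponent is the quadratic form `sq`. -/
structure IsNoise {G : Type*} [MeasureSpace G] [AddCommGroup G] (γ : Measure G) (φ : G → ℝ≥0∞)
    (sq : G → ℝ) : Prop where
  measurable : Measurable φ
  eq_withDensity : γ = volume.withDensity φ
  le_one : ∀ u, φ u ≤ 1
  lower : ∃ c : ℝ, 0 < c ∧ ∀ y g, ENNReal.ofReal (c * Real.exp (-sq y) * Real.exp (-sq g)) ≤ φ (y - g)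
  measurable_sq : Measurable sq
  sq_nonneg : ∀ u, 0 ≤ sq u
  sq_add : ∀ u v, sq (u + v) ≤ 2 * (sq u + sq v)
  integrable_sq : Integrable sq γ

/-- Density of the law of `g a + z`, with `a` drawn from `μ` and `z` from the density `φ`. -/
def mix {A G : Type*} [MeasurableSpace A] [AddCommGroup G] (φ : G → ℝ≥0∞) (μ : Measure A) (g : A → G)
    (y : G) : ℝ≥0∞ :=
  ∫⁻ a, φ (y - g a) ∂μ

section Noise

variable {A G : Type*} [MeasurableSpace A] [MeasureSpace G] [AddCommGroup G]
  {γ : Measure G} {φ : G → ℝ≥0∞} {sq : G → ℝ}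

theorem IsNoise.ne_zero (hn : IsNoise γ φ sq) (u : G) : φ u ≠ 0 := by
  obtain ⟨c, hc, h⟩ := hn.lower
  have := h u 0
  rw [sub_zero] at this
  exact (lt_of_lt_of_le (ENNReal.ofReal_pos.2 (by positivity)) this).ne'

theorem IsNoise.ne_top (hn : IsNoise γ φ sq) (u : G) : φ u ≠ ∞ :=
  ((hn.le_one u).trans_lt ENNReal.one_lt_top).ne

theorem IsNoise.mix_le (hn : IsNoise γ φ sq) (μ : Measure A) (g : A → G) (y : G) :
    mix φ μ g y ≤ μ Set.univ := by
  unfold mix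
  calc ∫⁻ a, φ (y - g a) ∂μ ≤ ∫⁻ _, 1 ∂μ := lintegral_mono fun a => hn.le_one _
    _ = μ Set.univ := by simp

/-- A mixture density has a Gaussian lower bound. -/
theorem IsNoise.exists_le_mix (hn : IsNoise γ φ sq) {μ : Measure A} [IsFiniteMeasure μ] (hμ : μ ≠ 0)
    {g : A → G} (hg : Measurable g) :
    ∃ κ : ℝ, 0 < κ ∧ ∀ y, ENNReal.ofReal (κ * Real.exp (-sq y)) ≤ mix φ μ g y := by
  obtain ⟨c, hc, h⟩ := hn.lower
  set K := ∫⁻ a, ENNReal.ofReal (Real.exp (-sq (g a))) ∂μ with hK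
  have hm : Measurable fun a => ENNReal.ofReal (Real.exp (-sq (g a))) := by
    exact (Real.measurable_exp.comp (hn.measurable_sq.comp hg).neg).ennreal_ofReal
  have hK0 : K ≠ 0 := by
    rw [hK, Ne, lintegral_eq_zero_iff hm]
    intro h0
    apply hμ
    have hF : ∀ᵐ a ∂μ, False := by
      filter_upwards [h0] with a ha
      have : (0 : ℝ≥0∞) < ENNReal.ofReal (Real.exp (-sq (g a))) := ENNReal.ofReal_pos.2 (by positivity)
      exact this.ne' ha
    simpa [ae_iff] using hF
  have hKt : K ≠ ∞ := by
    refine ne_top_of_le_ne_top (measure_ne_top μ Set.univ) ?_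
    calc K ≤ ∫⁻ _, 1 ∂μ := lintegral_mono fun a => by
          rw [ENNReal.ofReal_le_one, Real.exp_le_one_iff]
          linarith [hn.sq_nonneg (g a)]
      _ = μ Set.univ := by simp
  refine ⟨c * K.toReal, mul_pos hc (ENNReal.toReal_pos hK0 hKt), fun y => ?_⟩
  calc ENNReal.ofReal (c * K.toReal * Real.exp (-sq y))
      = ENNReal.ofReal (c * Real.exp (-sq y)) * K := by
        rw [mul_right_comm, ENNReal.ofReal_mul (by positivity), ENNReal.ofReal_toReal hKt]
    _ = ∫⁻ a, ENNReal.ofReal (c * Real.exp (-sq y) * Real.exp (-sq (g a))) ∂μ := by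
        rw [hK, ← lintegral_const_mul _ hm]
        refine lintegral_congr fun a => ?_
        rw [← ENNReal.ofReal_mul (by positivity)]
    _ ≤ _ := lintegral_mono fun a => h y (g a)

theorem IsNoise.mix_ne_zero (hn : IsNoise γ φ sq) {μ : Measure A} [IsFiniteMeasure μ] (hμ : μ ≠ 0)
    {g : A → G} (hg : Measurable g) (y : G) : mix φ μ g y ≠ 0 := by
  obtain ⟨κ, hκ, h⟩ := hn.exists_le_mix hμ hg
  exact (lt_of_lt_of_le (ENNReal.ofReal_pos.2 (by positivity)) (h y)).ne'

theorem IsNoise.mix_ne_top (hn : IsNoise γ φ sq) {μ : Measure A} [IsFiniteMeasure μ]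
    (g : A → G) (y : G) : mix φ μ g y ≠ ∞ :=
  ne_top_of_le_ne_top (measure_ne_top μ _) (hn.mix_le μ g y)

/-- The upper bound comes from φ ≤ 1, the lower one from `exists_le_mix`. Hence a finite second
moment of Y makes log `mix` (Y) integrable, whatever the law of the signal. -/
theorem IsNoise.abs_log_mix_le (hn : IsNoise γ φ sq) {μ : Measure A} [IsFiniteMeasure μ]
    {g : A → G} (hg : Measurable g) :
    ∃ C : ℝ, ∀ y, |Real.log (mix φ μ g y).toReal| ≤ C + sq y := by
  -- For μ = 0 the mixture vanishes and the convention `Real.log 0 = 0` gives the claim.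
  by_cases hμ : μ = 0
  · exact ⟨0, fun y => by simp [mix, hμ, hn.sq_nonneg y]⟩
  obtain ⟨κ, hκ, h⟩ := hn.exists_le_mix hμ hg
  refine ⟨|Real.log κ| + |Real.log (μ Set.univ).toReal|, fun y => ?_⟩
  have h1 : κ * Real.exp (-sq y) ≤ (mix φ μ g y).toReal :=
    (ENNReal.ofReal_le_iff_le_toReal (hn.mix_ne_top g y)).1 (h y)
  have h2 : (mix φ μ g y).toReal ≤ (μ Set.univ).toReal :=
    ENNReal.toReal_mono (measure_ne_top μ _) (hn.mix_le μ g y)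
  have h0 : 0 < κ * Real.exp (-sq y) := by positivity
  have l1 := Real.log_le_log h0 h1
  have l2 := Real.log_le_log (h0.trans_le h1) h2
  rw [Real.log_mul hκ.ne' (Real.exp_pos _).ne', Real.log_exp] at l1
  have := hn.sq_nonneg y
  rw [abs_le]
  constructor
  · linarith [neg_abs_le (Real.log κ), abs_nonneg (Real.log (μ Set.univ).toReal)]
  · linarith [abs_nonneg (Real.log κ), le_abs_self (Real.log (μ Set.univ).toReal)]

theorem IsNoise.lintegral_add [MeasurableAdd₂ G] [(volume : Measure G).IsAddLeftInvariant]
    (hn : IsNoise γ φ sq) (g : G) {F : G → ℝ≥0∞} (hF : Measurable F) :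
    ∫⁻ z, F (g + z) ∂γ = ∫⁻ y, φ (y - g) * F y := by
  have h := lintegral_add_left_eq_self (μ := (volume : Measure G)) (fun y => φ (y - g) * F y) g
  rw [← h, hn.eq_withDensity, lintegral_withDensity_eq_lintegral_mul _ hn.measurable
    (show Measurable fun z => F (g + z) from hF.comp (measurable_const_add g))]
  simp

/-- Dividing by the noise density turns the noise law into the volume, and translation invariance
then removes the signal. This is how the terms −h(z) enter the entropy inequalities. -/
theorem IsNoise.lintegral_add_div [MeasurableAdd₂ G] [(volume : Measure G).IsAddLeftInvariant]
    (hn : IsNoise γ φ sq) (g : G) {F : G → ℝ≥0∞} (hF : Measurable F) :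
    ∫⁻ z, F (g + z) / φ z ∂γ = ∫⁻ y, F y := by
  have hm : Measurable fun z => F (g + z) := hF.comp (measurable_const_add g)
  rw [← lintegral_add_left_eq_self (μ := (volume : Measure G)) F g, hn.eq_withDensity,
    lintegral_withDensity_eq_lintegral_mul _ hn.measurable
    (show Measurable fun z => F (g + z) / φ z from hm.div hn.measurable)]
  exact lintegral_congr fun z => ENNReal.mul_div_cancel (hn.ne_zero z) (hn.ne_top z)

variable [MeasurableAdd₂ G] [MeasurableNeg G]

theorem IsNoise.measurable_mix (hn : IsNoise γ φ sq) {μ : Measure A} [SFinite μ] {g : A → G}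
    (hg : Measurable g) : Measurable (mix φ μ g) := by
  unfold mix
  refine Measurable.lintegral_prod_right' (f := fun p : G × A => φ (p.1 - g p.2)) ?_
  exact hn.measurable.comp (measurable_fst.sub (hg.comp measurable_snd))

variable [(volume : Measure G).IsAddLeftInvariant] [SFinite (volume : Measure G)]

/-- The law of a function of `(a, g a + z)`. -/
theorem IsNoise.lintegral_lintegral_add (hn : IsNoise γ φ sq) {μ : Measure A} [SFinite μ] {g : A → G}
    (hg : Measurable g) {F : A → G → ℝ≥0∞} (hF : Measurable (Function.uncurry F)) :
    ∫⁻ a, ∫⁻ z, F a (g a + z) ∂γ ∂μ = ∫⁻ y, ∫⁻ a, φ (y - g a) * F a y ∂μ := by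
  have h1 : ∀ a, ∫⁻ z, F a (g a + z) ∂γ = ∫⁻ y, φ (y - g a) * F a y := fun a =>
    hn.lintegral_add (g a) (hF.comp (measurable_const.prodMk measurable_id))
  simp_rw [h1]
  refine lintegral_lintegral_swap (Measurable.aemeasurable ?_)
  exact (hn.measurable.comp (measurable_snd.sub (hg.comp measurable_fst))).mul hF

/-- This identifies `mix` as the density of signal plus noise. -/
theorem IsNoise.lintegral_mix_mul (hn : IsNoise γ φ sq) {μ : Measure A} [SFinite μ] {g : A → G}
    (hg : Measurable g) {F : G → ℝ≥0∞} (hF : Measurable F) :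
    ∫⁻ a, ∫⁻ z, F (g a + z) ∂γ ∂μ = ∫⁻ y, mix φ μ g y * F y := by
  rw [hn.lintegral_lintegral_add hg (F := fun _ y => F y) (hF.comp measurable_snd)]
  refine lintegral_congr fun y => ?_
  rw [mix, lintegral_mul_const]
  exact hn.measurable.comp (measurable_const.sub hg)

theorem IsNoise.lintegral_mix (hn : IsNoise γ φ sq) [IsProbabilityMeasure γ] {μ : Measure A}
    [SFinite μ] {g : A → G} (hg : Measurable g) : ∫⁻ y, mix φ μ g y = μ Set.univ := by
  have h := hn.lintegral_mix_mul (μ := μ) hg (F := fun _ => 1) measurable_const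
  simpa using h.symm

end Noise

/-! ### Sums over the fibres of a finite-valued map -/

/-- Conditioning on a message or on the link symbols is done by restricting the measure to a fibre,
without normalising; here the fibres are put together again. -/
theorem lintegral_eq_sum_fiber {A ι : Type*} [MeasurableSpace A] [Fintype ι] [MeasurableSpace ι]
    [MeasurableSingletonClass ι] {μ : Measure A} {D : A → ι} (hD : Measurable D) (f : A → ℝ≥0∞) :
    ∫⁻ a, f a ∂μ = ∑ i, ∫⁻ a in D ⁻¹' {i}, f a ∂μ := by
  have h := lintegral_biUnion_finset (μ := μ) (s := (Finset.univ : Finset ι)) (t := fun i => D ⁻¹' {i})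
    (fun i _ j _ hij => Disjoint.preimage D (by simpa using hij))
    (fun i _ => hD (measurableSet_singleton i)) f
  rw [← h]
  have : (⋃ i ∈ (Finset.univ : Finset ι), D ⁻¹' {i}) = Set.univ := by ext; simp
  rw [this, Measure.restrict_univ]

/-- This and the next two instances allow a pair of noise blocks to be treated as one noise with
values in a product group. -/
instance {E F : Type*} [MeasurableSpace E] [MeasurableSpace F] [Add E] [Add F] [MeasurableAdd₂ E]
    [MeasurableAdd₂ F] : MeasurableAdd₂ (E × F) :=
  ⟨(measurable_fst.fst.add measurable_snd.fst).prodMk (measurable_fst.snd.add measurable_snd.snd)⟩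

instance {E F : Type*} [MeasurableSpace E] [MeasurableSpace F] [Neg E] [Neg F] [MeasurableNeg E]
    [MeasurableNeg F] : MeasurableNeg (E × F) :=
  ⟨measurable_fst.neg.prodMk measurable_snd.neg⟩

instance {E F : Type*} [MeasureSpace E] [MeasureSpace F] [AddGroup E] [AddGroup F] [MeasurableAdd E]
    [MeasurableAdd F] [(volume : Measure E).IsAddLeftInvariant] [(volume : Measure F).IsAddLeftInvariant]
    [SFinite (volume : Measure E)] [SFinite (volume : Measure F)] :
    (volume : Measure (E × F)).IsAddLeftInvariant :=
  inferInstanceAs ((volume : Measure E).prod (volume : Measure F)).IsAddLeftInvariant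

/-! ### The entropy inequalities in the form ∫ f / d ≤ 1 -/

section Steps

variable {A A₁ A₂ E : Type*} [MeasurableSpace A] [MeasurableSpace A₁] [MeasurableSpace A₂]
  [MeasureSpace E] [AddCommGroup E] [MeasurableAdd₂ E]
  [MeasurableNeg E] {γ : Measure E} {φ : E → ℝ≥0∞} {sq : E → ℝ}

/-- Density of a pair of independent noises. -/
def pairPDF (φ : E → ℝ≥0∞) (u : E × E) : ℝ≥0∞ := φ u.1 * φ u.2

/-- Independent sources with independent noises have a product density. The components are crossed
because receiver 1 hears the interference of transmitter 2. -/
theorem mix_pairPDF (hφ : Measurable φ) {m₁ : Measure A₁} {m₂ : Measure A₂} [SFinite m₁] [SFinite m₂]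
    {g₁ : A₁ → E} {g₂ : A₂ → E} (h₁ : Measurable g₁) (h₂ : Measurable g₂) (s : E × E) :
    mix (pairPDF φ) (m₁.prod m₂) (fun a => (g₂ a.2, g₁ a.1)) s = mix φ m₁ g₁ s.2 * mix φ m₂ g₂ s.1 := by
  unfold mix pairPDF
  have e₁ : Measurable fun a => φ (s.2 - g₁ a) := hφ.comp (measurable_const.sub h₁)
  have e₂ : Measurable fun a => φ (s.1 - g₂ a) := hφ.comp (measurable_const.sub h₂)
  rw [← lintegral_prod_mul e₁.aemeasurable e₂.aemeasurable]
  exact lintegral_congr fun a => mul_comm _ _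

variable [(volume : Measure E).IsAddLeftInvariant] [SFinite (volume : Measure E)]

theorem ENNReal_div_mul_eq {a b c : ℝ≥0∞} (h0 : c ≠ 0) (ht : c ≠ ∞) : a / (b * c) = a / b / c := by
  rw [div_eq_mul_inv, ENNReal.mul_inv (Or.inr ht) (Or.inr h0), ← mul_assoc]; rfl

/-- Decoding from `y₁` against observing `y₂`: the information on `W` that `y₁` has beyond
`y₂` is at most `h(y₁ | y₂) - h(z₁)`. -/
theorem lintegral_decode_given_other_le_one (hn : IsNoise γ φ sq) [SFinite γ]
    {μ : Measure A} [IsFiniteMeasure μ]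
    {M : ℕ} (hM : 0 < M) {W : A → Fin M} (hW : Measurable W) {b₁ b₂ : A → E}
    (hb₂ : Measurable b₂) {t : Fin M → E → ℝ≥0∞} (ht : ∀ w, Measurable (t w))
    (hts : ∀ y, ∑ w, t w y ≤ M) {p : E × E → ℝ≥0∞} (hp : Measurable p)
    (hp1 : ∫⁻ y, p y ∂(volume.prod volume) ≤ 1) :
    ∫⁻ a, ∫⁻ z, t (W a) (b₁ a + z.1) * p (b₁ a + z.1, b₂ a + z.2) /
      (M * mix φ (μ.restrict (W ⁻¹' {W a})) b₂ (b₂ a + z.2) * φ z.1) ∂(γ.prod γ) ∂μ ≤ 1 := by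
  -- Unnormalised: the density of y₂ on the event W = w.
  set r : Fin M → E → ℝ≥0∞ := fun w => mix φ (μ.restrict (W ⁻¹' {w})) b₂ with hr
  have hrm : ∀ w, Measurable (r w) := fun w => hn.measurable_mix hb₂
  set H : Fin M → E × E → ℝ≥0∞ := fun w y => t w y.1 * p y / (M * r w y.2) with hH
  have hHm : ∀ w, Measurable (H w) := fun w =>
    (((ht w).comp measurable_fst).mul hp).div (((hrm w).comp measurable_snd).const_mul _)
  have hHm' : Measurable (Function.uncurry H) := measurable_from_prod_countable_right hHm
  set J : A → E → ℝ≥0∞ := fun a y => ∫⁻ z, H (W a) (y, b₂ a + z) ∂γ with hJ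
  have hJm : Measurable (Function.uncurry J) := by
    refine Measurable.lintegral_prod_right' (ν := γ)
      (f := fun x : (A × E) × E => H (W x.1.1) (x.1.2, b₂ x.1.1 + x.2)) ?_
    exact hHm'.comp ((hW.comp (measurable_fst.comp measurable_fst)).prodMk
      ((measurable_snd.comp measurable_fst).prodMk
        ((hb₂.comp (measurable_fst.comp measurable_fst)).add measurable_snd)))
  have h1 : ∀ a, ∫⁻ z, t (W a) (b₁ a + z.1) * p (b₁ a + z.1, b₂ a + z.2) /
      (M * mix φ (μ.restrict (W ⁻¹' {W a})) b₂ (b₂ a + z.2) * φ z.1) ∂(γ.prod γ)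
      = ∫⁻ y, J a y := by
    intro a
    have e : ∀ z : E × E, t (W a) (b₁ a + z.1) * p (b₁ a + z.1, b₂ a + z.2) /
      (M * mix φ (μ.restrict (W ⁻¹' {W a})) b₂ (b₂ a + z.2) * φ z.1)
      = H (W a) (b₁ a + z.1, b₂ a + z.2) / φ z.1 := fun z =>
        ENNReal_div_mul_eq (hn.ne_zero _) (hn.ne_top _)
    have hm : Measurable fun z : E × E => H (W a) (b₁ a + z.1, b₂ a + z.2) :=
      (hHm _).comp (by fun_prop)
    simp_rw [e]
    have hm2 : Measurable fun z : E × E => H (W a) (b₁ a + z.1, b₂ a + z.2) / φ z.1 :=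
      hm.div (hn.measurable.comp measurable_fst)
    rw [lintegral_prod _ hm2.aemeasurable]
    -- The factor 1 / φ z.1 makes y₁ a volume variable that no longer depends on the source.
    rw [← hn.lintegral_add_div (b₁ a) (F := J a) (hJm.comp (measurable_const.prodMk measurable_id))]
    refine lintegral_congr fun z => ?_
    simp_rw [div_eq_mul_inv]
    rw [lintegral_mul_const]
    exact hm.comp (measurable_const.prodMk measurable_id)
  simp_rw [h1]
  rw [lintegral_lintegral_swap hJm.aemeasurable]
  -- For fixed y₁ the integral over the source splits by message; on each fibre the law of y₂ has
  -- density `r w`, which cancels the denominator, and the sum of the tests cancels `M`.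
  have h2 : ∀ y₁, ∫⁻ a, J a y₁ ∂μ ≤ ∫⁻ y₂, p (y₁, y₂) := by
    intro y₁
    rw [hJ]
    have hm : Measurable (Function.uncurry fun (a : A) (y : E) => H (W a) (y₁, y)) :=
      hHm'.comp ((hW.comp measurable_fst).prodMk (measurable_const.prodMk measurable_snd))
    rw [hn.lintegral_lintegral_add hb₂ (F := fun a y => H (W a) (y₁, y)) hm]
    refine lintegral_mono fun y₂ => ?_
    rw [lintegral_eq_sum_fiber hW]
    calc ∑ w, ∫⁻ a in W ⁻¹' {w}, φ (y₂ - b₂ a) * H (W a) (y₁, y₂) ∂μ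
        = ∑ w, r w y₂ * H w (y₁, y₂) := by
          refine Finset.sum_congr rfl fun w _ => ?_
          rw [setLIntegral_congr_fun (g := fun a => φ (y₂ - b₂ a) * H w (y₁, y₂))
            (hW (measurableSet_singleton w)) (fun a ha => by
              have : W a = w := ha
              simp only [this])]
          rw [lintegral_mul_const _ (show Measurable fun a => φ (y₂ - b₂ a) from
            hn.measurable.comp (measurable_const.sub hb₂))]
          rfl
      _ ≤ ∑ w, t w y₁ * p (y₁, y₂) / M := by
          refine Finset.sum_le_sum fun w _ => ?_
          have hrt : r w y₂ ≠ ∞ := hn.mix_ne_top _ _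
          by_cases hr0 : r w y₂ = 0
          · rw [hr0, zero_mul]; exact zero_le
          · rw [hH]
            simp only
            rw [ENNReal_div_mul_eq hr0 hrt]
            exact ENNReal.mul_div_le
      _ = (∑ w, t w y₁) * p (y₁, y₂) / M := by
          simp_rw [div_eq_mul_inv, Finset.sum_mul]
      _ ≤ M * p (y₁, y₂) / M := by gcongr; exact hts y₁
      _ = p (y₁, y₂) := by
          rw [mul_div_assoc]
          exact ENNReal.mul_div_cancel (by exact_mod_cast hM.ne') (ENNReal.natCast_ne_top M)
  calc ∫⁻ y₁, ∫⁻ a, J a y₁ ∂μ ≤ ∫⁻ y₁, ∫⁻ y₂, p (y₁, y₂) := lintegral_mono h2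
    _ = ∫⁻ y, p y ∂(volume.prod volume) := (lintegral_prod _ hp.aemeasurable).symm
    _ ≤ 1 := hp1

/-- `h(y) + h(z') ≤ h(s) + h(y | s)` for `y = b + z` and `s = g + z'` with independent noises, where
any conditional density `q` may be used for the last entropy. -/
theorem lintegral_genie_le_one (hn : IsNoise γ φ sq) [SFinite γ] {μ : Measure A} [IsFiniteMeasure μ]
    {b g : A → E} (hb : Measurable b) {p : E → ℝ≥0∞} (hp : Measurable p)
    (hp1 : ∫⁻ s, p s ≤ 1) {q : E → E → ℝ≥0∞} (hq : Measurable (Function.uncurry q))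
    (hq1 : ∀ s, ∫⁻ y, q y s ≤ 1) :
    ∫⁻ a, ∫⁻ z, ∫⁻ z', p (g a + z') * q (b a + z) (g a + z') / (mix φ μ b (b a + z) * φ z')
      ∂γ ∂γ ∂μ ≤ 1 := by
  have hmm := hn.measurable_mix (μ := μ) hb
  have hF : Measurable fun x : E × E => p x.2 * q x.1 x.2 / mix φ μ b x.1 :=
    ((hp.comp measurable_snd).mul hq).div (hmm.comp measurable_fst)
  set K : E → ℝ≥0∞ := fun y => ∫⁻ s, p s * q y s / mix φ μ b y with hK
  have hKm : Measurable K := hF.lintegral_prod_right'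
  have h1 : ∀ a z, ∫⁻ z', p (g a + z') * q (b a + z) (g a + z') / (mix φ μ b (b a + z) * φ z') ∂γ
      = K (b a + z) := by
    intro a z
    simp_rw [ENNReal_div_mul_eq (hn.ne_zero _) (hn.ne_top _)]
    -- As z' is independent of (a, z), dividing by φ z' turns s into a volume variable decoupled
    -- from y.
    exact hn.lintegral_add_div (g a) (F := fun s => p s * q (b a + z) s / mix φ μ b (b a + z))
      (hF.comp (measurable_const.prodMk measurable_id))
  simp_rw [h1]
  rw [hn.lintegral_mix_mul hb hKm]
  calc ∫⁻ y, mix φ μ b y * K y ≤ ∫⁻ y, ∫⁻ s, p s * q y s := by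
        refine lintegral_mono fun y => ?_
        rw [hK]
        simp only
        rw [← lintegral_const_mul _ (show Measurable fun s => p s * q y s / mix φ μ b y from
          hF.comp (measurable_const.prodMk measurable_id))]
        exact lintegral_mono fun s => ENNReal.mul_div_le
    _ = ∫⁻ s, ∫⁻ y, p s * q y s :=
        lintegral_lintegral_swap ((hp.comp measurable_snd).mul hq).aemeasurable
    _ ≤ ∫⁻ s, p s := by
        refine lintegral_mono fun s => ?_
        rw [lintegral_const_mul _ (show Measurable fun y => q y s from
          hq.comp (measurable_id.prodMk measurable_const))]
        exact mul_le_of_le_one_right' (hq1 s)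
    _ ≤ 1 := hp1

/-- Decoding from `y = d + g + z`: given the link symbols `V` and `d`, the entropy of `y` is
that of `g + z` given `V` alone. Any density `p` may be used for the entropy of `y`. -/
theorem lintegral_decode_interference_le_one (hn : IsNoise γ φ sq) [SFinite γ]
    {m₁ : Measure A₁} {m₂ : Measure A₂} [IsProbabilityMeasure m₁] [IsProbabilityMeasure m₂]
    {ι : Type*} [Fintype ι] [MeasurableSpace ι] [MeasurableSingletonClass ι]
    {V : A₁ → A₂ → ι} {R₁ : ι → Set A₁} {R₂ : ι → Set A₂} (hR₁ : ∀ v, MeasurableSet (R₁ v))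
    (hV : ∀ a₁ a₂ v, V a₁ a₂ = v ↔ a₁ ∈ R₁ v ∧ a₂ ∈ R₂ v)
    {g : ι → A₁ → E} {d : ι → A₂ → E} (hg : ∀ v, Measurable (g v))
    {t : A₂ → E → ℝ≥0∞} (ht : Measurable (Function.uncurry t)) (ht1 : ∀ y, ∫⁻ a, t a y ∂m₂ ≤ 1)
    {p : E → ℝ≥0∞} (hp : Measurable p) (hp1 : ∫⁻ y, p y ≤ 1) :
    ∫⁻ a₂, ∫⁻ a₁, ∫⁻ z, t a₂ (d (V a₁ a₂) a₂ + g (V a₁ a₂) a₁ + z)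
      * p (d (V a₁ a₂) a₂ + g (V a₁ a₂) a₁ + z) * m₁ (R₁ (V a₁ a₂)) /
      mix φ (m₁.restrict (R₁ (V a₁ a₂))) (g (V a₁ a₂)) (g (V a₁ a₂) a₁ + z) ∂γ ∂m₁ ∂m₂ ≤ 1 := by
  have htm : ∀ a, Measurable (t a) := fun a => ht.comp (measurable_const.prodMk measurable_id)
  set T : A₂ → ℝ≥0∞ := fun a => ∫⁻ y, t a y * p y with hT
  -- For fixed a₂ every fibre is `R₁ v` or empty.
  have hVm : ∀ a₂, Measurable fun a₁ => V a₁ a₂ := by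
    intro a₂
    refine measurable_to_countable' fun v => ?_
    by_cases h : a₂ ∈ R₂ v
    · convert hR₁ v using 1; ext a₁; simp [hV, h]
    · convert MeasurableSet.empty using 1; ext a₁; simp [hV, h]
  -- Given a₂ and V = v, the term `d v a₂` is a known shift and a₁ ranges over `R₁ v`, a set
  -- independent of a₂. The density of `g v a₁ + z` cancels the denominator, translation invariance
  -- absorbs the shift, and `m₁ (R₁ v) * T a₂` remains.
  have h1 : ∀ a₂, ∫⁻ a₁, ∫⁻ z, t a₂ (d (V a₁ a₂) a₂ + g (V a₁ a₂) a₁ + z)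
      * p (d (V a₁ a₂) a₂ + g (V a₁ a₂) a₁ + z) * m₁ (R₁ (V a₁ a₂)) /
      mix φ (m₁.restrict (R₁ (V a₁ a₂))) (g (V a₁ a₂)) (g (V a₁ a₂) a₁ + z) ∂γ ∂m₁ ≤ T a₂ := by
    intro a₂
    rw [lintegral_eq_sum_fiber (hVm a₂)]
    calc _ ≤ ∑ v, m₁ ((fun a₁ => V a₁ a₂) ⁻¹' {v}) * T a₂ := by
          refine Finset.sum_le_sum fun v _ => ?_
          by_cases h : a₂ ∈ R₂ v
          swap
          · have : (fun a₁ => V a₁ a₂) ⁻¹' {v} = ∅ := by ext a₁; simp [hV, h]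
            rw [this]; simp
          have hset : (fun a₁ => V a₁ a₂) ⁻¹' {v} = R₁ v := by ext a₁; simp [hV, h]
          rw [hset]
          set ρ := mix φ (m₁.restrict (R₁ v)) (g v) with hρ
          have hρm : Measurable ρ := hn.measurable_mix (hg v)
          rw [setLIntegral_congr_fun (g := fun a₁ => ∫⁻ z, t a₂ (d v a₂ + (g v a₁ + z))
            * p (d v a₂ + (g v a₁ + z)) * m₁ (R₁ v) / ρ (g v a₁ + z) ∂γ) (hR₁ v) (fun a₁ ha => by
              have : V a₁ a₂ = v := (hV _ _ _).2 ⟨ha, h⟩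
              simp only [this, ← add_assoc]; rfl)]
          have hadd : Measurable fun s : E => d v a₂ + s := measurable_const_add _
          have hFm : Measurable fun s => t a₂ (d v a₂ + s) * p (d v a₂ + s) :=
            ((htm a₂).comp hadd).mul (hp.comp hadd)
          rw [hn.lintegral_mix_mul (hg v) (F := fun s => t a₂ (d v a₂ + s)
            * p (d v a₂ + s) * m₁ (R₁ v) / ρ s) ((hFm.mul_const _).div hρm)]
          calc ∫⁻ s, ρ s * (t a₂ (d v a₂ + s) * p (d v a₂ + s) * m₁ (R₁ v) / ρ s)
              ≤ ∫⁻ s, t a₂ (d v a₂ + s) * p (d v a₂ + s) * m₁ (R₁ v) :=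
                lintegral_mono fun s => ENNReal.mul_div_le
            _ = m₁ (R₁ v) * T a₂ := by
                rw [lintegral_mul_const _ hFm, mul_comm,
                  lintegral_add_left_eq_self (fun s => t a₂ s * p s) (d v a₂)]
      -- The fibres of V(·, a₂) partition the sources, so their masses add up to 1.
      _ = T a₂ := by
          rw [← Finset.sum_mul]
          have := lintegral_eq_sum_fiber (μ := m₁) (hVm a₂) (fun _ => 1)
          simp only [lintegral_const, one_mul, measure_univ, Measure.restrict_apply_univ] at this
          rw [← this, one_mul]
  calc _ ≤ ∫⁻ a₂, T a₂ ∂m₂ := lintegral_mono h1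
    _ = ∫⁻ y, ∫⁻ a₂, t a₂ y * p y ∂m₂ :=
        lintegral_lintegral_swap (ht.mul (hp.comp measurable_snd)).aemeasurable
    _ ≤ ∫⁻ y, p y := by
        refine lintegral_mono fun y => ?_
        rw [lintegral_mul_const _ (show Measurable fun a => t a y from
          ht.comp (measurable_id.prodMk measurable_const))]
        exact mul_le_of_le_one_left' (ht1 y)
    _ ≤ 1 := hp1

/-- `h(s₁, s₂) ≤ h(s₁ | V) + h(s₂ | V) + log #V` when `s₁`, `s₂` are independent given `V`. -/
theorem lintegral_link_le_one (hφ : Measurable φ) {sq₂ : E × E → ℝ} {γ₂ : Measure (E × E)} [IsProbabilityMeasure γ₂]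
    (hn : IsNoise γ₂ (pairPDF φ) sq₂)
    {m₁ : Measure A₁} {m₂ : Measure A₂} [IsProbabilityMeasure m₁] [IsProbabilityMeasure m₂]
    {ι : Type*} [Fintype ι] [MeasurableSpace ι] [MeasurableSingletonClass ι]
    {V : A₁ → A₂ → ι} (hVm : Measurable fun a : A₁ × A₂ => V a.1 a.2)
    {R₁ : ι → Set A₁} {R₂ : ι → Set A₂} (hR₁ : ∀ v, MeasurableSet (R₁ v))
    (hR₂ : ∀ v, MeasurableSet (R₂ v))
    (hV : ∀ a₁ a₂ v, V a₁ a₂ = v ↔ a₁ ∈ R₁ v ∧ a₂ ∈ R₂ v)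
    {g₁ : ι → A₁ → E} {g₂ : ι → A₂ → E} (h₁ : ∀ v, Measurable (g₁ v)) (h₂ : ∀ v, Measurable (g₂ v))
    {p : E × E → ℝ≥0∞} (hp : Measurable p) (hpt : ∀ s, p s ≠ ∞)
    (hpg : ∀ s, mix (pairPDF φ) (m₁.prod m₂)
      (fun a => (g₂ (V a.1 a.2) a.2, g₁ (V a.1 a.2) a.1)) s ≤ p s) :
    ∫⁻ a, ∫⁻ z, mix φ (m₁.restrict (R₁ (V a.1 a.2))) (g₁ (V a.1 a.2)) (g₁ (V a.1 a.2) a.1 + z.2) *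
        mix φ (m₂.restrict (R₂ (V a.1 a.2))) (g₂ (V a.1 a.2)) (g₂ (V a.1 a.2) a.2 + z.1) /
        (m₁ (R₁ (V a.1 a.2)) * m₂ (R₂ (V a.1 a.2)) * Fintype.card ι *
          p (g₂ (V a.1 a.2) a.2 + z.1, g₁ (V a.1 a.2) a.1 + z.2)) ∂γ₂ ∂(m₁.prod m₂) ≤ 1 := by
  rw [lintegral_eq_sum_fiber hVm]
  -- Every v contributes at most 1 / #ι. On the rectangle the numerator is the joint density ρ, and
  -- the law of the pair supplies ρ once more: one factor is dominated by `p`, the other integrates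
  -- to `m₁ (R₁ v) * m₂ (R₂ v)`, which the denominator contains.
  have key : ∀ v, ∫⁻ a in (fun a : A₁ × A₂ => V a.1 a.2) ⁻¹' {v}, ∫⁻ z,
      mix φ (m₁.restrict (R₁ (V a.1 a.2))) (g₁ (V a.1 a.2)) (g₁ (V a.1 a.2) a.1 + z.2) *
        mix φ (m₂.restrict (R₂ (V a.1 a.2))) (g₂ (V a.1 a.2)) (g₂ (V a.1 a.2) a.2 + z.1) /
        (m₁ (R₁ (V a.1 a.2)) * m₂ (R₂ (V a.1 a.2)) * Fintype.card ι *
          p (g₂ (V a.1 a.2) a.2 + z.1, g₁ (V a.1 a.2) a.1 + z.2)) ∂γ₂ ∂(m₁.prod m₂)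
      ≤ (Fintype.card ι : ℝ≥0∞)⁻¹ := by
    intro v
    have hset : (fun a : A₁ × A₂ => V a.1 a.2) ⁻¹' {v} = R₁ v ×ˢ R₂ v := by ext a; simp [hV]
    set ρ : E × E → ℝ≥0∞ := mix (pairPDF φ) ((m₁.restrict (R₁ v)).prod (m₂.restrict (R₂ v)))
      (fun a => (g₂ v a.2, g₁ v a.1)) with hρ
    have hgm : Measurable fun a : A₁ × A₂ => (g₂ v a.2, g₁ v a.1) :=
      ((h₂ v).comp measurable_snd).prodMk ((h₁ v).comp measurable_fst)
    have hρm : Measurable ρ := hn.measurable_mix hgm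
    -- ρ is the part of the full mixture that comes from V = v.
    have hρp : ∀ s, ρ s ≤ p s := by
      intro s
      refine le_trans ?_ (hpg s)
      rw [hρ, Measure.prod_restrict, mix, mix]
      rw [setLIntegral_congr_fun (g := fun a : A₁ × A₂ => pairPDF φ
        (s - (g₂ (V a.1 a.2) a.2, g₁ (V a.1 a.2) a.1))) ((hR₁ v).prod (hR₂ v)) (fun a ha => by
          have : V a.1 a.2 = v := (hV _ _ _).2 ha
          simp only [this])]
      exact setLIntegral_le_lintegral _ _
    set D : ℝ≥0∞ := m₁ (R₁ v) * m₂ (R₂ v) * Fintype.card ι with hD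
    have hDt : D ≠ ∞ := ENNReal.mul_ne_top
      (ENNReal.mul_ne_top (measure_ne_top _ _) (measure_ne_top _ _)) (ENNReal.natCast_ne_top _)
    rw [hset, setLIntegral_congr_fun (g := fun a : A₁ × A₂ =>
      ∫⁻ z, (fun s => ρ s / (D * p s)) ((g₂ v a.2, g₁ v a.1) + z) ∂γ₂) ((hR₁ v).prod (hR₂ v)) (fun a ha => by
          have : V a.1 a.2 = v := (hV _ _ _).2 ha
          simp only [this]
          refine lintegral_congr fun z => ?_
          rw [hρ, mix_pairPDF hφ (h₁ v) (h₂ v)]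
          rfl), ← Measure.prod_restrict]
    rw [hn.lintegral_mix_mul hgm (F := fun s => ρ s / (D * p s)) (hρm.div (hp.const_mul _))]
    calc ∫⁻ s, ρ s * (ρ s / (D * p s)) ≤ ∫⁻ s, ρ s / D := by
          refine lintegral_mono fun s => ?_
          rw [div_eq_mul_inv, ENNReal.mul_inv (Or.inr (hpt s)) (Or.inl hDt), div_eq_mul_inv]
          gcongr
          calc ρ s * (D⁻¹ * (p s)⁻¹) = D⁻¹ * (ρ s / p s) := by rw [div_eq_mul_inv]; ring
            _ ≤ D⁻¹ * 1 := by gcongr; exact ENNReal.div_le_of_le_mul (by simpa using hρp s)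
            _ = D⁻¹ := mul_one _
      _ = (m₁ (R₁ v) * m₂ (R₂ v)) / D := by
          simp_rw [div_eq_mul_inv]
          rw [lintegral_mul_const _ hρm, hn.lintegral_mix hgm, ← Set.univ_prod_univ,
            Measure.prod_prod, Measure.restrict_apply_univ, Measure.restrict_apply_univ]
      _ ≤ (Fintype.card ι : ℝ≥0∞)⁻¹ := by
          -- This form does not require D ≠ 0, so values v of probability zero are covered.
          refine ENNReal.div_le_of_le_mul ?_
          by_cases h0 : Fintype.card ι = 0
          · have := Fintype.card_eq_zero_iff.1 h0
            exact isEmptyElim v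
          · refine le_of_eq ?_
            calc m₁ (R₁ v) * m₂ (R₂ v)
                = m₁ (R₁ v) * m₂ (R₂ v) * (Fintype.card ι * (Fintype.card ι : ℝ≥0∞)⁻¹) := by
                  rw [ENNReal.mul_inv_cancel (by exact_mod_cast h0) (ENNReal.natCast_ne_top _),
                    mul_one]
              _ = _ := by rw [hD]; ring
  calc _ ≤ ∑ _v : ι, (Fintype.card ι : ℝ≥0∞)⁻¹ := Finset.sum_le_sum fun v _ => key v
    _ = Fintype.card ι * (Fintype.card ι : ℝ≥0∞)⁻¹ := by simp
    _ ≤ 1 := ENNReal.mul_inv_le_one _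

end Steps

/-! ### Gaussian densities on `Fin n → ℝ` -/

theorem lintegral_fin_prod_eq_prod {n : ℕ} (μ : Fin n → Measure ℝ) [∀ k, SigmaFinite (μ k)]
    {f : Fin n → ℝ → ℝ≥0∞} (hf : ∀ k, Measurable (f k)) :
    ∫⁻ x, ∏ k, f k (x k) ∂(Measure.pi μ) = ∏ k, ∫⁻ x, f k x ∂(μ k) := by
  induction n with
  | zero => simp
  | succ n ih =>
    have h := (measurePreserving_piFinSuccAbove μ 0).symm.lintegral_comp_emb
      (MeasurableEquiv.measurableEmbedding _) (fun x : Fin (n + 1) → ℝ => ∏ k, f k (x k))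
    rw [← h]
    simp only [MeasurableEquiv.piFinSuccAbove_symm_apply, Fin.insertNthEquiv,
      Fin.prod_univ_succ, Fin.insertNth_zero, Equiv.coe_fn_mk, Fin.cons_succ,
      Fin.zero_succAbove, Fin.cons_zero, cast_eq]
    rw [lintegral_prod_mul (hf 0).aemeasurable (g := fun x : Fin n → ℝ => ∏ k, f k.succ (x k))
      (Finset.measurable_fun_prod _ fun k _ => (hf _).comp (measurable_pi_apply k)).aemeasurable, ih (fun k => μ k.succ) (fun k => hf _)]

/-- The density of independent Gaussian coordinates with means `m k` and common variance `v`. -/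
def gaussPDF {n : ℕ} (m : Fin n → ℝ) (v : ℝ≥0) (u : Fin n → ℝ) : ℝ≥0∞ :=
  ∏ k, gaussianPDF (m k) v (u k)

variable {n : ℕ}

theorem measurable_gaussPDF {α : Type*} [MeasurableSpace α] {m u : α → Fin n → ℝ}
    (hm : Measurable m) (hu : Measurable u) (v : ℝ≥0) :
    Measurable fun a => gaussPDF (m a) v (u a) := by
  unfold gaussPDF
  refine Finset.measurable_fun_prod _ fun k _ => ?_
  exact measurable_uncurry_gaussianPDF.comp (((measurable_pi_apply k).comp hm).prodMk
    (measurable_const.prodMk ((measurable_pi_apply k).comp hu)))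

theorem lintegral_gaussPDF (m : Fin n → ℝ) {v : ℝ≥0} (hv : v ≠ 0) : ∫⁻ u, gaussPDF m v u = 1 := by
  unfold gaussPDF
  rw [volume_pi, lintegral_fin_prod_eq_prod (fun _ => volume) (fun k => measurable_gaussianPDF _ _)]
  simp [lintegral_gaussianPDF_eq_one _ hv]

theorem gaussPDF_ne_zero (m : Fin n → ℝ) {v : ℝ≥0} (hv : v ≠ 0) (u : Fin n → ℝ) :
    gaussPDF m v u ≠ 0 :=
  Finset.prod_ne_zero_iff.2 fun _ _ => (gaussianPDF_pos _ hv _).ne'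

theorem gaussPDF_ne_top (m : Fin n → ℝ) (v : ℝ≥0) (u : Fin n → ℝ) : gaussPDF m v u ≠ ∞ :=
  ENNReal.prod_ne_top fun _ _ => gaussianPDF_ne_top

theorem log_gaussPDF (m : Fin n → ℝ) {v : ℝ≥0} (hv : v ≠ 0) (u : Fin n → ℝ) :
    Real.log (gaussPDF m v u).toReal
      = -(n / 2 * Real.log (2 * Real.pi * v)) - (∑ k, (u k - m k) ^ 2) / (2 * v) := by
  have hv' : (0 : ℝ) < v := by positivity
  have h2 : 0 < 2 * Real.pi * (v : ℝ) := by positivity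
  unfold gaussPDF
  rw [ENNReal.toReal_prod, Real.log_prod fun k _ => by
    rw [toReal_gaussianPDF]; exact (gaussianPDFReal_pos _ _ _ hv).ne']
  simp_rw [toReal_gaussianPDF, gaussianPDFReal]
  have : ∀ k, Real.log ((√(2 * Real.pi * v))⁻¹ * Real.exp (-(u k - m k) ^ 2 / (2 * v)))
      = -(Real.log (2 * Real.pi * v) / 2) - (u k - m k) ^ 2 / (2 * v) := by
    intro k
    rw [Real.log_mul (by positivity) (Real.exp_pos _).ne', Real.log_inv, Real.log_sqrt h2.le,
      Real.log_exp]
    ring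
  simp_rw [this]
  rw [Finset.sum_sub_distrib, Finset.sum_const, Finset.card_univ, Fintype.card_fin, nsmul_eq_mul,
    Finset.sum_div]
  ring

/-- Squared Euclidean norm. -/
def sqNorm (u : Fin n → ℝ) : ℝ := ∑ k, u k ^ 2

/-- Standard Gaussian noise block. -/
abbrev stdNoise (n : ℕ) : Measure (Fin n → ℝ) := Measure.pi fun _ : Fin n => gaussianReal 0 1

abbrev stdPDF (n : ℕ) : (Fin n → ℝ) → ℝ≥0∞ := gaussPDF 0 1

theorem measurable_sqNorm : Measurable (sqNorm : (Fin n → ℝ) → ℝ) := by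
  unfold sqNorm; fun_prop

theorem sqNorm_nonneg (u : Fin n → ℝ) : 0 ≤ sqNorm u := Finset.sum_nonneg fun _ _ => sq_nonneg _

theorem sqNorm_add_le (u v : Fin n → ℝ) : sqNorm (u + v) ≤ 2 * (sqNorm u + sqNorm v) := by
  unfold sqNorm
  rw [← Finset.sum_add_distrib, Finset.mul_sum]
  exact Finset.sum_le_sum fun k _ => by
    simp only [Pi.add_apply]; nlinarith [sq_nonneg (u k - v k)]

theorem memLp_id_gaussian : MemLp id 2 (gaussianReal 0 1) :=
  memLp_id_gaussianReal 2

theorem measurePreserving_coord (k : Fin n) :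
    MeasurePreserving (fun z : Fin n → ℝ => z k) (stdNoise n) (gaussianReal 0 1) :=
  measurePreserving_eval (fun _ : Fin n => gaussianReal 0 1) k

theorem memLp_coord (k : Fin n) : MemLp (fun z : Fin n → ℝ => z k) 2 (stdNoise n) :=
  memLp_id_gaussian.comp_measurePreserving (measurePreserving_coord k)

theorem integral_coord (k : Fin n) : ∫ z : Fin n → ℝ, z k ∂(stdNoise n) = 0 := by
  have h := (measurePreserving_coord k).hasLaw.integral_comp (f := id) (by fun_prop)
  simpa using h

theorem integral_coord_sq (k : Fin n) : ∫ z : Fin n → ℝ, z k ^ 2 ∂(stdNoise n) = 1 := by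
  have h := (measurePreserving_coord k).hasLaw.integral_comp (f := fun x => x ^ 2) (by fun_prop)
  have hv := variance_of_integral_eq_zero (μ := gaussianReal 0 1) (X := id) (by fun_prop) (by simp)
  rw [variance_id_gaussianReal] at hv
  simp only [id] at hv
  rw [← hv] at h
  simpa [Function.comp_def] using h

theorem integrable_sqNorm : Integrable (sqNorm : (Fin n → ℝ) → ℝ) (stdNoise n) :=
  integrable_finsetSum _ fun k _ => (memLp_coord k).integrable_sq

theorem stdNoise_eq_withDensity : stdNoise n = volume.withDensity (stdPDF n) := by
  refine Measure.pi_eq fun s hs => ?_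
  rw [withDensity_apply _ (MeasurableSet.univ_pi hs), volume_pi, Measure.restrict_pi_pi]
  unfold stdPDF gaussPDF
  rw [lintegral_fin_prod_eq_prod _ (fun k => measurable_gaussianPDF _ _)]
  exact Finset.prod_congr rfl fun k _ => by
    rw [gaussianReal_of_var_ne_zero _ one_ne_zero, withDensity_apply _ (hs k)]; rfl

theorem stdPDF_eq (u : Fin n → ℝ) :
    stdPDF n u = ENNReal.ofReal ((√(2 * Real.pi))⁻¹ ^ n * Real.exp (-(sqNorm u / 2))) := by
  unfold stdPDF gaussPDF gaussianPDF gaussianPDFReal sqNorm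
  rw [← ENNReal.ofReal_prod_of_nonneg (fun k _ => by positivity), Finset.prod_mul_distrib,
    ← Real.exp_sum]
  simp [Finset.sum_div, neg_div]

theorem isNoise_stdNoise : IsNoise (stdNoise n) (stdPDF n) sqNorm where
  measurable := measurable_gaussPDF measurable_const measurable_id 1
  eq_withDensity := stdNoise_eq_withDensity
  le_one u := by
    rw [stdPDF_eq, ENNReal.ofReal_le_one]
    refine mul_le_one₀ (pow_le_one₀ (by positivity) ?_) (Real.exp_pos _).le ?_
    · refine inv_le_one_of_one_le₀ ?_
      rw [Real.one_le_sqrt]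
      linarith [Real.pi_gt_three]
    · rw [Real.exp_le_one_iff]; linarith [sqNorm_nonneg u]
  lower := by
    refine ⟨(√(2 * Real.pi))⁻¹ ^ n, by positivity, fun y g => ?_⟩
    rw [stdPDF_eq]
    refine ENNReal.ofReal_le_ofReal ?_
    -- What remains is ‖y − g‖² / 2 ≤ ‖y‖² + ‖g‖²; hence the exponents in `lower` are `sq` without
    -- the factor 1/2.
    rw [mul_assoc, ← Real.exp_add]
    gcongr
    have h := sqNorm_add_le y (-g)
    have : sqNorm (-g) = sqNorm g := by simp [sqNorm]
    rw [this, ← sub_eq_add_neg] at h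
    linarith
  measurable_sq := measurable_sqNorm
  sq_nonneg := sqNorm_nonneg
  sq_add := sqNorm_add_le
  integrable_sq := integrable_sqNorm

theorem IsNoise.pair {E : Type*} [MeasureSpace E] [AddCommGroup E] [SFinite (volume : Measure E)]
    {γ : Measure E} [IsProbabilityMeasure γ] {φ : E → ℝ≥0∞} {sq : E → ℝ} (hn : IsNoise γ φ sq) :
    IsNoise (γ.prod γ) (pairPDF φ) (fun u => sq u.1 + sq u.2) where
  measurable := (hn.measurable.comp measurable_fst).mul (hn.measurable.comp measurable_snd)
  eq_withDensity := by
    have : SFinite (volume.withDensity φ : Measure E) := by rw [← hn.eq_withDensity]; infer_instance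
    conv_lhs => rw [hn.eq_withDensity]
    exact prod_withDensity hn.measurable hn.measurable
  le_one u := mul_le_one' (hn.le_one _) (hn.le_one _)
  lower := by
    obtain ⟨c, hc, h⟩ := hn.lower
    refine ⟨c * c, by positivity, fun y g => ?_⟩
    refine le_trans (le_of_eq ?_) (mul_le_mul' (h y.1 g.1) (h y.2 g.2))
    rw [← ENNReal.ofReal_mul (by positivity), neg_add, neg_add, Real.exp_add, Real.exp_add]
    congr 1
    ring
  measurable_sq := (hn.measurable_sq.comp measurable_fst).add (hn.measurable_sq.comp measurable_snd)
  sq_nonneg u := add_nonneg (hn.sq_nonneg _) (hn.sq_nonneg _)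
  sq_add u v := by
    have h1 := hn.sq_add u.1 v.1
    have h2 := hn.sq_add u.2 v.2
    simp only [Prod.fst_add, Prod.snd_add]
    linarith
  integrable_sq := (hn.integrable_sq.comp_fst γ).add (hn.integrable_sq.comp_snd γ)

/-- Conditional density of a pair of blocks: the coordinates of `y` have means `m`, and the
sum and difference of the `k`-th coordinates are uncorrelated with variances `2 * l₁`, `2 * l₂`. -/
def pairGaussPDF (l₁ l₂ : ℝ≥0) (m : (Fin n → ℝ) × (Fin n → ℝ)) (y : (Fin n → ℝ) × (Fin n → ℝ)) :
    ℝ≥0∞ :=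
  gaussPDF m.1 ((l₁ + l₂) / 2) y.1 *
    gaussPDF (m.2 + (((l₁ : ℝ) - l₂) / (l₁ + l₂)) • (y.1 - m.1)) (2 * l₁ * l₂ / (l₁ + l₂)) y.2

theorem measurable_pairGaussPDF {α : Type*} [MeasurableSpace α] {m y : α → (Fin n → ℝ) × (Fin n → ℝ)}
    (hm : Measurable m) (hy : Measurable y) (l₁ l₂ : ℝ≥0) :
    Measurable fun a => pairGaussPDF l₁ l₂ (m a) (y a) := by
  have h₁ := measurable_gaussPDF hm.fst hy.fst ((l₁ + l₂) / 2)
  have h₂ : Measurable fun a =>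
      (m a).2 + (((l₁ : ℝ) - l₂) / (l₁ + l₂)) • ((y a).1 - (m a).1) :=
    by fun_prop
  exact h₁.mul (measurable_gaussPDF h₂ hy.snd (2 * l₁ * l₂ / (l₁ + l₂)))

theorem lintegral_pairGaussPDF {l₁ l₂ : ℝ≥0} (h₁ : l₁ ≠ 0) (h₂ : l₂ ≠ 0)
    (m : (Fin n → ℝ) × (Fin n → ℝ)) : ∫⁻ y, pairGaussPDF l₁ l₂ m y = 1 := by
  have hs : l₁ + l₂ ≠ 0 := by positivity
  rw [Measure.volume_eq_prod, lintegral_prod _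
    (show Measurable fun y => pairGaussPDF l₁ l₂ m y from
      measurable_pairGaussPDF measurable_const measurable_id l₁ l₂).aemeasurable]
  unfold pairGaussPDF
  simp only
  have : ∀ x : Fin n → ℝ, ∫⁻ y, gaussPDF m.1 ((l₁ + l₂) / 2) x *
    gaussPDF (m.2 + (((l₁ : ℝ) - l₂) / (l₁ + l₂)) • (x - m.1)) (2 * l₁ * l₂ / (l₁ + l₂)) y
      = gaussPDF m.1 ((l₁ + l₂) / 2) x := by
    intro x
    rw [lintegral_const_mul _ (measurable_gaussPDF measurable_const measurable_id' _),
      lintegral_gaussPDF _ (by positivity), mul_one]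
  simp_rw [this]
  exact lintegral_gaussPDF _ (by positivity)

theorem pairGaussPDF_ne_zero {l₁ l₂ : ℝ≥0} (h₁ : l₁ ≠ 0) (h₂ : l₂ ≠ 0)
    (m y : (Fin n → ℝ) × (Fin n → ℝ)) : pairGaussPDF l₁ l₂ m y ≠ 0 := by
  have hs : l₁ + l₂ ≠ 0 := by positivity
  exact mul_ne_zero (gaussPDF_ne_zero _ (by positivity) _) (gaussPDF_ne_zero _ (by positivity) _)

theorem pairGaussPDF_ne_top (l₁ l₂ : ℝ≥0) (m y : (Fin n → ℝ) × (Fin n → ℝ)) :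
    pairGaussPDF l₁ l₂ m y ≠ ∞ :=
  ENNReal.mul_ne_top (gaussPDF_ne_top _ _ _) (gaussPDF_ne_top _ _ _)

/-- The definition as marginal times conditional makes normalisation a Fubini argument; the sum and
difference coordinates used here diagonalise the quadratic form, which suits the moment
computations. -/
theorem log_pairGaussPDF {l₁ l₂ : ℝ≥0} (h₁ : l₁ ≠ 0) (h₂ : l₂ ≠ 0)
    (m y : (Fin n → ℝ) × (Fin n → ℝ)) :
    Real.log (pairGaussPDF l₁ l₂ m y).toReal
      = -(n * Real.log (2 * Real.pi) + n / 2 * Real.log (l₁ * l₂))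
        - (∑ k, ((y.1 k - m.1 k) + (y.2 k - m.2 k)) ^ 2) / (4 * l₁)
        - (∑ k, ((y.1 k - m.1 k) - (y.2 k - m.2 k)) ^ 2) / (4 * l₂) := by
  have hs : l₁ + l₂ ≠ 0 := by positivity
  have p₁ : (0 : ℝ) < l₁ := by positivity
  have p₂ : (0 : ℝ) < l₂ := by positivity
  have hp : (0 : ℝ) < 2 * Real.pi := by positivity
  unfold pairGaussPDF
  rw [ENNReal.toReal_mul, Real.log_mul
    (ENNReal.toReal_pos (gaussPDF_ne_zero _ (by positivity) _) (gaussPDF_ne_top _ _ _)).ne'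
    (ENNReal.toReal_pos (gaussPDF_ne_zero _ (by positivity) _) (gaussPDF_ne_top _ _ _)).ne',
    log_gaussPDF _ (by positivity), log_gaussPDF _ (by positivity)]
  push_cast
  -- Marginal variance times conditional variance is the determinant l₁ l₂.
  have e1 : Real.log (2 * Real.pi * ((l₁ + l₂) / 2)) + Real.log (2 * Real.pi * (2 * l₁ * l₂ / (l₁ + l₂)))
      = 2 * Real.log (2 * Real.pi) + Real.log (l₁ * l₂) := by
    rw [← Real.log_mul (by positivity) (by positivity), two_mul (Real.log _),
      ← Real.log_mul (by positivity) (by positivity), ← Real.log_mul (by positivity) (by positivity)]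
    congr 1
    field_simp
  have e2 : (∑ k, (y.1 k - m.1 k) ^ 2) / (2 * (((l₁ : ℝ) + l₂) / 2)) +
      (∑ k, (y.2 k - (m.2 + (((l₁ : ℝ) - l₂) / (l₁ + l₂)) • (y.1 - m.1)) k) ^ 2) /
        (2 * (2 * l₁ * l₂ / (l₁ + l₂)))
      = (∑ k, ((y.1 k - m.1 k) + (y.2 k - m.2 k)) ^ 2) / (4 * l₁)
        + (∑ k, ((y.1 k - m.1 k) - (y.2 k - m.2 k)) ^ 2) / (4 * l₂) := by
    simp_rw [Finset.sum_div]
    rw [← Finset.sum_add_distrib, ← Finset.sum_add_distrib]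
    refine Finset.sum_congr rfl fun k _ => ?_
    simp only [Pi.add_apply, Pi.smul_apply, Pi.sub_apply, smul_eq_mul]
    have : (l₁ : ℝ) + l₂ ≠ 0 := by positivity
    field_simp
    ring
  linear_combination (-(n : ℝ) / 2) * e1 - e2

namespace Code

variable {N M₁ M₂ : ℕ} (c : Code N M₁ M₂)

/-! ### The conferencing transcript as a finite random variable -/

/-- The symbols exchanged over the two links during a block. -/
abbrev Links : Type := (∀ k : Fin N, Fin (c.size₁₂ k)) × (∀ k : Fin N, Fin (c.size₂₁ k))

def links (a₁ : Fin M₁ × ℝ) (a₂ : Fin M₂ × ℝ) : c.Links :=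
  (fun k => ⟨c.f₁₂ k a₁.1 a₁.2 (c.transcript a₁ a₂ k).2, c.f₁₂_lt _ _ _ _⟩,
   fun k => ⟨c.f₂₁ k a₂.1 a₂.2 (c.transcript a₁ a₂ k).1, c.f₂₁_lt _ _ _ _⟩)

/-- The symbols sent over the link from transmitter 1 to transmitter 2 before time `k`. -/
def prefix₁₂ (v : c.Links) (k : ℕ) : List ℕ :=
  (List.range k).map fun i => if h : i < N then (v.1 ⟨i, h⟩ : ℕ) else 0

/-- The symbols sent over the link from transmitter 2 to transmitter 1 before time `k`. -/
def prefix₂₁ (v : c.Links) (k : ℕ) : List ℕ :=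
  (List.range k).map fun i => if h : i < N then (v.2 ⟨i, h⟩ : ℕ) else 0

/-- The sources of transmitter 1 that are compatible with the link symbols `v`. -/
def compat₁ (v : c.Links) : Set (Fin M₁ × ℝ) :=
  {a | ∀ k : Fin N, c.f₁₂ k a.1 a.2 (c.prefix₂₁ v k) = v.1 k}

/-- The sources of transmitter 2 that are compatible with the link symbols `v`. -/
def compat₂ (v : c.Links) : Set (Fin M₂ × ℝ) :=
  {a | ∀ k : Fin N, c.f₂₁ k a.1 a.2 (c.prefix₁₂ v k) = v.2 k}

/-- Causality: a symbol depends on the sender's own source and on the symbols received earlier. If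
each source separately would answer according to `v`, the exchange follows `v` by induction on time.
-/
theorem transcript_eq_of_compat {v : c.Links} {a₁ : Fin M₁ × ℝ} {a₂ : Fin M₂ × ℝ}
    (h₁ : a₁ ∈ c.compat₁ v) (h₂ : a₂ ∈ c.compat₂ v) {k : ℕ} (hk : k ≤ N) :
    c.transcript a₁ a₂ k = (c.prefix₁₂ v k, c.prefix₂₁ v k) := by
  induction k with
  | zero => rfl
  | succ k ih =>
    have hk' : k < N := hk
    have e₁ := h₁ ⟨k, hk'⟩
    have e₂ := h₂ ⟨k, hk'⟩
    simp only at e₁ e₂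
    rw [transcript, ih hk'.le]
    simp only [e₁, e₂]
    -- By `hk'` the default symbol 0 of the prefixes is not read inside the block.
    simp only [prefix₁₂, prefix₂₁, List.range_succ, List.map_append, List.map_cons,
      List.map_nil, hk', dite_true]

theorem transcript_eq (a₁ : Fin M₁ × ℝ) (a₂ : Fin M₂ × ℝ) {k : ℕ} (hk : k ≤ N) :
    c.transcript a₁ a₂ k = (c.prefix₁₂ (c.links a₁ a₂) k, c.prefix₂₁ (c.links a₁ a₂) k) := by
  induction k with
  | zero => rfl
  | succ k ih =>
    have hk' : k < N := hk
    rw [transcript, prefix₁₂, prefix₂₁]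
    simp only [List.range_succ, List.map_append, List.map_cons, List.map_nil, hk', dite_true]
    rw [show (List.range k).map (fun i => if h : i < N then ((c.links a₁ a₂).1 ⟨i, h⟩ : ℕ) else 0)
        = (c.transcript a₁ a₂ k).1 by rw [ih hk'.le]; rfl,
      show (List.range k).map (fun i => if h : i < N then ((c.links a₁ a₂).2 ⟨i, h⟩ : ℕ) else 0)
        = (c.transcript a₁ a₂ k).2 by rw [ih hk'.le]; rfl]
    rfl

/-- The link symbols take a given value on a rectangle: this is the conditional independence of
the two sources given the link symbols. -/
theorem links_eq_iff (a₁ : Fin M₁ × ℝ) (a₂ : Fin M₂ × ℝ) (v : c.Links) :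
    c.links a₁ a₂ = v ↔ a₁ ∈ c.compat₁ v ∧ a₂ ∈ c.compat₂ v := by
  constructor
  · rintro rfl
    constructor
    · intro k
      simp only [links]
      rw [c.transcript_eq a₁ a₂ k.2.le]
      rfl
    · intro k
      simp only [links]
      rw [c.transcript_eq a₁ a₂ k.2.le]
      rfl
  · rintro ⟨h₁, h₂⟩
    refine Prod.ext (funext fun k => Fin.ext ?_) (funext fun k => Fin.ext ?_)
    · simp only [links]
      rw [c.transcript_eq_of_compat h₁ h₂ k.2.le]
      exact h₁ k
    · simp only [links]
      rw [c.transcript_eq_of_compat h₁ h₂ k.2.le]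
      exact h₂ k

theorem measurable_of_fin_prod {M : ℕ} {β : Type*} [MeasurableSpace β] {f : Fin M → ℝ → β}
    (hf : ∀ w, Measurable (f w)) : Measurable fun a : Fin M × ℝ => f a.1 a.2 :=
  measurable_from_prod_countable_right hf

theorem measurableSet_compat₁ (v : c.Links) : MeasurableSet (c.compat₁ v) := by
  rw [compat₁, Set.ofPred_forall]
  exact MeasurableSet.iInter fun k =>
    (measurable_of_fin_prod fun w => c.measurable_f₁₂ k w _) (measurableSet_singleton _)

theorem measurableSet_compat₂ (v : c.Links) : MeasurableSet (c.compat₂ v) := by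
  rw [compat₂, Set.ofPred_forall]
  exact MeasurableSet.iInter fun k =>
    (measurable_of_fin_prod fun w => c.measurable_f₂₁ k w _) (measurableSet_singleton _)

theorem measurable_links :
    Measurable fun a : (Fin M₁ × ℝ) × (Fin M₂ × ℝ) => c.links a.1 a.2 := by
  refine measurable_to_countable' fun v => ?_
  convert (c.measurableSet_compat₁ v).prod (c.measurableSet_compat₂ v) using 1
  ext a
  simp [links_eq_iff]

/-- Input block of transmitter 1 as a function of the link symbols and its own source. -/
def block₁ (v : c.Links) (a : Fin M₁ × ℝ) (k : Fin N) : ℝ :=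
  c.x₁ k a.1 a.2 (c.prefix₂₁ v (k + 1))

/-- Input block of transmitter 2 as a function of the link symbols and its own source. -/
def block₂ (v : c.Links) (a : Fin M₂ × ℝ) (k : Fin N) : ℝ :=
  c.x₂ k a.1 a.2 (c.prefix₁₂ v (k + 1))

theorem measurable_block₁ (v : c.Links) : Measurable (c.block₁ v) :=
  measurable_pi_lambda _ fun k => measurable_of_fin_prod fun w => c.measurable_x₁ k w _

theorem measurable_block₂ (v : c.Links) : Measurable (c.block₂ v) :=
  measurable_pi_lambda _ fun k => measurable_of_fin_prod fun w => c.measurable_x₂ k w _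

/-- Input block of transmitter 1 as a function of the two sources. -/
def sent₁ (a : (Fin M₁ × ℝ) × (Fin M₂ × ℝ)) : Fin N → ℝ := c.block₁ (c.links a.1 a.2) a.1

/-- Input block of transmitter 2 as a function of the two sources. -/
def sent₂ (a : (Fin M₁ × ℝ) × (Fin M₂ × ℝ)) : Fin N → ℝ := c.block₂ (c.links a.1 a.2) a.2

theorem measurable_sent₁ : Measurable c.sent₁ := by
  have h : Measurable (Function.uncurry fun v a => c.block₁ v a) :=
    measurable_from_prod_countable_right c.measurable_block₁
  exact h.comp (c.measurable_links.prodMk measurable_fst)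

theorem measurable_sent₂ : Measurable c.sent₂ := by
  have h : Measurable (Function.uncurry fun v a => c.block₂ v a) :=
    measurable_from_prod_countable_right c.measurable_block₂
  exact h.comp (c.measurable_links.prodMk measurable_snd)

theorem input₁_eq (ω : Sample N M₁ M₂) (k : Fin N) : c.input₁ ω k = c.sent₁ (ω.1, ω.2.1) k := by
  simp only [input₁, sent₁, block₁]
  rw [c.transcript_eq ω.1 ω.2.1 k.2]

theorem input₂_eq (ω : Sample N M₁ M₂) (k : Fin N) : c.input₂ ω k = c.sent₂ (ω.1, ω.2.1) k := by
  simp only [input₂, sent₂, block₂]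
  rw [c.transcript_eq ω.1 ω.2.1 k.2]

/-! ### The extended probability space -/

/-- Law of the message and the randomness of transmitter 1. -/
def source₁ : Measure (Fin M₁ × ℝ) := (uniformOn (Set.univ : Set (Fin M₁))).prod c.ν₁

/-- Law of the message and the randomness of transmitter 2. -/
def source₂ : Measure (Fin M₂ × ℝ) := (uniformOn (Set.univ : Set (Fin M₂))).prod c.ν₂

instance [NeZero M₁] : IsProbabilityMeasure c.source₁ := by
  have := c.prob₁
  have := isProbabilityMeasure_uniformOn (s := (Set.univ : Set (Fin M₁))) Set.finite_univ
    Set.univ_nonempty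
  rw [source₁]; infer_instance

instance [NeZero M₂] : IsProbabilityMeasure c.source₂ := by
  have := c.prob₂
  have := isProbabilityMeasure_uniformOn (s := (Set.univ : Set (Fin M₂))) Set.finite_univ
    Set.univ_nonempty
  rw [source₂]; infer_instance

theorem uniformOn_univ_singleton {M : ℕ} (w : Fin M) :
    uniformOn (Set.univ : Set (Fin M)) {w} = (M : ℝ≥0∞)⁻¹ := by
  rw [uniformOn_univ]; simp

theorem source₁_msg (w : Fin M₁) : c.source₁ (Prod.fst ⁻¹' {w}) = (M₁ : ℝ≥0∞)⁻¹ := by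
  have := c.prob₁
  rw [source₁, ← Set.prod_univ, Measure.prod_prod, measure_univ, mul_one, uniformOn_univ_singleton]

theorem source₂_msg (w : Fin M₂) : c.source₂ (Prod.fst ⁻¹' {w}) = (M₂ : ℝ≥0∞)⁻¹ := by
  have := c.prob₂
  rw [source₂, ← Set.prod_univ, Measure.prod_prod, measure_univ, mul_one, uniformOn_univ_singleton]

/-- A pair of noise blocks. -/
abbrev Noise (N : ℕ) : Type := (Fin N → ℝ) × (Fin N → ℝ)

/-- The two sources, the channel noise, and an independent copy of the channel noise. -/
abbrev Extended (N M₁ M₂ : ℕ) : Type :=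
  ((Fin M₁ × ℝ) × (Fin M₂ × ℝ)) × (Noise N × Noise N)

abbrev pairNoise (N : ℕ) : Measure (Noise N) := (stdNoise N).prod (stdNoise N)

def sources : Measure ((Fin M₁ × ℝ) × (Fin M₂ × ℝ)) := c.source₁.prod c.source₂

/-- The second noise pair feeds `proxy`: the genie step needs side information whose noise is
independent of the outputs. -/
def extLaw : Measure (Extended N M₁ M₂) :=
  c.sources.prod ((pairNoise N).prod (pairNoise N))

instance [NeZero M₁] [NeZero M₂] : IsProbabilityMeasure c.sources := by
  rw [sources]; infer_instance

instance [NeZero M₁] [NeZero M₂] : IsProbabilityMeasure c.extLaw := by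
  rw [extLaw]; infer_instance

/-- Forget the copy of the noise. -/
def toSample (ω : Extended N M₁ M₂) : Sample N M₁ M₂ := (ω.1.1, ω.1.2, ω.2.1)

theorem measurePreserving_toSample [NeZero M₁] [NeZero M₂] :
    MeasurePreserving toSample c.extLaw c.law := by
  have hA := measurePreserving_prodAssoc c.source₁ c.source₂ (pairNoise N)
  have hB : MeasurePreserving (Prod.map id Prod.fst :
      Extended N M₁ M₂ → ((Fin M₁ × ℝ) × (Fin M₂ × ℝ)) × Noise N) c.extLaw
      (c.sources.prod (pairNoise N)) :=
    (MeasurePreserving.id c.sources).prod measurePreserving_fst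
  exact hA.comp hB

end Code

/-! ### Logarithms of densities -/

/-- Real logarithm of an extended nonnegative number. -/
def elog (x : ℝ≥0∞) : ℝ := Real.log x.toReal

theorem measurable_elog : Measurable elog := Real.measurable_log.comp ENNReal.measurable_toReal

theorem elog_mul {x y : ℝ≥0∞} (hx : x ≠ 0 ∧ x ≠ ∞) (hy : y ≠ 0 ∧ y ≠ ∞) :
    elog (x * y) = elog x + elog y := by
  rw [elog, ENNReal.toReal_mul, Real.log_mul (ENNReal.toReal_pos hx.1 hx.2).ne'
    (ENNReal.toReal_pos hy.1 hy.2).ne']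
  rfl

theorem mul_ne {x y : ℝ≥0∞} (hx : x ≠ 0 ∧ x ≠ ∞) (hy : y ≠ 0 ∧ y ≠ ∞) : x * y ≠ 0 ∧ x * y ≠ ∞ :=
  ⟨mul_ne_zero hx.1 hy.1, ENNReal.mul_ne_top hx.2 hy.2⟩

theorem elog_natCast (M : ℕ) : elog M = Real.log M := by simp [elog]

/-! ### Integrability of log-densities -/

section Integrability

variable {Ω A G ι : Type*} [MeasurableSpace Ω] {P : Measure Ω} [IsFiniteMeasure P]

theorem integrable_of_abs_le {f g : Ω → ℝ} {C : ℝ} (hf : Measurable f) (hg : Integrable g P)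
    (h : ∀ ω, |f ω| ≤ C + g ω) : Integrable f P :=
  Integrable.mono' ((integrable_const C).add hg) hf.aestronglyMeasurable
    (Filter.Eventually.of_forall h)

theorem integrable_finite_comp [Finite ι] [MeasurableSpace ι] [MeasurableSingletonClass ι]
    {I : Ω → ι} (hI : Measurable I) (f : ι → ℝ) : Integrable (fun ω => f (I ω)) P := by
  have := Fintype.ofFinite ι
  refine integrable_of_abs_le (C := ∑ i, |f i|) ((measurable_of_finite f).comp hI)
    (integrable_const (0 : ℝ)) fun ω => ?_
  have := Finset.single_le_sum (f := fun i => |f i|) (fun i _ => abs_nonneg _)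
    (Finset.mem_univ (I ω))
  simpa using this

variable [MeasurableSpace A] [MeasureSpace G] [AddCommGroup G] [MeasurableAdd₂ G] [MeasurableNeg G]
  {γ : Measure G} {φ : G → ℝ≥0∞} {sq : G → ℝ}

theorem IsNoise.measurable_mix_family (hn : IsNoise γ φ sq) [Countable ι] [MeasurableSpace ι]
    [MeasurableSingletonClass ι]
    {μ : ι → Measure A} [∀ i, IsFiniteMeasure (μ i)] {g : ι → A → G} (hg : ∀ i, Measurable (g i))
    {I : Ω → ι} (hI : Measurable I) {Y : Ω → G} (hY : Measurable Y) :
    Measurable fun ω => mix φ (μ (I ω)) (g (I ω)) (Y ω) := by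
  have h : Measurable (Function.uncurry fun i y => mix φ (μ i) (g i) y) :=
    measurable_from_prod_countable_right fun i => hn.measurable_mix (μ := μ i) (hg i)
  exact h.comp (hI.prodMk hY)

/-- The index is a random message or link value; having finitely many values, it admits one common
constant in `abs_log_mix_le`. -/
theorem IsNoise.integrable_elog_mix_family (hn : IsNoise γ φ sq) [Finite ι] [MeasurableSpace ι]
    [MeasurableSingletonClass ι]
    {μ : ι → Measure A} [∀ i, IsFiniteMeasure (μ i)] {g : ι → A → G} (hg : ∀ i, Measurable (g i))
    {I : Ω → ι} (hI : Measurable I) {Y : Ω → G} (hY : Measurable Y)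
    (hsq : Integrable (fun ω => sq (Y ω)) P) :
    Integrable (fun ω => elog (mix φ (μ (I ω)) (g (I ω)) (Y ω))) P := by
  have := Fintype.ofFinite ι
  choose C hC using fun i => hn.abs_log_mix_le (μ := μ i) (hg i)
  refine integrable_of_abs_le (C := ∑ i, |C i|)
    (measurable_elog.comp (hn.measurable_mix_family hg hI hY)) hsq fun ω => ?_
  have h1 := Finset.single_le_sum (f := fun i => |C i|) (fun i _ => abs_nonneg _)
    (Finset.mem_univ (I ω))
  have h2 := hC (I ω) (Y ω)
  have h3 := le_abs_self (C (I ω))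
  unfold elog
  linarith

theorem IsNoise.integrable_elog_mix (hn : IsNoise γ φ sq) {μ : Measure A} [IsFiniteMeasure μ]
    {g : A → G} (hg : Measurable g) {Y : Ω → G} (hY : Measurable Y)
    (hsq : Integrable (fun ω => sq (Y ω)) P) :
    Integrable (fun ω => elog (mix φ μ g (Y ω))) P := by
  obtain ⟨C, hC⟩ := hn.abs_log_mix_le (μ := μ) hg
  exact integrable_of_abs_le (measurable_elog.comp ((hn.measurable_mix hg).comp hY)) hsq
    fun ω => hC (Y ω)

end Integrability

/-! ### The decoding test -/

section Test

variable {M : ℕ} {E : Type*}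

/-- The test function that replaces Fano's inequality: its average over a uniform `w` is one. -/
def decTest (dec : E → Fin M) (w : Fin M) (y : E) : ℝ≥0∞ :=
  ((if dec y = w then (M : ℝ≥0∞) else 0) + 1) / 2

theorem sum_decTest (dec : E → Fin M) (y : E) : ∑ w, decTest dec w y = M := by
  unfold decTest
  simp_rw [div_eq_mul_inv]
  rw [← Finset.sum_mul, Finset.sum_add_distrib, Finset.sum_ite_eq, if_pos (Finset.mem_univ _)]
  simp only [Finset.sum_const, Finset.card_univ, Fintype.card_fin, nsmul_eq_mul, mul_one]
  rw [← two_mul, mul_comm, ← mul_assoc, ENNReal.inv_mul_cancel two_ne_zero ENNReal.ofNat_ne_top,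
    one_mul]

theorem decTest_ne (dec : E → Fin M) (w : Fin M) (y : E) :
    decTest dec w y ≠ 0 ∧ decTest dec w y ≠ ∞ := by
  unfold decTest
  constructor
  · refine (ENNReal.div_pos ?_ ENNReal.ofNat_ne_top).ne'
    exact (lt_of_lt_of_le zero_lt_one le_add_self).ne'
  · refine ENNReal.div_ne_top ?_ two_ne_zero
    split_ifs <;> simp

theorem elog_decTest (dec : E → Fin M) (w : Fin M) (y : E) :
    elog (decTest dec w y) = if dec y = w then Real.log ((M + 1) / 2) else Real.log (1 / 2) := by
  unfold decTest elog
  split_ifs with h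
  · rw [ENNReal.toReal_div, ENNReal.toReal_add (ENNReal.natCast_ne_top _) ENNReal.one_ne_top]; simp
  · simp

/-- The summand 1 in `decTest` keeps the logarithm at −log 2 when decoding fails, so an error costs
only log M. -/
theorem le_elog_decTest (dec : E → Fin M) (w : Fin M) (y : E) :
    Real.log M - Real.log 2 - (if dec y = w then 0 else Real.log M) ≤ elog (decTest dec w y) := by
  have hM : 0 < M := Fin.pos w
  have hM' : (0 : ℝ) < M := by exact_mod_cast hM
  rw [elog_decTest]
  split_ifs with h
  · rw [sub_zero, ← Real.log_div hM'.ne' two_ne_zero]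
    exact Real.log_le_log (by positivity) (by linarith)
  · rw [one_div, Real.log_inv]; linarith

variable [MeasurableSpace E]

theorem measurable_decTest {dec : E → Fin M} (hdec : Measurable dec) (w : Fin M) :
    Measurable (decTest dec w) := by
  unfold decTest
  have : MeasurableSet {y | dec y = w} := hdec (measurableSet_singleton w)
  exact ((Measurable.ite this measurable_const measurable_const).add measurable_const).div
    measurable_const

theorem measurable_uncurry_decTest {dec : E → Fin M} (hdec : Measurable dec) :
    Measurable (Function.uncurry (decTest dec)) :=
  measurable_from_prod_countable_right (measurable_decTest hdec)

variable {Ω : Type*} [MeasurableSpace Ω] {P : Measure Ω} [IsProbabilityMeasure P]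

theorem integrable_elog_decTest {dec : E → Fin M} (hdec : Measurable dec) {W : Ω → Fin M}
    (hW : Measurable W) {Y : Ω → E} (hY : Measurable Y) :
    Integrable (fun ω => elog (decTest dec (W ω) (Y ω))) P := by
  refine integrable_of_abs_le (C := |Real.log ((M + 1) / 2)| + |Real.log (1 / 2)|)
    (measurable_elog.comp ((measurable_uncurry_decTest hdec).comp (hW.prodMk hY)))
    (integrable_const (0 : ℝ)) fun ω => ?_
  rw [elog_decTest]
  have h1 := abs_nonneg (Real.log (((M : ℝ) + 1) / 2))
  have h2 := abs_nonneg (Real.log (1 / 2))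
  split_ifs <;> linarith

/-- A reliable decoder makes the test large on average. -/
theorem le_integral_elog_decTest {dec : E → Fin M} (hdec : Measurable dec) {W : Ω → Fin M}
    (hW : Measurable W) {Y : Ω → E} (hY : Measurable Y) {ε : ℝ} (hε : 0 ≤ ε)
    (herr : P {ω | dec (Y ω) ≠ W ω} ≤ ENNReal.ofReal ε) :
    (1 - ε) * Real.log M - Real.log 2 ≤ ∫ ω, elog (decTest dec (W ω) (Y ω)) ∂P := by
  set S : Set Ω := {ω | dec (Y ω) ≠ W ω} with hS
  have hSm : MeasurableSet S := (measurableSet_eq_fun (hdec.comp hY) hW).compl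
  have hi : Integrable (S.indicator fun _ => Real.log M) P :=
    (integrable_const _).indicator hSm
  have h1 : ∫ ω, (Real.log M - Real.log 2 - S.indicator (fun _ => Real.log M) ω) ∂P
      ≤ ∫ ω, elog (decTest dec (W ω) (Y ω)) ∂P := by
    refine integral_mono ((integrable_const _).sub hi) (integrable_elog_decTest hdec hW hY)
      fun ω => ?_
    refine le_trans (le_of_eq ?_) (le_elog_decTest dec (W ω) (Y ω))
    by_cases h : dec (Y ω) = W ω <;> simp [hS, Set.indicator, h]
  rw [integral_sub (integrable_const _) hi, integral_indicator_const _ hSm] at h1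
  simp only [integral_const, probReal_univ, smul_eq_mul, one_mul] at h1
  have h2 : P.real S ≤ ε := ENNReal.toReal_le_of_le_ofReal hε herr
  have h3 : 0 ≤ Real.log M := Real.log_natCast_nonneg M
  nlinarith

end Test

/-- Almost surely positive and finite, with integrable logarithm. -/
def LogIntegrable {Ω : Type*} [MeasurableSpace Ω] (f : Ω → ℝ≥0∞) (P : Measure Ω) : Prop :=
  (∀ᵐ ω ∂P, f ω ≠ 0 ∧ f ω ≠ ∞) ∧ Integrable (fun ω => elog (f ω)) P

namespace LogIntegrable

variable {Ω : Type*} [MeasurableSpace Ω] {P : Measure Ω} {f g d : Ω → ℝ≥0∞}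

theorem ae_elog_mul (hf : LogIntegrable f P) (hg : LogIntegrable g P) :
    (fun ω => elog (f ω * g ω)) =ᵐ[P] fun ω => elog (f ω) + elog (g ω) := by
  filter_upwards [hf.1, hg.1] with ω h1 h2 using elog_mul h1 h2

theorem mul (hf : LogIntegrable f P) (hg : LogIntegrable g P) :
    LogIntegrable (fun ω => f ω * g ω) P := by
  refine ⟨?_, (hf.2.add hg.2).congr (hf.ae_elog_mul hg).symm⟩
  filter_upwards [hf.1, hg.1] with ω h1 h2 using mul_ne h1 h2

theorem integral_mul (hf : LogIntegrable f P) (hg : LogIntegrable g P) :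
    ∫ ω, elog (f ω * g ω) ∂P = ∫ ω, elog (f ω) ∂P + ∫ ω, elog (g ω) ∂P := by
  rw [integral_congr_ae (hf.ae_elog_mul hg), integral_add hf.2 hg.2]

theorem integral_le [IsProbabilityMeasure P] (hf : LogIntegrable f P) (hd : LogIntegrable d P)
    (h : ∫⁻ ω, f ω / d ω ∂P ≤ 1) : ∫ ω, elog (f ω) ∂P ≤ ∫ ω, elog (d ω) ∂P :=
  integral_log_le_of_lintegral_div_le_one hf.1 hd.1 hf.2 hd.2 h

theorem of_const [IsFiniteMeasure P] {x : ℝ≥0∞} (hx : x ≠ 0 ∧ x ≠ ∞) : LogIntegrable (fun _ => x) P :=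
  ⟨Filter.Eventually.of_forall fun _ => hx, integrable_const _⟩

end LogIntegrable

theorem natCast_ne {M : ℕ} (h : 0 < M) : (M : ℝ≥0∞) ≠ 0 ∧ (M : ℝ≥0∞) ≠ ∞ :=
  ⟨by exact_mod_cast h.ne', ENNReal.natCast_ne_top M⟩

/-- Squared Euclidean norm of a pair of blocks. -/
def sqNormPair {N : ℕ} (u : Code.Noise N) : ℝ := sqNorm u.1 + sqNorm u.2

theorem isNoise_pairNoise {N : ℕ} :
    IsNoise (Code.pairNoise N) (pairPDF (stdPDF N)) sqNormPair :=
  isNoise_stdNoise.pair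

namespace Code

variable {N M₁ M₂ : ℕ} (c : Code N M₁ M₂) (hd hc : ℝ)

/-! ### Noiseless outputs and their mixtures -/

/-- Noiseless output at receiver 1. -/
def mean₁ (a : (Fin M₁ × ℝ) × (Fin M₂ × ℝ)) : Fin N → ℝ := hd • c.sent₁ a + hc • c.sent₂ a

/-- Noiseless output at receiver 2. -/
def mean₂ (a : (Fin M₁ × ℝ) × (Fin M₂ × ℝ)) : Fin N → ℝ := hd • c.sent₂ a + hc • c.sent₁ a

def meanY (a : (Fin M₁ × ℝ) × (Fin M₂ × ℝ)) : Noise N := (c.mean₁ hd hc a, c.mean₂ hd hc a)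

/-- Interference at the two receivers. -/
def meanS (a : (Fin M₁ × ℝ) × (Fin M₂ × ℝ)) : Noise N := (hc • c.sent₂ a, hc • c.sent₁ a)

theorem measurable_mean₁ : Measurable (c.mean₁ hd hc) :=
  (c.measurable_sent₁.const_smul hd).add (c.measurable_sent₂.const_smul hc)

theorem measurable_mean₂ : Measurable (c.mean₂ hd hc) :=
  (c.measurable_sent₂.const_smul hd).add (c.measurable_sent₁.const_smul hc)

theorem measurable_meanY : Measurable (c.meanY hd hc) :=
  (c.measurable_mean₁ hd hc).prodMk (c.measurable_mean₂ hd hc)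

theorem measurable_meanS : Measurable (c.meanS hc) :=
  (c.measurable_sent₂.const_smul hc).prodMk (c.measurable_sent₁.const_smul hc)

/-- Joint density of the two outputs. -/
def densY : Noise N → ℝ≥0∞ := mix (pairPDF (stdPDF N)) c.sources (c.meanY hd hc)

/-- Joint density of the two noisy interference signals. -/
def densS : Noise N → ℝ≥0∞ := mix (pairPDF (stdPDF N)) c.sources (c.meanS hc)

/-- Density of the second output. -/
def dens₂ : (Fin N → ℝ) → ℝ≥0∞ := mix (stdPDF N) c.sources (c.mean₂ hd hc)

/-- Density of the second output on the event that the first message is `w`. -/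
def densMsg (w : Fin M₁) : (Fin N → ℝ) → ℝ≥0∞ :=
  mix (stdPDF N) (c.sources.restrict ((fun a => a.1.1) ⁻¹' {w})) (c.mean₂ hd hc)

/-- Density of the noisy interference from transmitter 1 on the event that its source is
compatible with the link symbols `v`. -/
def densLink₁ (v : c.Links) : (Fin N → ℝ) → ℝ≥0∞ :=
  mix (stdPDF N) (c.source₁.restrict (c.compat₁ v)) (fun a => hc • c.block₁ v a)

/-- Density of the noisy interference from transmitter 2 on the event that its source is
compatible with the link symbols `v`. -/
def densLink₂ (v : c.Links) : (Fin N → ℝ) → ℝ≥0∞ :=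
  mix (stdPDF N) (c.source₂.restrict (c.compat₂ v)) (fun a => hc • c.block₂ v a)

/-- Output at receiver 1. -/
def out₁ (ω : Extended N M₁ M₂) : Fin N → ℝ := c.mean₁ hd hc ω.1 + ω.2.1.1

/-- Output at receiver 2. -/
def out₂ (ω : Extended N M₁ M₂) : Fin N → ℝ := c.mean₂ hd hc ω.1 + ω.2.1.2

/-- Both outputs. -/
def outs (ω : Extended N M₁ M₂) : Noise N := c.meanY hd hc ω.1 + ω.2.1

/-- Noisy interference signals. -/
def intf (ω : Extended N M₁ M₂) : Noise N := c.meanS hc ω.1 + ω.2.1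

/-- Noisy interference signals with independent noise. -/
def proxy (ω : Extended N M₁ M₂) : Noise N := c.meanS hc ω.1 + ω.2.2

theorem measurable_out₁ : Measurable (c.out₁ hd hc) :=
  ((c.measurable_mean₁ hd hc).comp measurable_fst).add measurable_snd.fst.fst

theorem measurable_out₂ : Measurable (c.out₂ hd hc) :=
  ((c.measurable_mean₂ hd hc).comp measurable_fst).add measurable_snd.fst.snd

theorem measurable_outs : Measurable (c.outs hd hc) :=
  ((c.measurable_meanY hd hc).comp measurable_fst).add measurable_snd.fst

theorem measurable_intf : Measurable (c.intf hc) :=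
  ((c.measurable_meanS hc).comp measurable_fst).add measurable_snd.fst

theorem measurable_proxy : Measurable (c.proxy hc) :=
  ((c.measurable_meanS hc).comp measurable_fst).add measurable_snd.snd

theorem output₁_toSample (ω : Extended N M₁ M₂) :
    c.output₁ hd hc (toSample ω) = c.out₁ hd hc ω := by
  ext k
  simp [output₁, input₁_eq, input₂_eq, out₁, mean₁, toSample]

theorem output₂_toSample (ω : Extended N M₁ M₂) :
    c.output₂ hd hc (toSample ω) = c.out₂ hd hc ω := by
  ext k
  simp [output₂, input₁_eq, input₂_eq, out₂, mean₂, toSample]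

theorem measurable_linkVar : Measurable fun ω : Extended N M₁ M₂ => c.links ω.1.1 ω.1.2 :=
  c.measurable_links.comp measurable_fst

/-! ### Moments -/

section Moments

/-- Finite second moments of the inputs. -/
def FinitePower : Prop :=
  (∀ k, MemLp (fun a => c.sent₁ a k) 2 c.sources) ∧ ∀ k, MemLp (fun a => c.sent₂ a k) 2 c.sources

theorem measurePreserving_fst_extLaw : MeasurePreserving (fun ω : Extended N M₁ M₂ => ω.1)
    c.extLaw c.sources :=
  measurePreserving_fst

variable [NeZero M₁] [NeZero M₂]

theorem measurePreserving_noise : MeasurePreserving (fun ω : Extended N M₁ M₂ => ω.2.1)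
    c.extLaw (pairNoise N) :=
  measurePreserving_fst.comp (measurePreserving_snd (μ := c.sources))

theorem measurePreserving_noise' : MeasurePreserving (fun ω : Extended N M₁ M₂ => ω.2.2)
    c.extLaw (pairNoise N) :=
  measurePreserving_snd.comp (measurePreserving_snd (μ := c.sources))

theorem sources_msg (w : Fin M₁) :
    c.sources ((fun a => a.1.1) ⁻¹' {w}) = (M₁ : ℝ≥0∞)⁻¹ := by
  have : ((fun a : (Fin M₁ × ℝ) × (Fin M₂ × ℝ) => a.1.1) ⁻¹' {w})
      = (Prod.fst ⁻¹' {w}) ×ˢ Set.univ := by ext; simp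
  rw [this, sources, Measure.prod_prod, measure_univ, mul_one, source₁_msg]

theorem densMsg_ne (w : Fin M₁) (y : Fin N → ℝ) :
    c.densMsg hd hc w y ≠ 0 ∧ c.densMsg hd hc w y ≠ ∞ := by
  refine ⟨isNoise_stdNoise.mix_ne_zero ?_ (c.measurable_mean₂ hd hc) _,
    isNoise_stdNoise.mix_ne_top _ _⟩
  rw [Ne, Measure.restrict_eq_zero, sources_msg]
  exact ENNReal.inv_ne_zero.2 (ENNReal.natCast_ne_top _)

theorem integrable_sqNorm_add (hX : c.FinitePower) (α β : ℝ) {z : Extended N M₁ M₂ → Fin N → ℝ}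
    (hz : MeasurePreserving z c.extLaw (stdNoise N)) :
    Integrable (fun ω => sqNorm (α • c.sent₁ ω.1 + β • c.sent₂ ω.1 + z ω)) c.extLaw := by
  refine integrable_finsetSum _ fun k _ => MemLp.integrable_sq ?_
  have h1 := ((hX.1 k).comp_measurePreserving c.measurePreserving_fst_extLaw).const_mul α
  have h2 := ((hX.2 k).comp_measurePreserving c.measurePreserving_fst_extLaw).const_mul β
  have h3 := (memLp_coord k).comp_measurePreserving hz
  exact (h1.add h2).add h3

theorem integrable_sqNorm_out₁ (hX : c.FinitePower) : Integrable (fun ω => sqNorm (c.out₁ hd hc ω)) c.extLaw :=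
  c.integrable_sqNorm_add hX hd hc (measurePreserving_fst.comp c.measurePreserving_noise)

theorem integrable_sqNorm_out₂ (hX : c.FinitePower) : Integrable (fun ω => sqNorm (c.out₂ hd hc ω)) c.extLaw := by
  -- The gains are exchanged because the helper lists the input of transmitter 1 first.
  have := c.integrable_sqNorm_add hX hc hd (measurePreserving_snd.comp c.measurePreserving_noise)
  refine this.congr (Filter.Eventually.of_forall fun ω => ?_)
  simp only [out₂, mean₂, Function.comp]
  rw [add_comm (hc • c.sent₁ ω.1)]

theorem integrable_sqNorm_outs (hX : c.FinitePower) : Integrable (fun ω => sqNormPair (c.outs hd hc ω)) c.extLaw :=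
  (c.integrable_sqNorm_out₁ hd hc hX).add (c.integrable_sqNorm_out₂ hd hc hX)

theorem integrable_sqNorm_meanS_fst (hX : c.FinitePower) {z : Extended N M₁ M₂ → Noise N}
    (hz : MeasurePreserving z c.extLaw (pairNoise N)) :
    Integrable (fun ω => sqNorm (c.meanS hc ω.1 + z ω).1) c.extLaw := by
  have := c.integrable_sqNorm_add hX 0 hc (measurePreserving_fst.comp hz)
  refine this.congr (Filter.Eventually.of_forall fun ω => ?_)
  simp [meanS]

theorem integrable_sqNorm_meanS_snd (hX : c.FinitePower) {z : Extended N M₁ M₂ → Noise N}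
    (hz : MeasurePreserving z c.extLaw (pairNoise N)) :
    Integrable (fun ω => sqNorm (c.meanS hc ω.1 + z ω).2) c.extLaw := by
  have := c.integrable_sqNorm_add hX hc 0 (measurePreserving_snd.comp hz)
  refine this.congr (Filter.Eventually.of_forall fun ω => ?_)
  simp [meanS]

theorem integrable_sqNorm_meanS (hX : c.FinitePower) {z : Extended N M₁ M₂ → Noise N}
    (hz : MeasurePreserving z c.extLaw (pairNoise N)) :
    Integrable (fun ω => sqNormPair (c.meanS hc ω.1 + z ω)) c.extLaw :=
  (c.integrable_sqNorm_meanS_fst hc hX hz).add (c.integrable_sqNorm_meanS_snd hc hX hz)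

/-! ### Log-integrability of the densities -/

theorem logIntegrable_densY (hX : c.FinitePower) : LogIntegrable (fun ω => c.densY hd hc (c.outs hd hc ω)) c.extLaw :=
  ⟨Filter.Eventually.of_forall fun _ => ⟨isNoise_pairNoise.mix_ne_zero
      (IsProbabilityMeasure.ne_zero _) (c.measurable_meanY hd hc) _, isNoise_pairNoise.mix_ne_top _ _⟩,
    isNoise_pairNoise.integrable_elog_mix (c.measurable_meanY hd hc) (c.measurable_outs hd hc)
      (c.integrable_sqNorm_outs hd hc hX)⟩

theorem logIntegrable_dens₂ (hX : c.FinitePower) : LogIntegrable (fun ω => c.dens₂ hd hc (c.out₂ hd hc ω)) c.extLaw :=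
  ⟨Filter.Eventually.of_forall fun _ => ⟨isNoise_stdNoise.mix_ne_zero
      (IsProbabilityMeasure.ne_zero _) (c.measurable_mean₂ hd hc) _, isNoise_stdNoise.mix_ne_top _ _⟩,
    isNoise_stdNoise.integrable_elog_mix (c.measurable_mean₂ hd hc) (c.measurable_out₂ hd hc)
      (c.integrable_sqNorm_out₂ hd hc hX)⟩

theorem logIntegrable_densS_intf (hX : c.FinitePower) : LogIntegrable (fun ω => c.densS hc (c.intf hc ω)) c.extLaw :=
  ⟨Filter.Eventually.of_forall fun _ => ⟨isNoise_pairNoise.mix_ne_zero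
      (IsProbabilityMeasure.ne_zero _) (c.measurable_meanS hc) _, isNoise_pairNoise.mix_ne_top _ _⟩,
    isNoise_pairNoise.integrable_elog_mix (c.measurable_meanS hc) (c.measurable_intf hc)
      (c.integrable_sqNorm_meanS hc hX c.measurePreserving_noise)⟩

theorem logIntegrable_densS_proxy (hX : c.FinitePower) : LogIntegrable (fun ω => c.densS hc (c.proxy hc ω)) c.extLaw :=
  ⟨Filter.Eventually.of_forall fun _ => ⟨isNoise_pairNoise.mix_ne_zero
      (IsProbabilityMeasure.ne_zero _) (c.measurable_meanS hc) _, isNoise_pairNoise.mix_ne_top _ _⟩,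
    isNoise_pairNoise.integrable_elog_mix (c.measurable_meanS hc) (c.measurable_proxy hc)
      (c.integrable_sqNorm_meanS hc hX c.measurePreserving_noise')⟩

theorem logIntegrable_densMsg (hX : c.FinitePower) :
    LogIntegrable (fun ω => c.densMsg hd hc ω.1.1.1 (c.out₂ hd hc ω)) c.extLaw :=
  ⟨Filter.Eventually.of_forall fun _ => c.densMsg_ne hd hc _ _,
    isNoise_stdNoise.integrable_elog_mix_family
      (μ := fun w => c.sources.restrict ((fun a => a.1.1) ⁻¹' {w})) (g := fun _ => c.mean₂ hd hc)
      (fun _ => c.measurable_mean₂ hd hc) measurable_fst.fst.fst (c.measurable_out₂ hd hc)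
      (c.integrable_sqNorm_out₂ hd hc hX)⟩

end Moments

end Code

namespace Code

variable {N M₁ M₂ : ℕ} (c : Code N M₁ M₂) (hd hc : ℝ)

theorem measurable_smul_block₁ (v : c.Links) : Measurable fun a => hc • c.block₁ v a :=
  (c.measurable_block₁ v).const_smul hc

theorem measurable_smul_block₂ (v : c.Links) : Measurable fun a => hc • c.block₂ v a :=
  (c.measurable_block₂ v).const_smul hc

theorem lintegral_extLaw {F : ((Fin M₁ × ℝ) × (Fin M₂ × ℝ)) → Noise N → Noise N → ℝ≥0∞}
    (hF : Measurable fun ω : Extended N M₁ M₂ => F ω.1 ω.2.1 ω.2.2) :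
    ∫⁻ ω, F ω.1 ω.2.1 ω.2.2 ∂c.extLaw
      = ∫⁻ a, ∫⁻ z, ∫⁻ z', F a z z' ∂(pairNoise N) ∂(pairNoise N) ∂c.sources := by
  rw [extLaw, lintegral_prod _ hF.aemeasurable]
  refine lintegral_congr fun a => ?_
  have hm : Measurable fun ζ : Noise N × Noise N => F a ζ.1 ζ.2 :=
    hF.comp (measurable_const.prodMk measurable_id)
  exact lintegral_prod _ hm.aemeasurable

theorem sum_densMsg (y : Fin N → ℝ) : ∑ w, c.densMsg hd hc w y = c.dens₂ hd hc y :=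
  (lintegral_eq_sum_fiber (measurable_fst.fst) _).symm

theorem measurable_msg₁ : Measurable (msg₁ : Sample N M₁ M₂ → Fin M₁) := measurable_fst.fst

theorem measurable_output₂ : Measurable (c.output₂ hd hc) := by
  have h : c.output₂ hd hc = fun ω => c.mean₂ hd hc (ω.1, ω.2.1) + ω.2.2.2 := by
    ext ω k
    simp [output₂, input₁_eq, input₂_eq, mean₂]
  rw [h]
  exact ((c.measurable_mean₂ hd hc).comp (measurable_fst.prodMk measurable_snd.fst)).add
    measurable_snd.snd.snd

/-! ### Log-integrability of the densities given the link symbols -/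

variable [NeZero M₁] [NeZero M₂]

/-- The source always lies in the compatible set of the observed link value, and there are finitely
many values, so almost surely this set is not null. -/
theorem ae_source₁_compat_ne_zero :
    ∀ᵐ ω ∂c.extLaw, c.source₁ (c.compat₁ (c.links ω.1.1 ω.1.2)) ≠ 0 := by
  have h : ∀ᵐ a ∂c.source₁, ∀ v, a ∈ c.compat₁ v → c.source₁ (c.compat₁ v) ≠ 0 := by
    rw [ae_all_iff]
    intro v
    by_cases hv : c.source₁ (c.compat₁ v) = 0
    · filter_upwards [measure_eq_zero_iff_ae_notMem.1 hv] with a ha h using absurd h ha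
    · exact Filter.Eventually.of_forall fun _ _ => hv
  have hq : MeasurePreserving (fun ω : Extended N M₁ M₂ => ω.1.1) c.extLaw c.source₁ :=
    (measurePreserving_fst (ν := c.source₂)).comp c.measurePreserving_fst_extLaw
  filter_upwards [hq.quasiMeasurePreserving.ae h] with ω hω
  exact hω _ ((c.links_eq_iff _ _ _).1 rfl).1

theorem ae_source₂_compat_ne_zero :
    ∀ᵐ ω ∂c.extLaw, c.source₂ (c.compat₂ (c.links ω.1.1 ω.1.2)) ≠ 0 := by
  have h : ∀ᵐ a ∂c.source₂, ∀ v, a ∈ c.compat₂ v → c.source₂ (c.compat₂ v) ≠ 0 := by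
    rw [ae_all_iff]
    intro v
    by_cases hv : c.source₂ (c.compat₂ v) = 0
    · filter_upwards [measure_eq_zero_iff_ae_notMem.1 hv] with a ha h using absurd h ha
    · exact Filter.Eventually.of_forall fun _ _ => hv
  have hq : MeasurePreserving (fun ω : Extended N M₁ M₂ => ω.1.2) c.extLaw c.source₂ :=
    (measurePreserving_snd (μ := c.source₁)).comp c.measurePreserving_fst_extLaw
  filter_upwards [hq.quasiMeasurePreserving.ae h] with ω hω
  exact hω _ ((c.links_eq_iff _ _ _).1 rfl).2

theorem logIntegrable_source₁_compat :
    LogIntegrable (fun ω => c.source₁ (c.compat₁ (c.links ω.1.1 ω.1.2))) c.extLaw := by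
  refine ⟨?_, integrable_finite_comp c.measurable_linkVar fun v => elog (c.source₁ (c.compat₁ v))⟩
  filter_upwards [c.ae_source₁_compat_ne_zero] with ω hω using ⟨hω, measure_ne_top _ _⟩

theorem logIntegrable_source₂_compat :
    LogIntegrable (fun ω => c.source₂ (c.compat₂ (c.links ω.1.1 ω.1.2))) c.extLaw := by
  refine ⟨?_, integrable_finite_comp c.measurable_linkVar fun v => elog (c.source₂ (c.compat₂ v))⟩
  filter_upwards [c.ae_source₂_compat_ne_zero] with ω hω using ⟨hω, measure_ne_top _ _⟩

theorem logIntegrable_densLink₁ (hX : c.FinitePower) :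
    LogIntegrable (fun ω => c.densLink₁ hc (c.links ω.1.1 ω.1.2) (c.intf hc ω).2) c.extLaw := by
  refine ⟨?_, isNoise_stdNoise.integrable_elog_mix_family
    (μ := fun v => c.source₁.restrict (c.compat₁ v)) (g := fun v a => hc • c.block₁ v a)
    (c.measurable_smul_block₁ hc) c.measurable_linkVar (c.measurable_intf hc).snd
    (c.integrable_sqNorm_meanS_snd hc hX c.measurePreserving_noise)⟩
  filter_upwards [c.ae_source₁_compat_ne_zero] with ω hω
  refine ⟨isNoise_stdNoise.mix_ne_zero ?_ (c.measurable_smul_block₁ hc _) _,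
    isNoise_stdNoise.mix_ne_top _ _⟩
  rwa [Ne, Measure.restrict_eq_zero]

theorem logIntegrable_densLink₂ (hX : c.FinitePower) :
    LogIntegrable (fun ω => c.densLink₂ hc (c.links ω.1.1 ω.1.2) (c.intf hc ω).1) c.extLaw := by
  refine ⟨?_, isNoise_stdNoise.integrable_elog_mix_family
    (μ := fun v => c.source₂.restrict (c.compat₂ v)) (g := fun v a => hc • c.block₂ v a)
    (c.measurable_smul_block₂ hc) c.measurable_linkVar (c.measurable_intf hc).fst
    (c.integrable_sqNorm_meanS_fst hc hX c.measurePreserving_noise)⟩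
  filter_upwards [c.ae_source₂_compat_ne_zero] with ω hω
  refine ⟨isNoise_stdNoise.mix_ne_zero ?_ (c.measurable_smul_block₂ hc _) _,
    isNoise_stdNoise.mix_ne_top _ _⟩
  rwa [Ne, Measure.restrict_eq_zero]

theorem logIntegrable_decTest₁ :
    LogIntegrable (fun ω => decTest c.dec₁ ω.1.1.1 (c.out₁ hd hc ω)) c.extLaw :=
  ⟨Filter.Eventually.of_forall fun _ => decTest_ne _ _ _,
    integrable_elog_decTest c.measurable_dec₁ measurable_fst.fst.fst (c.measurable_out₁ hd hc)⟩

theorem logIntegrable_decTest₂ :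
    LogIntegrable (fun ω => decTest c.dec₂ ω.1.2.1 (c.out₂ hd hc ω)) c.extLaw :=
  ⟨Filter.Eventually.of_forall fun _ => decTest_ne _ _ _,
    integrable_elog_decTest c.measurable_dec₂ measurable_fst.snd.fst (c.measurable_out₂ hd hc)⟩

/-! ### Integrals over the extended space -/

theorem lintegral_extLaw_fst {F : ((Fin M₁ × ℝ) × (Fin M₂ × ℝ)) → Noise N → ℝ≥0∞}
    (hF : Measurable (Function.uncurry F)) :
    ∫⁻ ω, F ω.1 ω.2.1 ∂c.extLaw = ∫⁻ a, ∫⁻ z, F a z ∂(pairNoise N) ∂c.sources := by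
  have hp : MeasurePreserving (Prod.map id Prod.fst :
      Extended N M₁ M₂ → ((Fin M₁ × ℝ) × (Fin M₂ × ℝ)) × Noise N) c.extLaw
      (c.sources.prod (pairNoise N)) := (MeasurePreserving.id c.sources).prod measurePreserving_fst
  exact (hp.lintegral_comp hF).trans (lintegral_prod _ hF.aemeasurable)

theorem measurable_densY : Measurable (c.densY hd hc) :=
  isNoise_pairNoise.measurable_mix (c.measurable_meanY hd hc)

theorem measurable_densS : Measurable (c.densS hc) :=
  isNoise_pairNoise.measurable_mix (c.measurable_meanS hc)

theorem measurable_dens₂ : Measurable (c.dens₂ hd hc) :=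
  isNoise_stdNoise.measurable_mix (c.measurable_mean₂ hd hc)

theorem measurable_densMsg : Measurable (Function.uncurry (c.densMsg hd hc)) :=
  measurable_from_prod_countable_right fun w => isNoise_stdNoise.measurable_mix
    (μ := c.sources.restrict ((fun a => a.1.1) ⁻¹' {w})) (c.measurable_mean₂ hd hc)

theorem measurable_densLink₁ : Measurable (Function.uncurry (c.densLink₁ hc)) := by
  have h : ∀ v, Measurable (c.densLink₁ hc v) := fun v => isNoise_stdNoise.measurable_mix
    (μ := c.source₁.restrict (c.compat₁ v)) (c.measurable_smul_block₁ hc v)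
  exact measurable_from_prod_countable_right h

theorem measurable_densLink₂ : Measurable (Function.uncurry (c.densLink₂ hc)) := by
  have h : ∀ v, Measurable (c.densLink₂ hc v) := fun v => isNoise_stdNoise.measurable_mix
    (μ := c.source₂.restrict (c.compat₂ v)) (c.measurable_smul_block₂ hc v)
  exact measurable_from_prod_countable_right h

/-! ### The entropy inequalities -/

/-- `log M₁ ≲ I(W₁; y₂) + h(y₁ | y₂) - h(z₁)`. -/
theorem decode₁_given_out₂ (hX : c.FinitePower)
    (hz : LogIntegrable (fun ω : Extended N M₁ M₂ => stdPDF N ω.2.1.1) c.extLaw) :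
    ∫ ω, elog (decTest c.dec₁ ω.1.1.1 (c.out₁ hd hc ω)) ∂c.extLaw
      + ∫ ω, elog (c.densY hd hc (c.outs hd hc ω)) ∂c.extLaw
      ≤ Real.log M₁ + ∫ ω, elog (c.densMsg hd hc ω.1.1.1 (c.out₂ hd hc ω)) ∂c.extLaw
        + ∫ ω, elog (stdPDF N ω.2.1.1) ∂c.extLaw := by
  have hM : LogIntegrable (fun _ : Extended N M₁ M₂ => (M₁ : ℝ≥0∞)) c.extLaw :=
    .of_const (natCast_ne (NeZero.pos M₁))
  have ht := c.logIntegrable_decTest₁ hd hc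
  have hy := c.logIntegrable_densY hd hc hX
  have hw := c.logIntegrable_densMsg hd hc hX
  -- In entropy terms E log `densMsg` = −h(y₂ | W₁) − log M₁, because `densMsg` is not normalised.
  have key := (ht.mul hy).integral_le ((hM.mul hw).mul hz) (by
    have h := lintegral_decode_given_other_le_one (isNoise_stdNoise (n := N)) (μ := c.sources)
      (NeZero.pos M₁) (W := fun a => a.1.1) measurable_fst.fst (b₁ := c.mean₁ hd hc)
      (c.measurable_mean₂ hd hc) (fun w => measurable_decTest c.measurable_dec₁ w)
      (fun y => (sum_decTest c.dec₁ y).le) (c.measurable_densY hd hc)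
      (by
        have := isNoise_pairNoise.lintegral_mix (μ := c.sources) (c.measurable_meanY hd hc)
        rw [measure_univ] at this
        exact this.le)
    refine le_trans (le_of_eq ?_) h
    refine c.lintegral_extLaw_fst (F := fun a z => decTest c.dec₁ a.1.1 (c.mean₁ hd hc a + z.1)
      * c.densY hd hc (c.meanY hd hc a + z)
        / (M₁ * c.densMsg hd hc a.1.1 (c.mean₂ hd hc a + z.2) * stdPDF N z.1)) ?_
    have m₁ := c.measurable_mean₁ hd hc
    have m₂ := c.measurable_mean₂ hd hc
    refine Measurable.div (Measurable.mul ?_ ?_) (Measurable.mul (Measurable.const_mul ?_ _) ?_)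
    · exact (measurable_uncurry_decTest c.measurable_dec₁).comp (measurable_fst.fst.fst.prodMk
        ((m₁.comp measurable_fst).add measurable_snd.fst))
    · exact (c.measurable_densY hd hc).comp
        (((c.measurable_meanY hd hc).comp measurable_fst).add measurable_snd)
    · exact (c.measurable_densMsg hd hc).comp (measurable_fst.fst.fst.prodMk
        ((m₂.comp measurable_fst).add measurable_snd.snd))
    · exact isNoise_stdNoise.measurable.comp measurable_snd.fst)
  rw [ht.integral_mul hy, (hM.mul hw).integral_mul hz, hM.integral_mul hw] at key
  simpa [elog_natCast] using key

/-- `I(W₁; y₂)` is at most the leakage. -/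
theorem leakage_le (hX : c.FinitePower) {r : ℝ} (hr : 0 ≤ r)
    (hs : mutualInfo c.law msg₁ (c.output₂ hd hc) ≤ ENNReal.ofReal r) :
    Real.log M₁ + ∫ ω, elog (c.densMsg hd hc ω.1.1.1 (c.out₂ hd hc ω)) ∂c.extLaw
      ≤ r + ∫ ω, elog (c.dens₂ hd hc (c.out₂ hd hc ω)) ∂c.extLaw := by
  have hT := c.measurePreserving_toSample
  have : IsProbabilityMeasure c.law :=
    hT.map_eq ▸ Measure.isProbabilityMeasure_map hT.measurable.aemeasurable
  have mY := c.measurable_output₂ hd hc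
  have mW := measurable_msg₁ (N := N) (M₁ := M₁) (M₂ := M₂)
  have mJ : Measurable fun ω : Sample N M₁ M₂ => (msg₁ ω, c.output₂ hd hc ω) := mW.prodMk mY
  have := Measure.isProbabilityMeasure_map (μ := c.law) mJ.aemeasurable
  have := Measure.isProbabilityMeasure_map (μ := c.law) mY.aemeasurable
  have := Measure.isProbabilityMeasure_map (μ := c.law) mW.aemeasurable
  -- The likelihood ratio p(y₂ | w) / p(y₂); the factor `M₁` normalises `densMsg`.
  set f : Fin M₁ × (Fin N → ℝ) → ℝ≥0∞ := fun x =>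
    M₁ * c.densMsg hd hc x.1 x.2 * (c.dens₂ hd hc x.2)⁻¹ with hf
  have hfm : Measurable f := ((c.measurable_densMsg hd hc).const_mul _).mul
    ((c.measurable_dens₂ hd hc).comp measurable_snd).inv
  have hpos : ∀ y, c.dens₂ hd hc y ≠ 0 ∧ c.dens₂ hd hc y ≠ ∞ := fun y =>
    ⟨isNoise_stdNoise.mix_ne_zero (IsProbabilityMeasure.ne_zero _) (c.measurable_mean₂ hd hc) _,
      isNoise_stdNoise.mix_ne_top _ _⟩
  have hMne := natCast_ne (NeZero.pos M₁)
  have hfl : ∀ x, elog (f x)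
      = Real.log M₁ + elog (c.densMsg hd hc x.1 x.2) - elog (c.dens₂ hd hc x.2) := by
    intro x
    rw [hf]
    simp only
    rw [elog_mul (mul_ne hMne (c.densMsg_ne hd hc _ _))
      ⟨ENNReal.inv_ne_zero.2 (hpos _).2, ENNReal.inv_ne_top.2 (hpos _).1⟩,
      elog_mul hMne (c.densMsg_ne hd hc _ _), elog_natCast]
    have : elog (c.dens₂ hd hc x.2)⁻¹ = - elog (c.dens₂ hd hc x.2) := by
      rw [elog, ENNReal.toReal_inv, Real.log_inv]; rfl
    rw [this, sub_eq_add_neg]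
  have mC : MeasurePreserving (fun ω : Extended N M₁ M₂ => (ω.1.1.1, c.out₂ hd hc ω)) c.extLaw
      (c.law.map fun ω => (msg₁ ω, c.output₂ hd hc ω)) := by
    have h1 : MeasurePreserving (fun ω : Sample N M₁ M₂ => (msg₁ ω, c.output₂ hd hc ω)) c.law
      (c.law.map fun ω => (msg₁ ω, c.output₂ hd hc ω)) := ⟨mJ, rfl⟩
    have h2 := h1.comp hT
    have e : (fun ω : Sample N M₁ M₂ => (msg₁ ω, c.output₂ hd hc ω)) ∘ toSample
        = fun ω : Extended N M₁ M₂ => (ω.1.1.1, c.out₂ hd hc ω) := by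
      funext ω
      simp only [Function.comp, output₂_toSample]
      rfl
    rwa [e] at h2
  have i1 := (c.logIntegrable_densMsg hd hc hX).2
  have i2 := (c.logIntegrable_dens₂ hd hc hX).2
  have hcomp : Integrable (fun ω : Extended N M₁ M₂ => elog (f (ω.1.1.1, c.out₂ hd hc ω))) c.extLaw := by
    simp_rw [hfl]
    exact ((integrable_const _).add i1).sub i2
  have hfi : Integrable (fun x => elog (f x)) (c.law.map fun ω => (msg₁ ω, c.output₂ hd hc ω)) :=
    (mC.integrable_comp (measurable_elog.comp hfm).aestronglyMeasurable).1 hcomp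
  -- Under the product law the message is uniform and independent of y₂, and the average of `f` over
  -- w is 1 by `sum_densMsg`.
  have hint : ∫⁻ x, f x ∂((c.law.map msg₁).prod (c.law.map (c.output₂ hd hc))) ≤ 1 := by
    rw [lintegral_prod_symm _ hfm.aemeasurable]
    have hw : ∀ w, (c.law.map msg₁) {w} = (M₁ : ℝ≥0∞)⁻¹ := by
      intro w
      rw [← hT.map_eq, Measure.map_map mW hT.measurable, Measure.map_apply (mW.comp hT.measurable)
        (measurableSet_singleton w), ← c.sources_msg w,
        ← c.measurePreserving_fst_extLaw.measure_preimage
          (measurable_fst.fst (measurableSet_singleton w)).nullMeasurableSet]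
      rfl
    calc ∫⁻ y, ∫⁻ w, f (w, y) ∂(c.law.map msg₁) ∂(c.law.map (c.output₂ hd hc))
        ≤ ∫⁻ _, 1 ∂(c.law.map (c.output₂ hd hc)) := by
          refine lintegral_mono fun y => ?_
          rw [lintegral_fintype]
          simp_rw [hw]
          calc ∑ w, f (w, y) * (M₁ : ℝ≥0∞)⁻¹
              = ∑ w, c.densMsg hd hc w y * (c.dens₂ hd hc y)⁻¹ := by
                refine Finset.sum_congr rfl fun w _ => ?_
                rw [hf]
                simp only
                calc (M₁ : ℝ≥0∞) * c.densMsg hd hc w y * (c.dens₂ hd hc y)⁻¹ * (M₁ : ℝ≥0∞)⁻¹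
                    = (M₁ * (M₁ : ℝ≥0∞)⁻¹) * (c.densMsg hd hc w y * (c.dens₂ hd hc y)⁻¹) := by ring
                  _ = _ := by rw [ENNReal.mul_inv_cancel hMne.1 hMne.2, one_mul]
            _ = 1 := by
                rw [← Finset.sum_mul, sum_densMsg, ENNReal.mul_inv_cancel (hpos y).1 (hpos y).2]
            _ ≤ 1 := le_rfl
      _ = 1 := by simp
  have key := integral_log_le_of_klDiv_le hfm
    (Filter.Eventually.of_forall fun x => mul_ne (mul_ne hMne (c.densMsg_ne hd hc x.1 x.2))
      ⟨ENNReal.inv_ne_zero.2 (hpos _).2, ENNReal.inv_ne_top.2 (hpos _).1⟩) hfi hint hr hs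
  have e := integral_map (μ := c.extLaw) mC.measurable.aemeasurable
    (f := fun x => elog (f x)) (measurable_elog.comp hfm).aestronglyMeasurable
  rw [mC.map_eq] at e
  change ∫ x, elog (f x) ∂(c.law.map fun ω => (msg₁ ω, c.output₂ hd hc ω)) ≤ r at key
  rw [e] at key
  simp_rw [hfl] at key
  rw [integral_sub (f := fun ω : Extended N M₁ M₂ => Real.log M₁ +
      elog (c.densMsg hd hc ω.1.1.1 (c.out₂ hd hc ω))) ((integrable_const _).add i1) i2, integral_add (integrable_const _) i1] at key
  simp only [integral_const, probReal_univ, smul_eq_mul, one_mul] at key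
  linarith

/-- The source whose message is decoded is outermost, the order required by
`lintegral_decode_interference_le_one`. -/
theorem lintegral_extLaw_noise₁ {H : ((Fin M₁ × ℝ) × (Fin M₂ × ℝ)) → (Fin N → ℝ) → ℝ≥0∞}
    (hH : Measurable (Function.uncurry H)) :
    ∫⁻ ω, H ω.1 ω.2.1.1 ∂c.extLaw
      = ∫⁻ a₁, ∫⁻ a₂, ∫⁻ z, H (a₁, a₂) z ∂(stdNoise N) ∂c.source₂ ∂c.source₁ := by
  have hp : MeasurePreserving (fun ω : Extended N M₁ M₂ => (ω.1, ω.2.1.1)) c.extLaw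
      (c.sources.prod (stdNoise N)) :=
    (MeasurePreserving.id c.sources).prod (measurePreserving_fst.comp measurePreserving_fst)
  refine (hp.lintegral_comp hH).trans ((lintegral_prod _ hH.aemeasurable).trans ?_)
  exact lintegral_prod _ (hH.lintegral_prod_right').aemeasurable

theorem lintegral_extLaw_noise₂ {H : ((Fin M₁ × ℝ) × (Fin M₂ × ℝ)) → (Fin N → ℝ) → ℝ≥0∞}
    (hH : Measurable (Function.uncurry H)) :
    ∫⁻ ω, H ω.1 ω.2.1.2 ∂c.extLaw
      = ∫⁻ a₂, ∫⁻ a₁, ∫⁻ z, H (a₁, a₂) z ∂(stdNoise N) ∂c.source₁ ∂c.source₂ := by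
  have hp : MeasurePreserving (fun ω : Extended N M₁ M₂ => (ω.1, ω.2.1.2)) c.extLaw
      (c.sources.prod (stdNoise N)) :=
    (MeasurePreserving.id c.sources).prod (measurePreserving_snd.comp measurePreserving_fst)
  refine (hp.lintegral_comp hH).trans ((lintegral_prod _ hH.aemeasurable).trans ?_)
  exact lintegral_prod_symm _ (hH.lintegral_prod_right').aemeasurable

theorem lintegral_decTest_source₁ (y : Fin N → ℝ) :
    ∫⁻ a, decTest c.dec₁ a.1 y ∂c.source₁ ≤ 1 := by
  rw [lintegral_eq_sum_fiber (measurable_fst : Measurable fun a : Fin M₁ × ℝ => a.1)]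
  calc _ = ∑ w, decTest c.dec₁ w y * (M₁ : ℝ≥0∞)⁻¹ := by
        refine Finset.sum_congr rfl fun w _ => ?_
        rw [setLIntegral_congr_fun (g := fun _ => decTest c.dec₁ w y)
          (measurable_fst (measurableSet_singleton w)) (fun a ha => by
            have : a.1 = w := ha
            simp only [this]), setLIntegral_const, source₁_msg]
    _ ≤ 1 := by
        rw [← Finset.sum_mul, sum_decTest]
        exact ENNReal.mul_inv_le_one _

theorem lintegral_decTest_source₂ (y : Fin N → ℝ) :
    ∫⁻ a, decTest c.dec₂ a.1 y ∂c.source₂ ≤ 1 := by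
  rw [lintegral_eq_sum_fiber (measurable_fst : Measurable fun a : Fin M₂ × ℝ => a.1)]
  calc _ = ∑ w, decTest c.dec₂ w y * (M₂ : ℝ≥0∞)⁻¹ := by
        refine Finset.sum_congr rfl fun w _ => ?_
        rw [setLIntegral_congr_fun (g := fun _ => decTest c.dec₂ w y)
          (measurable_fst (measurableSet_singleton w)) (fun a ha => by
            have : a.1 = w := ha
            simp only [this]), setLIntegral_const, source₂_msg]
    _ ≤ 1 := by
        rw [← Finset.sum_mul, sum_decTest]
        exact ENNReal.mul_inv_le_one _

/-- `log M₂ ≲ h(y₂) - h(s₁ | V)`. -/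
theorem decode₂_interference (hX : c.FinitePower) :
    ∫ ω, elog (decTest c.dec₂ ω.1.2.1 (c.out₂ hd hc ω)) ∂c.extLaw
      + ∫ ω, elog (c.dens₂ hd hc (c.out₂ hd hc ω)) ∂c.extLaw
      + ∫ ω, elog (c.source₁ (c.compat₁ (c.links ω.1.1 ω.1.2))) ∂c.extLaw
      ≤ ∫ ω, elog (c.densLink₁ hc (c.links ω.1.1 ω.1.2) (c.intf hc ω).2) ∂c.extLaw := by
  have ht := c.logIntegrable_decTest₂ hd hc
  have hy := c.logIntegrable_dens₂ hd hc hX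
  have hs := c.logIntegrable_source₁_compat
  -- The conditional density of s₁ given V = v is `densLink₁` divided by the mass of the compatible
  -- set; that mass therefore stands in the numerator.
  have key := ((ht.mul hy).mul hs).integral_le (c.logIntegrable_densLink₁ hc hX) (by
    have hp1 := isNoise_stdNoise.lintegral_mix (μ := c.sources) (c.measurable_mean₂ hd hc)
    rw [measure_univ] at hp1
    have h := lintegral_decode_interference_le_one (isNoise_stdNoise (n := N))
      (m₁ := c.source₁) (m₂ := c.source₂) c.measurableSet_compat₁ c.links_eq_iff
      (d := fun v a => hd • c.block₂ v a) (c.measurable_smul_block₁ hc)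
      (t := fun a y => decTest c.dec₂ a.1 y)
      ((measurable_uncurry_decTest c.measurable_dec₂).comp
        (measurable_fst.fst.prodMk measurable_snd))
      c.lintegral_decTest_source₂ (c.measurable_dens₂ hd hc) hp1.le
    refine le_trans (le_of_eq ?_) h
    refine c.lintegral_extLaw_noise₂ (H := fun a z => decTest c.dec₂ a.2.1 (c.mean₂ hd hc a + z)
      * c.dens₂ hd hc (c.mean₂ hd hc a + z) * c.source₁ (c.compat₁ (c.links a.1 a.2))
        / c.densLink₁ hc (c.links a.1 a.2) (hc • c.sent₁ a + z)) ?_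
    have mY : Measurable fun x : ((Fin M₁ × ℝ) × (Fin M₂ × ℝ)) × (Fin N → ℝ) =>
      c.mean₂ hd hc x.1 + x.2 := ((c.measurable_mean₂ hd hc).comp measurable_fst).add measurable_snd
    refine Measurable.div (Measurable.mul (Measurable.mul ?_ ?_) ?_) ?_
    · exact (measurable_uncurry_decTest c.measurable_dec₂).comp (measurable_fst.snd.fst.prodMk mY)
    · exact (c.measurable_dens₂ hd hc).comp mY
    · exact (measurable_of_finite fun v => c.source₁ (c.compat₁ v)).comp
        (c.measurable_links.comp measurable_fst)
    · exact (c.measurable_densLink₁ hc).comp ((c.measurable_links.comp measurable_fst).prodMk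
        (((c.measurable_sent₁.const_smul hc).comp measurable_fst).add measurable_snd)))
  rwa [(ht.mul hy).integral_mul hs, ht.integral_mul hy] at key

/-- `log M₁ ≲ h(y₁) - h(s₂ | V)`, where the entropy of `y₁` is bounded through a density `q`. -/
theorem decode₁_interference (hX : c.FinitePower) {q : (Fin N → ℝ) → ℝ≥0∞} (hq : Measurable q)
    (hq1 : ∫⁻ y, q y ≤ 1) (hqi : LogIntegrable (fun ω => q (c.out₁ hd hc ω)) c.extLaw) :
    ∫ ω, elog (decTest c.dec₁ ω.1.1.1 (c.out₁ hd hc ω)) ∂c.extLaw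
      + ∫ ω, elog (q (c.out₁ hd hc ω)) ∂c.extLaw
      + ∫ ω, elog (c.source₂ (c.compat₂ (c.links ω.1.1 ω.1.2))) ∂c.extLaw
      ≤ ∫ ω, elog (c.densLink₂ hc (c.links ω.1.1 ω.1.2) (c.intf hc ω).1) ∂c.extLaw := by
  have ht := c.logIntegrable_decTest₁ hd hc
  have hs := c.logIntegrable_source₂_compat
  have key := ((ht.mul hqi).mul hs).integral_le (c.logIntegrable_densLink₂ hc hX) (by
    -- The same lemma with the two transmitters exchanged.
    have h := lintegral_decode_interference_le_one (isNoise_stdNoise (n := N))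
      (m₁ := c.source₂) (m₂ := c.source₁) (V := fun a₂ a₁ => c.links a₁ a₂)
      c.measurableSet_compat₂ (fun a₂ a₁ v => (c.links_eq_iff a₁ a₂ v).trans and_comm)
      (d := fun v a => hd • c.block₁ v a) (c.measurable_smul_block₂ hc)
      (t := fun a y => decTest c.dec₁ a.1 y)
      ((measurable_uncurry_decTest c.measurable_dec₁).comp
        (measurable_fst.fst.prodMk measurable_snd))
      c.lintegral_decTest_source₁ hq hq1
    refine le_trans (le_of_eq ?_) h
    refine c.lintegral_extLaw_noise₁ (H := fun a z => decTest c.dec₁ a.1.1 (c.mean₁ hd hc a + z)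
      * q (c.mean₁ hd hc a + z) * c.source₂ (c.compat₂ (c.links a.1 a.2))
        / c.densLink₂ hc (c.links a.1 a.2) (hc • c.sent₂ a + z)) ?_
    have mY : Measurable fun x : ((Fin M₁ × ℝ) × (Fin M₂ × ℝ)) × (Fin N → ℝ) =>
      c.mean₁ hd hc x.1 + x.2 := ((c.measurable_mean₁ hd hc).comp measurable_fst).add measurable_snd
    refine Measurable.div (Measurable.mul (Measurable.mul ?_ ?_) ?_) ?_
    · exact (measurable_uncurry_decTest c.measurable_dec₁).comp (measurable_fst.fst.fst.prodMk mY)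
    · exact hq.comp mY
    · exact (measurable_of_finite fun v => c.source₂ (c.compat₂ v)).comp
        (c.measurable_links.comp measurable_fst)
    · exact (c.measurable_densLink₂ hc).comp ((c.measurable_links.comp measurable_fst).prodMk
        (((c.measurable_sent₂.const_smul hc).comp measurable_fst).add measurable_snd)))
  rwa [(ht.mul hqi).integral_mul hs, ht.integral_mul hqi] at key

/-- `h(s₁, s₂) ≤ h(s₁ | V) + h(s₂ | V) + log #V`. -/
theorem entropy_links (hX : c.FinitePower) :
    ∫ ω, elog (c.densLink₁ hc (c.links ω.1.1 ω.1.2) (c.intf hc ω).2) ∂c.extLaw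
      + ∫ ω, elog (c.densLink₂ hc (c.links ω.1.1 ω.1.2) (c.intf hc ω).1) ∂c.extLaw
      ≤ ∫ ω, elog (c.source₁ (c.compat₁ (c.links ω.1.1 ω.1.2))) ∂c.extLaw
        + ∫ ω, elog (c.source₂ (c.compat₂ (c.links ω.1.1 ω.1.2))) ∂c.extLaw
        + Real.log (Fintype.card c.Links) + ∫ ω, elog (c.densS hc (c.intf hc ω)) ∂c.extLaw := by
  have hl₁ := c.logIntegrable_densLink₁ hc hX
  have hl₂ := c.logIntegrable_densLink₂ hc hX
  have hs₁ := c.logIntegrable_source₁_compat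
  have hs₂ := c.logIntegrable_source₂_compat
  have hS := c.logIntegrable_densS_intf hc hX
  have hcard : LogIntegrable (fun _ : Extended N M₁ M₂ => (Fintype.card c.Links : ℝ≥0∞)) c.extLaw := by
    have : Nonempty c.Links := ⟨c.links (0, 0) (0, 0)⟩
    exact .of_const (natCast_ne Fintype.card_pos)
  have key := (hl₁.mul hl₂).integral_le (((hs₁.mul hs₂).mul hcard).mul hS) (by
    have h := lintegral_link_le_one (isNoise_stdNoise (n := N)).measurable
      (isNoise_pairNoise (N := N)) (m₁ := c.source₁) (m₂ := c.source₂) c.measurable_links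
      c.measurableSet_compat₁ c.measurableSet_compat₂ c.links_eq_iff
      (c.measurable_smul_block₁ hc) (c.measurable_smul_block₂ hc) (c.measurable_densS hc)
      (fun s => isNoise_pairNoise.mix_ne_top _ s) (fun s => le_rfl)
    refine le_trans (le_of_eq ?_) h
    refine c.lintegral_extLaw_fst (F := fun a z =>
      c.densLink₁ hc (c.links a.1 a.2) (hc • c.sent₁ a + z.2)
        * c.densLink₂ hc (c.links a.1 a.2) (hc • c.sent₂ a + z.1)
        / (c.source₁ (c.compat₁ (c.links a.1 a.2)) * c.source₂ (c.compat₂ (c.links a.1 a.2))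
          * Fintype.card c.Links * c.densS hc (c.meanS hc a + z))) ?_
    have mL : Measurable fun x : ((Fin M₁ × ℝ) × (Fin M₂ × ℝ)) × Noise N =>
      c.links x.1.1 x.1.2 := c.measurable_links.comp measurable_fst
    refine Measurable.div (Measurable.mul ?_ ?_)
      (Measurable.mul (Measurable.mul_const (Measurable.mul ?_ ?_) _) ?_)
    · exact (c.measurable_densLink₁ hc).comp (mL.prodMk
        (((c.measurable_sent₁.const_smul hc).comp measurable_fst).add measurable_snd.snd))
    · exact (c.measurable_densLink₂ hc).comp (mL.prodMk
        (((c.measurable_sent₂.const_smul hc).comp measurable_fst).add measurable_snd.fst))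
    · exact (measurable_of_finite fun v => c.source₁ (c.compat₁ v)).comp mL
    · exact (measurable_of_finite fun v => c.source₂ (c.compat₂ v)).comp mL
    · exact (c.measurable_densS hc).comp
        (((c.measurable_meanS hc).comp measurable_fst).add measurable_snd))
  rw [hl₁.integral_mul hl₂, ((hs₁.mul hs₂).mul hcard).integral_mul hS,
    (hs₁.mul hs₂).integral_mul hcard, hs₁.integral_mul hs₂] at key
  simp only [elog_natCast, integral_const, probReal_univ, smul_eq_mul, one_mul] at key
  exact key

/-- `h(y) + h(z') ≤ h(s) + h(y | s)`, where the conditional entropy is bounded through a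
conditional density `q`. -/
theorem entropy_genie (hX : c.FinitePower) {q : Noise N → Noise N → ℝ≥0∞}
    (hq : Measurable (Function.uncurry q)) (hq1 : ∀ s, ∫⁻ y, q y s ≤ 1)
    (hqi : LogIntegrable (fun ω => q (c.outs hd hc ω) (c.proxy hc ω)) c.extLaw)
    (hz : LogIntegrable (fun ω : Extended N M₁ M₂ => pairPDF (stdPDF N) ω.2.2) c.extLaw) :
    ∫ ω, elog (c.densS hc (c.proxy hc ω)) ∂c.extLaw
      + ∫ ω, elog (q (c.outs hd hc ω) (c.proxy hc ω)) ∂c.extLaw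
      ≤ ∫ ω, elog (c.densY hd hc (c.outs hd hc ω)) ∂c.extLaw
        + ∫ ω, elog (pairPDF (stdPDF N) ω.2.2) ∂c.extLaw := by
  have hS := c.logIntegrable_densS_proxy hc hX
  have hY := c.logIntegrable_densY hd hc hX
  have key := (hS.mul hqi).integral_le (hY.mul hz) (by
    have hp1 := isNoise_pairNoise.lintegral_mix (μ := c.sources) (c.measurable_meanS hc)
    rw [measure_univ] at hp1
    have h := lintegral_genie_le_one (isNoise_pairNoise (N := N)) (μ := c.sources)
      (g := c.meanS hc) (c.measurable_meanY hd hc) (c.measurable_densS hc) hp1.le hq hq1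
    refine le_trans (le_of_eq ?_) h
    refine c.lintegral_extLaw (F := fun a z z' => c.densS hc (c.meanS hc a + z')
      * q (c.meanY hd hc a + z) (c.meanS hc a + z')
        / (c.densY hd hc (c.meanY hd hc a + z) * pairPDF (stdPDF N) z')) ?_
    refine Measurable.div (Measurable.mul ?_ ?_) (Measurable.mul ?_ ?_)
    · exact (c.measurable_densS hc).comp (c.measurable_proxy hc)
    · exact hq.comp ((c.measurable_outs hd hc).prodMk (c.measurable_proxy hc))
    · exact (c.measurable_densY hd hc).comp (c.measurable_outs hd hc)
    · exact isNoise_pairNoise.measurable.comp measurable_snd.snd)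
  rwa [hS.integral_mul hqi, hY.integral_mul hz] at key

/-- Exchanging the channel noise with its copy preserves `extLaw`. This joins `entropy_links`, which
concerns the channel noise, to `entropy_genie`, which needs the independent copy. -/
theorem integral_densS_intf :
    ∫ ω, elog (c.densS hc (c.intf hc ω)) ∂c.extLaw
      = ∫ ω, elog (c.densS hc (c.proxy hc ω)) ∂c.extLaw := by
  have hp : MeasurePreserving (Prod.map id Prod.swap : Extended N M₁ M₂ → Extended N M₁ M₂)
      c.extLaw c.extLaw :=
    (MeasurePreserving.id c.sources).prod Measure.measurePreserving_swap
  have h := integral_map (μ := c.extLaw) hp.measurable.aemeasurable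
    (f := fun ω => elog (c.densS hc (c.intf hc ω)))
    (measurable_elog.comp ((c.measurable_densS hc).comp (c.measurable_intf hc))).aestronglyMeasurable
  rw [hp.map_eq] at h
  exact h

/-- The entropy inequalities combined. -/
theorem entropy_bound (hX : c.FinitePower) {r : ℝ} (hr : 0 ≤ r)
    (hs : mutualInfo c.law msg₁ (c.output₂ hd hc) ≤ ENNReal.ofReal r)
    {q₁ : (Fin N → ℝ) → ℝ≥0∞} (hq₁ : Measurable q₁)
    (hq₁1 : ∫⁻ y, q₁ y ≤ 1) (hq₁i : LogIntegrable (fun ω => q₁ (c.out₁ hd hc ω)) c.extLaw)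
    {q : Noise N → Noise N → ℝ≥0∞}
    (hq : Measurable (Function.uncurry q)) (hq1 : ∀ s, ∫⁻ y, q y s ≤ 1)
    (hqi : LogIntegrable (fun ω => q (c.outs hd hc ω) (c.proxy hc ω)) c.extLaw)
    (hz : LogIntegrable (fun ω : Extended N M₁ M₂ => stdPDF N ω.2.1.1) c.extLaw)
    (hz' : LogIntegrable (fun ω : Extended N M₁ M₂ => pairPDF (stdPDF N) ω.2.2) c.extLaw) :
    2 * ∫ ω, elog (decTest c.dec₁ ω.1.1.1 (c.out₁ hd hc ω)) ∂c.extLaw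
      + ∫ ω, elog (decTest c.dec₂ ω.1.2.1 (c.out₂ hd hc ω)) ∂c.extLaw
      + ∫ ω, elog (q₁ (c.out₁ hd hc ω)) ∂c.extLaw
      + ∫ ω, elog (q (c.outs hd hc ω) (c.proxy hc ω)) ∂c.extLaw
      ≤ r + Real.log (Fintype.card c.Links) + ∫ ω, elog (stdPDF N ω.2.1.1) ∂c.extLaw
        + ∫ ω, elog (pairPDF (stdPDF N) ω.2.2) ∂c.extLaw := by
  have hA := c.decode₁_given_out₂ hd hc hX hz
  have hS := c.leakage_le hd hc hX hr hs
  have hB := c.decode₂_interference hd hc hX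
  have hC := c.decode₁_interference hd hc hX hq₁ hq₁1 hq₁i
  have hD := c.entropy_links hc hX
  have hE := c.entropy_genie hd hc hX hq hq1 hqi hz'
  have hW := c.integral_densS_intf hc
  -- In the sum the terms in `densMsg`, `dens₂`, `densY`, `densLink₁`, `densLink₂`, `densS` and the
  -- compatible sets all cancel.
  linarith

end Code

/-! ### Second moments of sums of independent variables -/

section Independent

variable {A B : Type*} [MeasurableSpace A] [MeasurableSpace B] {μ : Measure A} {ν : Measure B}
  [IsProbabilityMeasure μ] [IsProbabilityMeasure ν] {f : A → ℝ} {g : B → ℝ}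

theorem memLp_add_prod (hf : MemLp f 2 μ) (hg : MemLp g 2 ν) :
    MemLp (fun p : A × B => f p.1 + g p.2) 2 (μ.prod ν) :=
  (hf.comp_measurePreserving measurePreserving_fst).add
    (hg.comp_measurePreserving measurePreserving_snd)

theorem integral_add_prod (hf : MemLp f 2 μ) (hg : MemLp g 2 ν) :
    ∫ p, (f p.1 + g p.2) ∂(μ.prod ν) = ∫ a, f a ∂μ + ∫ b, g b ∂ν := by
  have hf1 := hf.integrable one_le_two
  have hg1 := hg.integrable one_le_two
  rw [integral_add (hf1.comp_fst ν) (hg1.comp_snd μ), integral_fun_fst, integral_fun_snd]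
  simp

/-- The cross term factorises and only `g` has to be centred, so signals with nonzero mean are
allowed. -/
theorem integral_add_sq_prod (hf : MemLp f 2 μ) (hg : MemLp g 2 ν) (h0 : ∫ b, g b ∂ν = 0) :
    ∫ p, (f p.1 + g p.2) ^ 2 ∂(μ.prod ν) = ∫ a, f a ^ 2 ∂μ + ∫ b, g b ^ 2 ∂ν := by
  have hf1 := hf.integrable one_le_two
  have hg1 := hg.integrable one_le_two
  have i1 : Integrable (fun p : A × B => f p.1 ^ 2) (μ.prod ν) := hf.integrable_sq.comp_fst ν
  have i2 : Integrable (fun p : A × B => g p.2 ^ 2) (μ.prod ν) := hg.integrable_sq.comp_snd μ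
  have i3 : Integrable (fun p : A × B => 2 * (f p.1 * g p.2)) (μ.prod ν) :=
    (hf1.mul_prod hg1).const_mul 2
  have e : ∀ p : A × B, (f p.1 + g p.2) ^ 2 = f p.1 ^ 2 + g p.2 ^ 2 + 2 * (f p.1 * g p.2) :=
    fun p => by ring
  simp_rw [e]
  rw [integral_add (f := fun p : A × B => f p.1 ^ 2 + g p.2 ^ 2) (i1.add i2) i3,
    integral_add i1 i2, integral_const_mul, integral_prod_mul, h0,
    integral_fun_fst (fun a => f a ^ 2), integral_fun_snd (fun b => g b ^ 2)]
  simp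

end Independent

/-! ### Second moments of the noise coordinates -/

section NoiseMoments

variable {N : ℕ} (k : Fin N)

theorem memLp_mul_coord (u : ℝ) : MemLp (fun z : Fin N → ℝ => u * z k) 2 (stdNoise N) :=
  (memLp_coord k).const_mul u

theorem integral_mul_coord (u : ℝ) : ∫ z : Fin N → ℝ, u * z k ∂(stdNoise N) = 0 := by
  rw [integral_const_mul, integral_coord, mul_zero]

theorem integral_mul_coord_sq (u : ℝ) : ∫ z : Fin N → ℝ, (u * z k) ^ 2 ∂(stdNoise N) = u ^ 2 := by
  simp_rw [mul_pow]
  rw [integral_const_mul, integral_coord_sq, mul_one]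

theorem memLp_pair (u v : ℝ) :
    MemLp (fun z : Code.Noise N => u * z.1 k + v * z.2 k) 2 (Code.pairNoise N) :=
  memLp_add_prod (memLp_mul_coord k u) (memLp_mul_coord k v)

theorem integral_pair (u v : ℝ) :
    ∫ z : Code.Noise N, (u * z.1 k + v * z.2 k) ∂(Code.pairNoise N) = 0 := by
  have h := integral_add_prod (memLp_mul_coord k u) (memLp_mul_coord k v)
  rwa [integral_mul_coord, integral_mul_coord, add_zero] at h

theorem integral_pair_sq (u v : ℝ) :
    ∫ z : Code.Noise N, (u * z.1 k + v * z.2 k) ^ 2 ∂(Code.pairNoise N) = u ^ 2 + v ^ 2 := by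
  have h := integral_add_sq_prod (memLp_mul_coord k u) (memLp_mul_coord k v)
    (integral_mul_coord k v)
  rwa [integral_mul_coord_sq, integral_mul_coord_sq] at h

end NoiseMoments

namespace Code

variable {N M₁ M₂ : ℕ} (c : Code N M₁ M₂) (hd hc : ℝ) [NeZero M₁] [NeZero M₂]

/-- A signal coordinate plus a linear combination of the noise coordinates. -/
def noisy (f : ((Fin M₁ × ℝ) × (Fin M₂ × ℝ)) → ℝ) (k : Fin N) (u₁ u₂ u₃ u₄ : ℝ)
    (ω : Extended N M₁ M₂) : ℝ :=
  f ω.1 + ((u₁ * ω.2.1.1 k + u₂ * ω.2.1.2 k) + (u₃ * ω.2.2.1 k + u₄ * ω.2.2.2 k))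

variable {f : ((Fin M₁ × ℝ) × (Fin M₂ × ℝ)) → ℝ} (k : Fin N)
  (u₁ u₂ u₃ u₄ : ℝ)

theorem integrable_noisy_sq (hf : MemLp f 2 c.sources) :
    Integrable (fun ω => noisy f k u₁ u₂ u₃ u₄ ω ^ 2) c.extLaw :=
  (memLp_add_prod hf (memLp_add_prod (memLp_pair k u₁ u₂) (memLp_pair k u₃ u₄))).integrable_sq

theorem integral_noisy_sq (hf : MemLp f 2 c.sources) :
    ∫ ω, noisy f k u₁ u₂ u₃ u₄ ω ^ 2 ∂c.extLaw
      = ∫ a, f a ^ 2 ∂c.sources + (u₁ ^ 2 + u₂ ^ 2 + u₃ ^ 2 + u₄ ^ 2) := by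
  have hn := memLp_add_prod (memLp_pair k u₁ u₂) (memLp_pair k u₃ u₄)
  have h0 := integral_add_prod (memLp_pair k u₁ u₂) (memLp_pair k u₃ u₄)
  have h1 := integral_add_sq_prod (memLp_pair k u₁ u₂) (memLp_pair k u₃ u₄) (integral_pair k u₃ u₄)
  rw [integral_pair, integral_pair, add_zero] at h0
  rw [integral_pair_sq, integral_pair_sq] at h1
  have h := integral_add_sq_prod hf hn h0
  rw [h1] at h
  refine h.trans ?_
  ring

/-- Total second moment of a linear combination of the inputs. -/
theorem sum_integral_lin_sq (hX : c.FinitePower) (u v : ℝ) :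
    ∑ k, ∫ a, (u * c.sent₁ a k + v * c.sent₂ a k) ^ 2 ∂c.sources
      = u ^ 2 * ∑ k, ∫ a, c.sent₁ a k ^ 2 ∂c.sources + v ^ 2 * ∑ k, ∫ a, c.sent₂ a k ^ 2 ∂c.sources
        + 2 * u * v * ∑ k, ∫ a, c.sent₁ a k * c.sent₂ a k ∂c.sources := by
  simp_rw [Finset.mul_sum]
  rw [← Finset.sum_add_distrib, ← Finset.sum_add_distrib]
  refine Finset.sum_congr rfl fun k _ => ?_
  have i1 := (hX.1 k).integrable_sq.const_mul (u ^ 2)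
  have i2 := (hX.2 k).integrable_sq.const_mul (v ^ 2)
  have i3 : Integrable (fun a => 2 * u * v * (c.sent₁ a k * c.sent₂ a k)) c.sources :=
    ((hX.1 k).integrable_mul (hX.2 k)).const_mul _
  have e : ∀ a, (u * c.sent₁ a k + v * c.sent₂ a k) ^ 2 = u ^ 2 * c.sent₁ a k ^ 2
      + v ^ 2 * c.sent₂ a k ^ 2 + 2 * u * v * (c.sent₁ a k * c.sent₂ a k) := fun a => by ring
  simp_rw [e]
  rw [integral_add (f := fun a => u ^ 2 * c.sent₁ a k ^ 2 + v ^ 2 * c.sent₂ a k ^ 2)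
    (i1.add i2) i3, integral_add i1 i2, integral_const_mul, integral_const_mul, integral_const_mul]

theorem memLp_lin (hX : c.FinitePower) (u v : ℝ) (k : Fin N) :
    MemLp (fun a => u * c.sent₁ a k + v * c.sent₂ a k) 2 c.sources :=
  ((hX.1 k).const_mul u).add ((hX.2 k).const_mul v)

theorem integrable_sum_noisy_sq (hX : c.FinitePower) (u v : ℝ) :
    Integrable (fun ω => ∑ k, noisy (fun a => u * c.sent₁ a k + v * c.sent₂ a k) k u₁ u₂ u₃ u₄ ω ^ 2)
      c.extLaw :=
  integrable_finsetSum _ fun k _ => c.integrable_noisy_sq k u₁ u₂ u₃ u₄ (c.memLp_lin hX u v k)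

theorem integral_sum_noisy_sq (hX : c.FinitePower) (u v : ℝ) :
    ∫ ω, ∑ k, noisy (fun a => u * c.sent₁ a k + v * c.sent₂ a k) k u₁ u₂ u₃ u₄ ω ^ 2 ∂c.extLaw
      = u ^ 2 * ∑ k, ∫ a, c.sent₁ a k ^ 2 ∂c.sources + v ^ 2 * ∑ k, ∫ a, c.sent₂ a k ^ 2 ∂c.sources
        + 2 * u * v * ∑ k, ∫ a, c.sent₁ a k * c.sent₂ a k ∂c.sources
        + N * (u₁ ^ 2 + u₂ ^ 2 + u₃ ^ 2 + u₄ ^ 2) := by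
  rw [integral_finsetSum _ fun k _ => c.integrable_noisy_sq k u₁ u₂ u₃ u₄ (c.memLp_lin hX u v k)]
  simp_rw [fun k => c.integral_noisy_sq k u₁ u₂ u₃ u₄ (c.memLp_lin hX u v k)]
  rw [Finset.sum_add_distrib, c.sum_integral_lin_sq hX, Finset.sum_const, Finset.card_univ,
    Fintype.card_fin, nsmul_eq_mul]

/-! ### Gaussian log-densities -/

/-- Pure noise is written as `noisy` with zero signal coefficients so that `integral_sum_noisy_sq`
serves all the log-densities. -/
theorem elog_noise₁ (ω : Extended N M₁ M₂) :
    elog (stdPDF N ω.2.1.1) = -(N / 2 * Real.log (2 * Real.pi))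
      - (∑ k, noisy (fun a => 0 * c.sent₁ a k + 0 * c.sent₂ a k) k 1 0 0 0 ω ^ 2) / 2 := by
  rw [elog, stdPDF, log_gaussPDF _ one_ne_zero]
  simp [noisy]

theorem elog_noise_pair (ω : Extended N M₁ M₂) :
    elog (pairPDF (stdPDF N) ω.2.2) = -(N * Real.log (2 * Real.pi))
      - (∑ k, noisy (fun a => 0 * c.sent₁ a k + 0 * c.sent₂ a k) k 0 0 1 0 ω ^ 2) / 2
      - (∑ k, noisy (fun a => 0 * c.sent₁ a k + 0 * c.sent₂ a k) k 0 0 0 1 ω ^ 2) / 2 := by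
  rw [pairPDF, elog_mul ⟨gaussPDF_ne_zero _ one_ne_zero _, gaussPDF_ne_top _ _ _⟩
    ⟨gaussPDF_ne_zero _ one_ne_zero _, gaussPDF_ne_top _ _ _⟩, elog, elog,
    log_gaussPDF _ one_ne_zero, log_gaussPDF _ one_ne_zero]
  simp [noisy]
  ring

theorem elog_out₁ {v : ℝ≥0} (hv : v ≠ 0) (ω : Extended N M₁ M₂) :
    elog (gaussPDF 0 v (c.out₁ hd hc ω)) = -(N / 2 * Real.log (2 * Real.pi * v))
      - (∑ k, noisy (fun a => hd * c.sent₁ a k + hc * c.sent₂ a k) k 1 0 0 0 ω ^ 2) / (2 * v) := by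
  rw [elog, log_gaussPDF _ hv]
  simp [noisy, out₁, mean₁]

/-- Linear estimate of the outputs from the interference: gain `b₁` on the sum and `b₂` on the
difference of the two components. -/
def estimate (b₁ b₂ : ℝ) (s : Noise N) : Noise N :=
  (((b₁ - b₂) / 2) • s.1 + ((b₁ + b₂) / 2) • s.2, ((b₁ + b₂) / 2) • s.1 + ((b₁ - b₂) / 2) • s.2)

theorem measurable_estimate (b₁ b₂ : ℝ) : Measurable (estimate b₁ b₂ : Noise N → Noise N) := by
  unfold estimate; fun_prop

/-- The residuals decouple: their sum contains only x₁ + x₂, their difference only x₁ − x₂. As the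
first interference component comes from transmitter 2, `b₂` acts on s.2 − s.1. -/
theorem elog_outs {l₁ l₂ : ℝ≥0} (h₁ : l₁ ≠ 0) (h₂ : l₂ ≠ 0) (b₁ b₂ : ℝ) (ω : Extended N M₁ M₂) :
    elog (pairGaussPDF l₁ l₂ (estimate b₁ b₂ (c.proxy hc ω)) (c.outs hd hc ω))
      = -(N * Real.log (2 * Real.pi) + N / 2 * Real.log (l₁ * l₂))
        - (∑ k, noisy (fun a => (hd + hc - b₁ * hc) * c.sent₁ a k + (hd + hc - b₁ * hc) * c.sent₂ a k)
            k 1 1 (-b₁) (-b₁) ω ^ 2) / (4 * l₁)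
        - (∑ k, noisy (fun a => (hd - hc - b₂ * hc) * c.sent₁ a k + -(hd - hc - b₂ * hc) * c.sent₂ a k)
            k 1 (-1) b₂ (-b₂) ω ^ 2) / (4 * l₂) := by
  rw [elog, log_pairGaussPDF h₁ h₂]
  congr 2
  · congr 1
    refine Finset.sum_congr rfl fun k _ => ?_
    simp only [noisy, outs, proxy, estimate, meanY, meanS, mean₁, mean₂, Prod.fst_add, Prod.snd_add,
      Pi.add_apply, Pi.smul_apply, smul_eq_mul]
    ring
  · refine Finset.sum_congr rfl fun k _ => ?_
    simp only [noisy, outs, proxy, estimate, meanY, meanS, mean₁, mean₂, Prod.fst_add, Prod.snd_add,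
      Pi.add_apply, Pi.smul_apply, smul_eq_mul]
    ring

theorem logIntegrable_noise₁ (hX : c.FinitePower) :
    LogIntegrable (fun ω : Extended N M₁ M₂ => stdPDF N ω.2.1.1) c.extLaw := by
  refine ⟨Filter.Eventually.of_forall fun _ =>
    ⟨gaussPDF_ne_zero _ one_ne_zero _, gaussPDF_ne_top _ _ _⟩, ?_⟩
  simp_rw [c.elog_noise₁]
  exact (integrable_const _).sub ((c.integrable_sum_noisy_sq _ _ _ _ hX 0 0).div_const _)

theorem logIntegrable_noise_pair (hX : c.FinitePower) :
    LogIntegrable (fun ω : Extended N M₁ M₂ => pairPDF (stdPDF N) ω.2.2) c.extLaw := by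
  refine ⟨Filter.Eventually.of_forall fun _ => mul_ne
    ⟨gaussPDF_ne_zero _ one_ne_zero _, gaussPDF_ne_top _ _ _⟩
    ⟨gaussPDF_ne_zero _ one_ne_zero _, gaussPDF_ne_top _ _ _⟩, ?_⟩
  simp_rw [c.elog_noise_pair]
  exact ((integrable_const _).sub ((c.integrable_sum_noisy_sq _ _ _ _ hX 0 0).div_const _)).sub
    ((c.integrable_sum_noisy_sq _ _ _ _ hX 0 0).div_const _)

theorem logIntegrable_out₁ (hX : c.FinitePower) {v : ℝ≥0} (hv : v ≠ 0) :
    LogIntegrable (fun ω => gaussPDF 0 v (c.out₁ hd hc ω)) c.extLaw := by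
  refine ⟨Filter.Eventually.of_forall fun _ =>
    ⟨gaussPDF_ne_zero _ hv _, gaussPDF_ne_top _ _ _⟩, ?_⟩
  simp_rw [c.elog_out₁ hd hc hv]
  exact (integrable_const _).sub ((c.integrable_sum_noisy_sq _ _ _ _ hX hd hc).div_const _)

theorem logIntegrable_outs (hX : c.FinitePower) {l₁ l₂ : ℝ≥0} (h₁ : l₁ ≠ 0) (h₂ : l₂ ≠ 0)
    (b₁ b₂ : ℝ) : LogIntegrable
      (fun ω => pairGaussPDF l₁ l₂ (estimate b₁ b₂ (c.proxy hc ω)) (c.outs hd hc ω)) c.extLaw := by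
  refine ⟨Filter.Eventually.of_forall fun _ =>
    ⟨pairGaussPDF_ne_zero h₁ h₂ _ _, pairGaussPDF_ne_top _ _ _ _⟩, ?_⟩
  simp_rw [c.elog_outs hd hc h₁ h₂]
  exact ((integrable_const _).sub ((c.integrable_sum_noisy_sq _ _ _ _ hX _ _).div_const _)).sub
    ((c.integrable_sum_noisy_sq _ _ _ _ hX _ _).div_const _)

theorem integral_const_sub_div (hX : c.FinitePower) (C D u v : ℝ) :
    ∫ ω, (C - (∑ k, noisy (fun a => u * c.sent₁ a k + v * c.sent₂ a k) k u₁ u₂ u₃ u₄ ω ^ 2) / D)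
      ∂c.extLaw = C - (∫ ω, ∑ k, noisy (fun a => u * c.sent₁ a k + v * c.sent₂ a k) k u₁ u₂ u₃ u₄ ω ^ 2
        ∂c.extLaw) / D := by
  rw [integral_sub (integrable_const _) ((c.integrable_sum_noisy_sq _ _ _ _ hX _ _).div_const _),
    integral_div]
  simp

theorem integral_const_sub_div_sub_div (hX : c.FinitePower)
    (C D D' u v u' v' w₁ w₂ w₃ w₄ : ℝ) :
    ∫ ω, (C - (∑ k, noisy (fun a => u * c.sent₁ a k + v * c.sent₂ a k) k u₁ u₂ u₃ u₄ ω ^ 2) / D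
        - (∑ k, noisy (fun a => u' * c.sent₁ a k + v' * c.sent₂ a k) k w₁ w₂ w₃ w₄ ω ^ 2) / D') ∂c.extLaw
      = C - (∫ ω, ∑ k, noisy (fun a => u * c.sent₁ a k + v * c.sent₂ a k) k u₁ u₂ u₃ u₄ ω ^ 2
          ∂c.extLaw) / D
        - (∫ ω, ∑ k, noisy (fun a => u' * c.sent₁ a k + v' * c.sent₂ a k) k w₁ w₂ w₃ w₄ ω ^ 2
          ∂c.extLaw) / D' := by
  have i1 : Integrable (fun ω => C -
      (∑ k, noisy (fun a => u * c.sent₁ a k + v * c.sent₂ a k) k u₁ u₂ u₃ u₄ ω ^ 2) / D) c.extLaw :=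
    (integrable_const _).sub ((c.integrable_sum_noisy_sq _ _ _ _ hX _ _).div_const _)
  rw [integral_sub i1 ((c.integrable_sum_noisy_sq _ _ _ _ hX _ _).div_const _), integral_div,
    c.integral_const_sub_div _ _ _ _ hX]

theorem integral_elog_noise₁ (hX : c.FinitePower) :
    ∫ ω : Extended N M₁ M₂, elog (stdPDF N ω.2.1.1) ∂c.extLaw
      = -(N / 2 * Real.log (2 * Real.pi)) - N / 2 := by
  simp_rw [c.elog_noise₁]
  rw [c.integral_const_sub_div _ _ _ _ hX, c.integral_sum_noisy_sq _ _ _ _ hX]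
  ring

theorem integral_elog_noise_pair (hX : c.FinitePower) :
    ∫ ω : Extended N M₁ M₂, elog (pairPDF (stdPDF N) ω.2.2) ∂c.extLaw
      = -(N * Real.log (2 * Real.pi)) - N := by
  simp_rw [c.elog_noise_pair]
  rw [c.integral_const_sub_div_sub_div _ _ _ _ hX, c.integral_sum_noisy_sq _ _ _ _ hX,
    c.integral_sum_noisy_sq _ _ _ _ hX]
  ring

theorem integral_elog_out₁ (hX : c.FinitePower) {v : ℝ≥0} (hv : v ≠ 0) :
    ∫ ω, elog (gaussPDF 0 v (c.out₁ hd hc ω)) ∂c.extLaw = -(N / 2 * Real.log (2 * Real.pi * v))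
      - (hd ^ 2 * ∑ k, ∫ a, c.sent₁ a k ^ 2 ∂c.sources + hc ^ 2 * ∑ k, ∫ a, c.sent₂ a k ^ 2 ∂c.sources
        + 2 * hd * hc * ∑ k, ∫ a, c.sent₁ a k * c.sent₂ a k ∂c.sources + N) / (2 * v) := by
  simp_rw [c.elog_out₁ hd hc hv]
  rw [c.integral_const_sub_div _ _ _ _ hX, c.integral_sum_noisy_sq _ _ _ _ hX]
  congr 2
  ring

theorem integral_elog_outs (hX : c.FinitePower) {l₁ l₂ : ℝ≥0} (h₁ : l₁ ≠ 0) (h₂ : l₂ ≠ 0)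
    (b₁ b₂ : ℝ) :
    ∫ ω, elog (pairGaussPDF l₁ l₂ (estimate b₁ b₂ (c.proxy hc ω)) (c.outs hd hc ω)) ∂c.extLaw
      = -(N * Real.log (2 * Real.pi) + N / 2 * Real.log (l₁ * l₂))
        - ((hd + hc - b₁ * hc) ^ 2 * (∑ k, ∫ a, c.sent₁ a k ^ 2 ∂c.sources
            + ∑ k, ∫ a, c.sent₂ a k ^ 2 ∂c.sources
            + 2 * ∑ k, ∫ a, c.sent₁ a k * c.sent₂ a k ∂c.sources) + N * (2 + 2 * b₁ ^ 2)) / (4 * l₁)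
        - ((hd - hc - b₂ * hc) ^ 2 * (∑ k, ∫ a, c.sent₁ a k ^ 2 ∂c.sources
            + ∑ k, ∫ a, c.sent₂ a k ^ 2 ∂c.sources
            - 2 * ∑ k, ∫ a, c.sent₁ a k * c.sent₂ a k ∂c.sources) + N * (2 + 2 * b₂ ^ 2)) / (4 * l₂) := by
  simp_rw [c.elog_outs hd hc h₁ h₂]
  rw [c.integral_const_sub_div_sub_div _ _ _ _ hX, c.integral_sum_noisy_sq _ _ _ _ hX,
    c.integral_sum_noisy_sq _ _ _ _ hX]
  ring

end Code

/-! ### The bound for a single code -/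

/-- Error variance of estimating `h x + z` from `√B x + z'` for `h² = H` and a Gaussian `x` of
variance `Q`. -/
def condVar (H B Q : ℝ) : ℝ := 1 + H * Q / (1 + B * Q)

theorem condVar_eq {H B Q : ℝ} (h : 1 + B * Q ≠ 0) :
    condVar H B Q = 1 + H * Q - H * B * Q ^ 2 / (1 + B * Q) := by
  rw [condVar, add_sub_assoc, add_right_inj, eq_sub_iff_add_eq, ← add_div, div_eq_iff h]
  ring

theorem one_le_condVar {H B Q : ℝ} (hH : 0 ≤ H) (hB : 0 ≤ B) (hQ : 0 ≤ Q) : 1 ≤ condVar H B Q := by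
  have : 0 ≤ H * Q / (1 + B * Q) := by positivity
  unfold condVar; linarith

/-- The error of the linear estimate of `h x + z` from `b x + z'` that is optimal for variance `Q`. -/
theorem linear_estimate_error {h b Q X n : ℝ} (hQ : 0 ≤ Q) (hX : X ≤ 2 * n * Q) :
    (h - h * b * Q / (1 + b ^ 2 * Q) * b) ^ 2 * X + n * (2 + 2 * (h * b * Q / (1 + b ^ 2 * Q)) ^ 2)
      ≤ 2 * n * condVar (h ^ 2) (b ^ 2) Q := by
  have hp : 0 < 1 + b ^ 2 * Q := by positivity
  -- Equality holds at X = 2nQ, and the error is nondecreasing in X.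
  have e : (h - h * b * Q / (1 + b ^ 2 * Q) * b) ^ 2 * (2 * n * Q)
      + n * (2 + 2 * (h * b * Q / (1 + b ^ 2 * Q)) ^ 2) = 2 * n * condVar (h ^ 2) (b ^ 2) Q := by
    unfold condVar
    field_simp
    ring
  rw [← e]
  gcongr

namespace Code

variable {N M₁ M₂ : ℕ} (c : Code N M₁ M₂) {hd hc : ℝ}

theorem size₁₂_pos [NeZero M₁] (k : ℕ) : 0 < c.size₁₂ k :=
  (Nat.zero_le _).trans_lt (c.f₁₂_lt k 0 0 [])

theorem size₂₁_pos [NeZero M₂] (k : ℕ) : 0 < c.size₂₁ k :=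
  (Nat.zero_le _).trans_lt (c.f₂₁_lt k 0 0 [])

theorem log_card_links_le [NeZero M₁] [NeZero M₂] {CG : ℝ} (h : c.LinkConstraint CG) :
    Real.log (Fintype.card c.Links) ≤ 2 * N * CG * Real.log 2 := by
  have hl2 : 0 < Real.log 2 := Real.log_pos one_lt_two
  have hcard : (Fintype.card c.Links : ℝ)
      = (∏ k ∈ Finset.range N, (c.size₁₂ k : ℝ)) * ∏ k ∈ Finset.range N, (c.size₂₁ k : ℝ) := by
    rw [Fintype.card_prod, Fintype.card_pi, Fintype.card_pi, Finset.prod_range, Finset.prod_range]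
    simp
  have h1 : ∀ k ∈ Finset.range N, (c.size₁₂ k : ℝ) ≠ 0 := fun k _ => by
    exact_mod_cast (c.size₁₂_pos k).ne'
  have h2 : ∀ k ∈ Finset.range N, (c.size₂₁ k : ℝ) ≠ 0 := fun k _ => by
    exact_mod_cast (c.size₂₁_pos k).ne'
  rw [hcard, Real.log_mul (Finset.prod_ne_zero_iff.2 h1) (Finset.prod_ne_zero_iff.2 h2),
    Real.log_prod h1, Real.log_prod h2]
  obtain ⟨a, b⟩ := h
  simp only [Real.logb] at a b
  rw [← Finset.sum_div, div_le_iff₀ hl2] at a b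
  linarith

variable [NeZero M₁] [NeZero M₂]

theorem lintegral_law_eq {F : ((Fin M₁ × ℝ) × (Fin M₂ × ℝ)) → ℝ≥0∞} (hF : Measurable F) :
    ∫⁻ ω, F (ω.1, ω.2.1) ∂c.law = ∫⁻ a, F a ∂c.sources := by
  have hm : Measurable fun ω : Sample N M₁ M₂ => F (ω.1, ω.2.1) :=
    hF.comp (measurable_fst.prodMk measurable_snd.fst)
  rw [← c.measurePreserving_toSample.lintegral_comp hm,
    ← c.measurePreserving_fst_extLaw.lintegral_comp hF]
  rfl

theorem sum_integral_sq_le {A : Type*} [MeasurableSpace A] {μ : Measure A} {X : Fin N → A → ℝ}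
    (hX : ∀ k, Measurable (X k)) {r : ℝ} (hr : 0 ≤ r)
    (h : ∑ k, ∫⁻ a, ENNReal.ofReal (X k a ^ 2) ∂μ ≤ ENNReal.ofReal r) :
    (∀ k, MemLp (X k) 2 μ) ∧ ∑ k, ∫ a, X k a ^ 2 ∂μ ≤ r := by
  have hfin : ∀ k, ∫⁻ a, ENNReal.ofReal (X k a ^ 2) ∂μ < ∞ := fun k =>
    ((Finset.single_le_sum (f := fun k => ∫⁻ a, ENNReal.ofReal (X k a ^ 2) ∂μ)
      (fun _ _ => zero_le) (Finset.mem_univ k)).trans h).trans_lt ENNReal.ofReal_lt_top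
  have hint : ∀ k, Integrable (fun a => X k a ^ 2) μ := fun k =>
    ⟨((hX k).pow_const 2).aestronglyMeasurable, by
      rw [hasFiniteIntegral_iff_ofReal (Filter.Eventually.of_forall fun a => sq_nonneg _)]
      exact hfin k⟩
  refine ⟨fun k => (memLp_two_iff_integrable_sq (hX k).aestronglyMeasurable).2 (hint k), ?_⟩
  rw [← ENNReal.ofReal_le_ofReal_iff hr, ENNReal.ofReal_sum_of_nonneg
    fun k _ => integral_nonneg fun a => sq_nonneg _]
  refine le_trans (le_of_eq (Finset.sum_congr rfl fun k _ => ?_)) h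
  exact ofReal_integral_eq_lintegral_ofReal (hint k) (Filter.Eventually.of_forall fun a => sq_nonneg _)

theorem power_bounds {P : ℝ} (hP : 0 ≤ P) (h : c.PowerConstraint P) :
    c.FinitePower ∧ ∑ k, ∫ a, c.sent₁ a k ^ 2 ∂c.sources ≤ N * P
      ∧ ∑ k, ∫ a, c.sent₂ a k ^ 2 ∂c.sources ≤ N * P := by
  have m₁ : ∀ k, Measurable fun a => c.sent₁ a k := fun k =>
    (measurable_pi_apply k).comp c.measurable_sent₁
  have m₂ : ∀ k, Measurable fun a => c.sent₂ a k := fun k =>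
    (measurable_pi_apply k).comp c.measurable_sent₂
  obtain ⟨h₁, h₂⟩ := h
  simp_rw [c.input₁_eq] at h₁
  simp_rw [c.input₂_eq] at h₂
  simp_rw [fun k => c.lintegral_law_eq (F := fun a => ENNReal.ofReal (c.sent₁ a k ^ 2))
    ((m₁ k).pow_const 2).ennreal_ofReal] at h₁
  simp_rw [fun k => c.lintegral_law_eq (F := fun a => ENNReal.ofReal (c.sent₂ a k ^ 2))
    ((m₂ k).pow_const 2).ennreal_ofReal] at h₂
  have hNP : (0 : ℝ) ≤ N * P := by positivity
  have r₁ := sum_integral_sq_le m₁ hNP h₁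
  have r₂ := sum_integral_sq_le m₂ hNP h₂
  exact ⟨⟨r₁.1, r₂.1⟩, r₁.2, r₂.2⟩

/-- The average correlation coefficient of the two inputs. -/
theorem exists_correlation {P : ℝ} (hP : 0 ≤ P) (hX : c.FinitePower)
    (h₁ : ∑ k, ∫ a, c.sent₁ a k ^ 2 ∂c.sources ≤ N * P)
    (h₂ : ∑ k, ∫ a, c.sent₂ a k ^ 2 ∂c.sources ≤ N * P) :
    ∃ ρ ∈ Set.Icc (-1 : ℝ) 1, ∑ k, ∫ a, c.sent₁ a k * c.sent₂ a k ∂c.sources = ρ * (N * P) := by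
  -- Expanding Σ E (x₁ ± x₂)² ≥ 0 bounds the total correlation by N P in absolute value.
  have e₁ := c.sum_integral_lin_sq hX 1 1
  have e₂ := c.sum_integral_lin_sq hX 1 (-1)
  have n₁ : 0 ≤ ∑ k, ∫ a, (1 * c.sent₁ a k + 1 * c.sent₂ a k) ^ 2 ∂c.sources :=
    Finset.sum_nonneg fun k _ => integral_nonneg fun a => sq_nonneg _
  have n₂ : 0 ≤ ∑ k, ∫ a, (1 * c.sent₁ a k + -1 * c.sent₂ a k) ^ 2 ∂c.sources :=
    Finset.sum_nonneg fun k _ => integral_nonneg fun a => sq_nonneg _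
  rw [e₁] at n₁
  rw [e₂] at n₂
  set T := ∑ k, ∫ a, c.sent₁ a k * c.sent₂ a k ∂c.sources
  -- If N P = 0, then `n₁` and `n₂` force T = 0 and any ρ will do.
  rcases (show (0 : ℝ) ≤ N * P by positivity).eq_or_lt with h0 | h0
  · refine ⟨0, by constructor <;> norm_num, ?_⟩
    rw [zero_mul]
    linarith
  · refine ⟨T / (N * P), ⟨?_, ?_⟩, (div_mul_cancel₀ T h0.ne').symm⟩
    · rw [le_div_iff₀ h0]; linarith
    · rw [div_le_iff₀ h0]; linarith

theorem law_error₁ {ε : ℝ} (h : c.Reliable hd hc ε) :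
    c.extLaw {ω | c.dec₁ (c.out₁ hd hc ω) ≠ ω.1.1.1} ≤ ENNReal.ofReal ε := by
  refine le_trans ?_ h.1
  have := (c.measurePreserving_toSample).measure_preimage_le
    {ω | c.dec₁ (c.output₁ hd hc ω) ≠ msg₁ ω}
  simp only [Set.preimage_ofPred_eq, output₁_toSample] at this
  exact this

theorem law_error₂ {ε : ℝ} (h : c.Reliable hd hc ε) :
    c.extLaw {ω | c.dec₂ (c.out₂ hd hc ω) ≠ ω.1.2.1} ≤ ENNReal.ofReal ε := by
  refine le_trans ?_ h.2
  have := (c.measurePreserving_toSample).measure_preimage_le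
    {ω | c.dec₂ (c.output₂ hd hc ω) ≠ msg₂ ω}
  simp only [Set.preimage_ofPred_eq, output₂_toSample] at this
  exact this

theorem received_power_nonneg {ρ : ℝ} (hρ : ρ ∈ Set.Icc (-1 : ℝ) 1) :
    0 ≤ hd ^ 2 + hc ^ 2 + 2 * ρ * (hd * hc) := by
  obtain ⟨h1, h2⟩ := hρ
  nlinarith [sq_nonneg (hd + ρ * hc), mul_nonneg (mul_nonneg (by linarith : 0 ≤ 1 - ρ)
    (by linarith : 0 ≤ 1 + ρ)) (sq_nonneg hc)]

/-- The rate bound for one code, in nats per block. -/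
theorem rate_bound {P CG ε : ℝ} (hP : 0 ≤ P) (hε : 0 ≤ ε) (hL : c.LinkConstraint CG)
    (hpow : c.PowerConstraint P) (hrel : c.Reliable hd hc ε) (hsec : c.WeaklySecret hd hc ε) :
    ∃ ρ ∈ Set.Icc (-1 : ℝ) 1,
      (1 - ε) * (2 * Real.log M₁ + Real.log M₂) - 3 * Real.log 2
        ≤ N * ε * Real.log 2 + 2 * N * CG * Real.log 2
          + N / 2 * Real.log (1 + (hd ^ 2 + hc ^ 2 + 2 * ρ * (hd * hc)) * P)
          + N / 2 * Real.log (condVar ((hd + hc) ^ 2) (hc ^ 2) (P * (1 + ρ))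
            * condVar ((hd - hc) ^ 2) (hc ^ 2) (P * (1 - ρ))) := by
  obtain ⟨hX, hS₁, hS₂⟩ := c.power_bounds hP hpow
  obtain ⟨ρ, hρ, hT⟩ := c.exists_correlation hP hX hS₁ hS₂
  refine ⟨ρ, hρ, ?_⟩
  have hQ₁ : 0 ≤ P * (1 + ρ) := mul_nonneg hP (by linarith [hρ.1])
  have hQ₂ : 0 ≤ P * (1 - ρ) := mul_nonneg hP (by linarith [hρ.2])
  have hg := received_power_nonneg (hd := hd) (hc := hc) hρ
  have hv1 : 0 < 1 + (hd ^ 2 + hc ^ 2 + 2 * ρ * (hd * hc)) * P := by positivity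
  have hl1 : 0 < condVar ((hd + hc) ^ 2) (hc ^ 2) (P * (1 + ρ)) :=
    zero_lt_one.trans_le (one_le_condVar (sq_nonneg _) (sq_nonneg _) hQ₁)
  have hl2 : 0 < condVar ((hd - hc) ^ 2) (hc ^ 2) (P * (1 - ρ)) :=
    zero_lt_one.trans_le (one_le_condVar (sq_nonneg _) (sq_nonneg _) hQ₂)
  -- `b₁` and `b₂` are the regression coefficients in the sum and difference directions for inputs
  -- of full power P and correlation ρ.
  set b₁ := (hd + hc) * hc * (P * (1 + ρ)) / (1 + hc ^ 2 * (P * (1 + ρ))) with hb₁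
  set b₂ := (hd - hc) * hc * (P * (1 - ρ)) / (1 + hc ^ 2 * (P * (1 - ρ))) with hb₂
  obtain ⟨v, hv⟩ : ∃ v : ℝ≥0, (v : ℝ) = 1 + (hd ^ 2 + hc ^ 2 + 2 * ρ * (hd * hc)) * P :=
    ⟨⟨_, hv1.le⟩, rfl⟩
  obtain ⟨l₁, hl₁⟩ : ∃ l : ℝ≥0, (l : ℝ) = condVar ((hd + hc) ^ 2) (hc ^ 2) (P * (1 + ρ)) :=
    ⟨⟨_, hl1.le⟩, rfl⟩
  obtain ⟨l₂, hl₂⟩ : ∃ l : ℝ≥0, (l : ℝ) = condVar ((hd - hc) ^ 2) (hc ^ 2) (P * (1 - ρ)) :=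
    ⟨⟨_, hl2.le⟩, rfl⟩
  have hv0 : v ≠ 0 := fun h => by rw [h] at hv; simp at hv; linarith
  have hl₁0 : l₁ ≠ 0 := fun h => by rw [h] at hl₁; simp at hl₁; linarith
  have hl₂0 : l₂ ≠ 0 := fun h => by rw [h] at hl₂; simp at hl₂; linarith
  have hr : (0 : ℝ) ≤ N * ε * Real.log 2 := by
    have := Real.log_nonneg (one_le_two (α := ℝ)); positivity
  have key := c.entropy_bound hd hc hX hr hsec.1
    (measurable_gaussPDF measurable_const measurable_id v) (lintegral_gaussPDF 0 hv0).le
    (c.logIntegrable_out₁ hd hc hX hv0)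
    (q := fun y s => pairGaussPDF l₁ l₂ (estimate b₁ b₂ s) y)
    (measurable_pairGaussPDF ((measurable_estimate b₁ b₂).comp measurable_snd) measurable_fst l₁ l₂)
    (fun s => (lintegral_pairGaussPDF hl₁0 hl₂0 _).le)
    (c.logIntegrable_outs hd hc hX hl₁0 hl₂0 b₁ b₂)
    (c.logIntegrable_noise₁ hX) (c.logIntegrable_noise_pair hX)
  have t₁ := le_integral_elog_decTest (P := c.extLaw) (M := M₁) c.measurable_dec₁
    (W := fun ω => ω.1.1.1) measurable_fst.fst.fst (c.measurable_out₁ hd hc) hε (c.law_error₁ hrel)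
  have t₂ := le_integral_elog_decTest (P := c.extLaw) (M := M₂) c.measurable_dec₂
    (W := fun ω => ω.1.2.1) measurable_fst.snd.fst (c.measurable_out₂ hd hc) hε (c.law_error₂ hrel)
  have hcard := c.log_card_links_le hL
  simp only [id] at key
  rw [c.integral_elog_out₁ hd hc hX hv0, c.integral_elog_outs hd hc hX hl₁0 hl₂0,
    c.integral_elog_noise₁ hX, c.integral_elog_noise_pair hX, hT, hv, hl₁, hl₂] at key
  set S₁ := ∑ k, ∫ a, c.sent₁ a k ^ 2 ∂c.sources
  set S₂ := ∑ k, ∫ a, c.sent₂ a k ^ 2 ∂c.sources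
  -- Each Gaussian exponent has mean at most N / 2: the variances were chosen for full power, and
  -- the cross term is exact by the choice of ρ.
  have q₁ : (hd ^ 2 * S₁ + hc ^ 2 * S₂ + 2 * hd * hc * (ρ * (N * P)) + N)
      / (2 * (1 + (hd ^ 2 + hc ^ 2 + 2 * ρ * (hd * hc)) * P)) ≤ N / 2 := by
    rw [div_le_iff₀ (by positivity)]
    nlinarith [mul_le_mul_of_nonneg_left hS₁ (sq_nonneg hd),
      mul_le_mul_of_nonneg_left hS₂ (sq_nonneg hc)]
  have q₂ : ((hd + hc - b₁ * hc) ^ 2 * (S₁ + S₂ + 2 * (ρ * (N * P))) + N * (2 + 2 * b₁ ^ 2))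
      / (4 * condVar ((hd + hc) ^ 2) (hc ^ 2) (P * (1 + ρ))) ≤ N / 2 := by
    rw [div_le_iff₀ (by positivity)]
    have := linear_estimate_error (h := hd + hc) (b := hc) (n := N)
      (X := S₁ + S₂ + 2 * (ρ * (N * P))) hQ₁ (by linarith)
    linarith
  have q₃ : ((hd - hc - b₂ * hc) ^ 2 * (S₁ + S₂ - 2 * (ρ * (N * P))) + N * (2 + 2 * b₂ ^ 2))
      / (4 * condVar ((hd - hc) ^ 2) (hc ^ 2) (P * (1 - ρ))) ≤ N / 2 := by
    rw [div_le_iff₀ (by positivity)]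
    have := linear_estimate_error (h := hd - hc) (b := hc) (n := N)
      (X := S₁ + S₂ - 2 * (ρ * (N * P))) hQ₂ (by linarith)
    linarith
  -- The three exponents N / 2 and the terms in log 2π now cancel against those of the three noise
  -- blocks.
  rw [Real.log_mul (by positivity) hv1.ne'] at key
  linarith

end Code

/-! ### The outer bound in terms of the error variances -/

/-- The vectors (1, 1) and (1, −1) diagonalise all three matrices, so the Schur complement splits
into two scalar ones. -/
theorem det_circulant_schur {y₀ y₁ t₀ t₁ a b : ℝ} (h₁ : a + b ≠ 0) (h₂ : a - b ≠ 0) :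
    ((!![y₀, y₁; y₁, y₀] : Matrix (Fin 2) (Fin 2) ℝ) - !![t₀, t₁; t₁, t₀] * (!![a, b; b, a])⁻¹
      * (!![t₀, t₁; t₁, t₀]).transpose).det
      = (y₀ + y₁ - (t₀ + t₁) ^ 2 / (a + b)) * (y₀ - y₁ - (t₀ - t₁) ^ 2 / (a - b)) := by
  have e : a * a - b * b = (a + b) * (a - b) := by ring
  have ht : (!![t₀, t₁; t₁, t₀] : Matrix (Fin 2) (Fin 2) ℝ).transpose = !![t₀, t₁; t₁, t₀] := by
    ext i j
    fin_cases i <;> fin_cases j <;> rfl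
  rw [ht, Matrix.inv_def, Matrix.det_fin_two_of, Ring.inverse_eq_inv', Matrix.adjugate_fin_two_of,
    e, mul_smul_comm, smul_mul_assoc, Matrix.mul_fin_two, Matrix.mul_fin_two, Matrix.det_fin_two]
  simp only [Matrix.sub_apply, Matrix.smul_apply, Matrix.of_apply, Matrix.cons_val_zero,
    Matrix.cons_val_one, Matrix.cons_val', Matrix.cons_val_fin_one, smul_eq_mul]
  field_simp
  ring

/-- The scalar Schur complements are `condVar` at powers P (1 ± ρ). The absolute values stem from
√(SNR · INR) = |h_d| |h_c| P. -/
theorem outerBound_eq (CG : ℝ) {hd hc P ρ : ℝ} (hP : 0 ≤ P) (hρ : ρ ∈ Set.Icc (-1 : ℝ) 1) :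
    outerBound CG (hd ^ 2 * P) (hc ^ 2 * P) ρ
      = (1 / 3) * (2 * CG
        + (1 / 2) * Real.logb 2 (1 + (hd ^ 2 + hc ^ 2 + 2 * ρ * (|hd| * |hc|)) * P)
        + (1 / 2) * Real.logb 2 (condVar ((|hd| + |hc|) ^ 2) (hc ^ 2) (P * (1 + ρ))
          * condVar ((|hd| - |hc|) ^ 2) (hc ^ 2) (P * (1 - ρ)))) := by
  have hs : √(hd ^ 2 * P * (hc ^ 2 * P)) = |hd| * |hc| * P := by
    rw [show hd ^ 2 * P * (hc ^ 2 * P) = (|hd| * |hc| * P) ^ 2 by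
      rw [mul_pow, mul_pow, sq_abs, sq_abs]; ring]
    exact Real.sqrt_sq (by positivity)
  have hQ₁ : 0 ≤ P * (1 + ρ) := mul_nonneg hP (by linarith [hρ.1])
  have hQ₂ : 0 ≤ P * (1 - ρ) := mul_nonneg hP (by linarith [hρ.2])
  have p₁ : 0 < 1 + hc ^ 2 * (P * (1 + ρ)) := by positivity
  have p₂ : 0 < 1 + hc ^ 2 * (P * (1 - ρ)) := by positivity
  have e₁ : 1 + hc ^ 2 * P + ρ * (hc ^ 2 * P) = 1 + hc ^ 2 * (P * (1 + ρ)) := by ring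
  have e₂ : 1 + hc ^ 2 * P - ρ * (hc ^ 2 * P) = 1 + hc ^ 2 * (P * (1 - ρ)) := by ring
  unfold outerBound sigmaYgivenS sigmaY sigmaYS sigmaS
  rw [det_circulant_schur (by rw [e₁]; exact p₁.ne') (by rw [e₂]; exact p₂.ne'), hs, e₁, e₂]
  have d₁ : hd ^ 2 = |hd| ^ 2 := (sq_abs hd).symm
  have d₂ : hc ^ 2 = |hc| ^ 2 := (sq_abs hc).symm
  rw [d₂] at p₁ p₂
  rw [d₁, d₂]
  congr 2
  · congr 3
    ring
  · congr 2
    rw [condVar_eq p₁.ne', condVar_eq p₂.ne']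
    congr 1 <;> ring

/-- The arguments of both logarithms stay at least 1 on [−1, 1]; by compactness the maximum is then
attained. -/
theorem continuousOn_outerBound (CG : ℝ) {hd hc P : ℝ} (hP : 0 ≤ P) :
    ContinuousOn (fun ρ => outerBound CG (hd ^ 2 * P) (hc ^ 2 * P) ρ) (Set.Icc (-1) 1) := by
  refine ContinuousOn.congr ?_ fun ρ hρ => outerBound_eq CG hP hρ
  have q₁ : ∀ ρ ∈ Set.Icc (-1 : ℝ) 1, 0 ≤ P * (1 + ρ) := fun ρ hρ =>
    mul_nonneg hP (by linarith [hρ.1])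
  have q₂ : ∀ ρ ∈ Set.Icc (-1 : ℝ) 1, 0 ≤ P * (1 - ρ) := fun ρ hρ =>
    mul_nonneg hP (by linarith [hρ.2])
  have c₁ : ContinuousOn (fun ρ : ℝ => condVar ((|hd| + |hc|) ^ 2) (hc ^ 2) (P * (1 + ρ)))
      (Set.Icc (-1) 1) := by
    unfold condVar
    refine continuousOn_const.add (ContinuousOn.div (by fun_prop) (by fun_prop) fun ρ hρ => ?_)
    have := q₁ ρ hρ
    positivity
  have c₂ : ContinuousOn (fun ρ : ℝ => condVar ((|hd| - |hc|) ^ 2) (hc ^ 2) (P * (1 - ρ)))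
      (Set.Icc (-1) 1) := by
    unfold condVar
    refine continuousOn_const.add (ContinuousOn.div (by fun_prop) (by fun_prop) fun ρ hρ => ?_)
    have := q₂ ρ hρ
    positivity
  have l₁ : ContinuousOn (fun ρ : ℝ =>
      Real.logb 2 (1 + (hd ^ 2 + hc ^ 2 + 2 * ρ * (|hd| * |hc|)) * P)) (Set.Icc (-1) 1) := by
    refine ContinuousOn.div_const (ContinuousOn.log (by fun_prop) fun ρ hρ => ?_) _
    have := Code.received_power_nonneg (hd := |hd|) (hc := |hc|) hρ
    rw [sq_abs, sq_abs] at this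
    positivity
  have l₂ : ContinuousOn (fun ρ : ℝ =>
      Real.logb 2 (condVar ((|hd| + |hc|) ^ 2) (hc ^ 2) (P * (1 + ρ))
        * condVar ((|hd| - |hc|) ^ 2) (hc ^ 2) (P * (1 - ρ)))) (Set.Icc (-1) 1) := by
    refine ContinuousOn.div_const (ContinuousOn.log (c₁.mul c₂) fun ρ hρ => ?_) _
    have h₁ := one_le_condVar (sq_nonneg (|hd| + |hc|)) (sq_nonneg hc) (q₁ ρ hρ)
    have h₂ := one_le_condVar (sq_nonneg (|hd| - |hc|)) (sq_nonneg hc) (q₂ ρ hρ)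
    exact (mul_pos (zero_lt_one.trans_le h₁) (zero_lt_one.trans_le h₂)).ne'
  fun_prop

/-- Reversing the sign of the correlation compensates for cross gains of opposite sign. -/
theorem exists_outerBound_eq (CG : ℝ) {hd hc P ρ : ℝ} (hP : 0 ≤ P) (hρ : ρ ∈ Set.Icc (-1 : ℝ) 1) :
    ∃ ρ' ∈ Set.Icc (-1 : ℝ) 1, outerBound CG (hd ^ 2 * P) (hc ^ 2 * P) ρ'
      = (1 / 3) * (2 * CG + (1 / 2) * Real.logb 2 (1 + (hd ^ 2 + hc ^ 2 + 2 * ρ * (hd * hc)) * P)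
        + (1 / 2) * Real.logb 2 (condVar ((hd + hc) ^ 2) (hc ^ 2) (P * (1 + ρ))
          * condVar ((hd - hc) ^ 2) (hc ^ 2) (P * (1 - ρ)))) := by
  have e₁ : (|hd| + |hc|) ^ 2 = hd ^ 2 + hc ^ 2 + 2 * (|hd * hc|) := by
    rw [abs_mul]; linear_combination sq_abs hd + sq_abs hc
  have e₂ : (|hd| - |hc|) ^ 2 = hd ^ 2 + hc ^ 2 - 2 * (|hd * hc|) := by
    rw [abs_mul]; linear_combination sq_abs hd + sq_abs hc
  rcases le_total 0 (hd * hc) with h | h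
  · refine ⟨ρ, hρ, ?_⟩
    rw [outerBound_eq CG hP hρ, e₁, e₂, ← abs_mul, abs_of_nonneg h,
      show hd ^ 2 + hc ^ 2 + 2 * (hd * hc) = (hd + hc) ^ 2 by ring,
      show hd ^ 2 + hc ^ 2 - 2 * (hd * hc) = (hd - hc) ^ 2 by ring]
  · have hρ' : -ρ ∈ Set.Icc (-1 : ℝ) 1 := ⟨by linarith [hρ.2], by linarith [hρ.1]⟩
    refine ⟨-ρ, hρ', ?_⟩
    rw [outerBound_eq CG hP hρ', e₁, e₂, ← abs_mul, abs_of_nonpos h,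
      show hd ^ 2 + hc ^ 2 + 2 * -(hd * hc) = (hd - hc) ^ 2 by ring,
      show hd ^ 2 + hc ^ 2 - 2 * -(hd * hc) = (hd + hc) ^ 2 by ring,
      show 2 * -ρ * -(hd * hc) = 2 * ρ * (hd * hc) by ring, ← sub_eq_add_neg, sub_neg_eq_add,
      mul_comm (condVar ((hd - hc) ^ 2) (hc ^ 2) (P * (1 - ρ)))]

/-- The rate bound for one code, in bits per channel use. -/
theorem Code.rate_le {N M₁ M₂ : ℕ} (hN : 0 < N) (h₁ : 0 < M₁) (h₂ : 0 < M₂) (c : Code N M₁ M₂)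
    {hd hc P CG ε R : ℝ} (hP : 0 ≤ P) (hε : 0 ≤ ε) (hε1 : ε ≤ 1) (hL : c.LinkConstraint CG)
    (hpow : c.PowerConstraint P) (hrel : c.Reliable hd hc ε) (hsec : c.WeaklySecret hd hc ε)
    (hR₁ : N * R ≤ Real.logb 2 M₁) (hR₂ : N * R ≤ Real.logb 2 M₂) :
    ∃ ρ ∈ Set.Icc (-1 : ℝ) 1,
      (1 - ε) * R - 1 / N - ε ≤ outerBound CG (hd ^ 2 * P) (hc ^ 2 * P) ρ := by
  have : NeZero M₁ := ⟨h₁.ne'⟩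
  have : NeZero M₂ := ⟨h₂.ne'⟩
  obtain ⟨ρ, hρ, h⟩ := c.rate_bound hP hε hL hpow hrel hsec
  obtain ⟨ρ', hρ', he⟩ := exists_outerBound_eq CG (hd := hd) (hc := hc) hP hρ
  refine ⟨ρ', hρ', ?_⟩
  rw [he]
  have hl2 : 0 < Real.log 2 := Real.log_pos one_lt_two
  have hN' : (0 : ℝ) < N := by exact_mod_cast hN
  unfold Real.logb at *
  set A := Real.log (1 + (hd ^ 2 + hc ^ 2 + 2 * ρ * (hd * hc)) * P)
  set B := Real.log (condVar ((hd + hc) ^ 2) (hc ^ 2) (P * (1 + ρ))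
            * condVar ((hd - hc) ^ 2) (hc ^ 2) (P * (1 - ρ)))
  rw [le_div_iff₀ hl2] at hR₁ hR₂
  have hε' : 0 ≤ 1 - ε := by linarith
  have m₁ := mul_le_mul_of_nonneg_left hR₁ hε'
  have m₂ := mul_le_mul_of_nonneg_left hR₂ hε'
  -- Used to weaken the leakage N ε log 2 to 3 N ε log 2, which becomes the term ε after division by
  -- 3 N log 2; the decoding term 3 log 2 becomes 1 / N.
  have hNε : 0 ≤ N * ε * Real.log 2 := by positivity
  have key : 3 * N * Real.log 2 * ((1 - ε) * R - 1 / N - ε)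
      ≤ 3 * N * Real.log 2 * (1 / 3 * (2 * CG + 1 / 2 * (A / Real.log 2) + 1 / 2 * (B / Real.log 2))) := by
    have e₁ : 3 * N * Real.log 2 * ((1 - ε) * R - 1 / N - ε)
        = 3 * ((1 - ε) * (N * R * Real.log 2)) - 3 * Real.log 2 - 3 * (N * ε * Real.log 2) := by
      field_simp
    have e₂ : 3 * N * Real.log 2
          * (1 / 3 * (2 * CG + 1 / 2 * (A / Real.log 2) + 1 / 2 * (B / Real.log 2)))
        = 2 * N * CG * Real.log 2 + N / 2 * A + N / 2 * B := by
      field_simp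
    rw [e₁, e₂]
    linarith
  exact le_of_mul_le_mul_left key (by positivity)

end GSIC

end

/-! ### The maximum over the correlation and the limit ε → 0 -/

theorem theorem7 (hd hc P CG : ℝ) (hP : 0 ≤ P) (hCG : 0 ≤ CG) :
    ∃ B : ℝ,
      IsGreatest
        ((fun ρ : ℝ => GSIC.outerBound CG (hd ^ 2 * P) (hc ^ 2 * P) ρ) '' Set.Icc (-1) 1) B ∧
      ∀ R : ℝ, GSIC.SymmetricAchievable hd hc P CG R → R ≤ B := by
  obtain ⟨ρ₀, hρ₀, hmax⟩ := isCompact_Icc.exists_isMaxOn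
    (Set.nonempty_Icc.2 (by norm_num : (-1 : ℝ) ≤ 1))
    (GSIC.continuousOn_outerBound CG (hd := hd) (hc := hc) hP)
  set B := GSIC.outerBound CG (hd ^ 2 * P) (hc ^ 2 * P) ρ₀ with hB
  refine ⟨B, ⟨⟨ρ₀, hρ₀, rfl⟩, ?_⟩, fun R hR => ?_⟩
  · rintro _ ⟨ρ, hρ, rfl⟩
    exact hmax hρ
  have key : ∀ ε : ℝ, 0 < ε → ε ≤ 1 → (1 - ε) * (R - ε) - 2 * ε ≤ B := by
    intro ε hε hε1
    -- This block length ensures N > 0 and 1 / N ≤ ε.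
    obtain ⟨N, hcode, hN⟩ := ((hR ε hε).and (Filter.eventually_ge_atTop (⌈1 / ε⌉₊ + 1))).exists
    obtain ⟨M₁, M₂, h₁, h₂, hR₁, hR₂, c, hL, hpow, hrel, hsec⟩ := hcode
    have hN0 : 0 < N := by omega
    obtain ⟨ρ, hρ, h⟩ := c.rate_le hN0 h₁ h₂ hP hε.le hε1 hL hpow hrel hsec hR₁ hR₂
    have hle : GSIC.outerBound CG (hd ^ 2 * P) (hc ^ 2 * P) ρ ≤ B := hmax hρ
    have hNε : 1 / ε ≤ N := (Nat.le_ceil _).trans (by exact_mod_cast (by omega : ⌈1 / ε⌉₊ ≤ N))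
    have : 1 / (N : ℝ) ≤ ε := by
      rw [div_le_iff₀ (by exact_mod_cast hN0)]
      rw [div_le_iff₀ hε] at hNε
      linarith
    linarith
  have hlim : Filter.Tendsto (fun ε : ℝ => (1 - ε) * (R - ε) - 2 * ε)
      (nhdsWithin 0 (Set.Ioi 0)) (nhds R) := by
    have hc : Continuous fun ε : ℝ => (1 - ε) * (R - ε) - 2 * ε := by fun_prop
    have := hc.tendsto 0
    simp only [sub_zero, one_mul, mul_zero] at this
    exact this.mono_left nhdsWithin_le_nhds
  refine le_of_tendsto hlim ?_
  filter_upwards [Ioo_mem_nhdsGT (zero_lt_one (α := ℝ))] with ε hε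
  exact key ε hε.1 hε.2.le
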